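/- Consider the plant $x_{t+1}=Ax_t+B_uu_t+B_ww_t$, $t=0,1,\dots$, with $x_t\in\mathbb R^{n_x}$, $u_t\in\mathbb R^{n_u}$, $w_t\in\mathbb R^{n_w}$ and initial state $x_0$. Assume that $A$ is nonsingular, $(A,B_u)$ is stabilizable, $Q\succeq 0$, $R\succ 0$ and $(A,Q)$ is detectable. Let $w_0,w_1,\dots$ be IID random vectors with $\mathbb E[w_i]=0$ and $\mathbb E[w_iw_j^\top]=\delta_{ij}I$. Let $$J_\infty=\lim_{T\to\infty}\frac1T\sum_{t=0}^{T-1}\bigl(x_t^\top Qx_t+u_t^\top Ru_t\bigr)$$ be the average cost along a trajectory (with the upper limit in $[0,\infty]$ if the limit does not exist). For $p\ge 0$, a policy with $p$ steps of preview is a sequence of conditional laws $\mathrm{Prob}(u_t\mid i_t)$, where $i_t=\{x_0,\dots,x_t,w_0,\dots,w_{t+p}\}$; given all disturbances and the earlier inputs, $u_t$ is drawn from $\mathrm{Prob}(\cdot\mid i_t)$. It is stabilizing if the state is uniformly bounded in mean and in second moment. Let $J^*_{\infty,p}=\min \mathbb E[J_\infty\mid i_0]$ over the stabilizing policies with $p$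 steps of preview. Then the algebraic Riccati equation $P-A^\top PA-Q+A^\top PB_uH^{-1}B_u^\top PA=0$, with $H=R+B_u^\top PB_u$, has a unique stabilizing solution $P$, that is, one with $P\succeq0$, $H\succ0$ and $\hat A:=A-B_uK_x$ Schur (spectral radius $\rho(\hat A)<1$), where $K_x=H^{-1}B_u^\top PA$. Put $K_w=H^{-1}B_u^\top PB_w$ and $K_v=H^{-1}B_u^\top$. The Lyapunov equation $\hat A^\top X\hat A-X+PB_wB_w^\top P=0$ has a unique solution $X$, and $X\succeq0$. Let $Y=K_v^\top HK_v$; then $Y\succeq 0$. The noncausal controller is $$u^{nc}_t=-K_xx_t-K_ww_t-K_vv^{nc}_{t+1},\qquad v^{nc}_{t+1}=\sum_{j=t+1}^\infty(\hat A^\top)^{j-t}PB_ww_j,$$ where the series converge almost surely. Let $J^*_{\infty,nc}=\mathbb E[J_\infty]$ be its expected per-step cost, the limit $J_\infty$ existing almost surely. The minimum $J^*_{\infty,p}$ is attained, by a policy for which the limit $J_\infty$ exists almost surely; both $J^*_{\infty,p}$ and $J^*_{\infty,nc}$ are finite constants, independent of $x_0$ and $i_0$, and for every $p\ge0$ $$J^*_{\infty,p}-J^*_{\infty,nc}=\mathrm{trace}\bigl[Y(\hat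 A^\top)^{p+1}X\hat A^{p+1}\bigr],$$ $$\lambda_{\min}(X^{1/2})^2\,\lambda_{\min}(Y^{1/2})^2\,\|\hat A^{p+1}\|_F^2\;\le\; J^*_{\infty,p}-J^*_{\infty,nc}\;\le\;\|X^{1/2}\|_F^2\,\|Y^{1/2}\|_F^2\,\|\hat A^{p+1}\|_F^2 .$$ Hence the gap decays geometrically in $p$: $\rho(\hat A)<1$; for every $p\ge 0$, $$\lambda_{\min}(X)\lambda_{\min}(Y)\,\rho(\hat A)^{2(p+1)}\le J^*_{\infty,p}-J^*_{\infty,nc},$$ and for every $r>\rho(\hat A)$ there is a constant $C$ with $J^*_{\infty,p}-J^*_{\infty,nc}\le C\,r^{2(p+1)}$ for all $p\ge 0$. -/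

import Mathlib

open MeasureTheory ProbabilityTheory Filter Topology
open scoped ENNReal NNReal Matrix

noncomputable section

namespace PreviewLQR

/-! ### Matrix notions -/

/-- A real square matrix is Schur if its (complex) spectral radius is less than one. -/
def IsSchur {n : ℕ} (M : Matrix (Fin n) (Fin n) ℝ) : Prop :=
  spectralRadius ℂ (M.map (algebraMap ℝ ℂ)) < 1

/-- The (complex) spectral radius of a real square matrix, as a real number. -/
def specRad {n : ℕ} (M : Matrix (Fin n) (Fin n) ℝ) : ℝ :=
  (spectralRadius ℂ (M.map (algebraMap ℝ ℂ))).toReal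

/-- `(A, B)` is stabilizable: some state feedback makes the closed loop Schur. -/
def Stabilizable {n m : ℕ} (A : Matrix (Fin n) (Fin n) ℝ) (B : Matrix (Fin n) (Fin m) ℝ) : Prop :=
  ∃ F : Matrix (Fin m) (Fin n) ℝ, IsSchur (A + B * F)

/-- `(A, C)` is detectable: some output injection makes the error dynamics Schur. -/
def Detectable {n m : ℕ} (A : Matrix (Fin n) (Fin n) ℝ) (C : Matrix (Fin m) (Fin n) ℝ) : Prop :=
  ∃ L : Matrix (Fin n) (Fin m) ℝ, IsSchur (A + L * C)

/-- The Frobenius norm. -/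
def frobNorm {m n : ℕ} (M : Matrix (Fin m) (Fin n) ℝ) : ℝ :=
  (Matrix.frobeniusNormedAddCommGroup (m := Fin m) (n := Fin n) (α := ℝ)).toNorm.norm M

open scoped MatrixOrder in
/-- The positive semidefinite square root of a positive semidefinite matrix. -/
def matSqrt {n : ℕ} (M : Matrix (Fin n) (Fin n) ℝ) : Matrix (Fin n) (Fin n) ℝ :=
  CFC.sqrt M

/-- The smallest eigenvalue of a real symmetric matrix. -/
def lamMin {n : ℕ} (M : Matrix (Fin n) (Fin n) ℝ) : ℝ :=
  sInf (spectrum ℝ M)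

/-! ### Plant, cost, Riccati equation and gains -/

/-- The data of the LTI plant `x_{t+1} = A x_t + B_u u_t + B_w w_t` and of the quadratic cost. -/
structure Data (nx nu nw : ℕ) where
  A : Matrix (Fin nx) (Fin nx) ℝ
  Bu : Matrix (Fin nx) (Fin nu) ℝ
  Bw : Matrix (Fin nx) (Fin nw) ℝ
  Q : Matrix (Fin nx) (Fin nx) ℝ
  R : Matrix (Fin nu) (Fin nu) ℝ

variable {nx nu nw : ℕ}

/-- `H = R + B_uᵀ P B_u`. -/
def Data.H (D : Data nx nu nw) (P : Matrix (Fin nx) (Fin nx) ℝ) : Matrix (Fin nu) (Fin nu) ℝ :=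
  D.R + D.Buᵀ * P * D.Bu

/-- `K_x = H⁻¹ B_uᵀ P A`. -/
def Data.Kx (D : Data nx nu nw) (P : Matrix (Fin nx) (Fin nx) ℝ) : Matrix (Fin nu) (Fin nx) ℝ :=
  (D.H P)⁻¹ * D.Buᵀ * P * D.A

/-- `K_w = H⁻¹ B_uᵀ P B_w`. -/
def Data.Kw (D : Data nx nu nw) (P : Matrix (Fin nx) (Fin nx) ℝ) : Matrix (Fin nu) (Fin nw) ℝ :=
  (D.H P)⁻¹ * D.Buᵀ * P * D.Bw

/-- `K_v = H⁻¹ B_uᵀ`. -/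
def Data.Kv (D : Data nx nu nw) (P : Matrix (Fin nx) (Fin nx) ℝ) : Matrix (Fin nu) (Fin nx) ℝ :=
  (D.H P)⁻¹ * D.Buᵀ

/-- The closed-loop matrix `Â = A - B_u K_x`. -/
def Data.Ahat (D : Data nx nu nw) (P : Matrix (Fin nx) (Fin nx) ℝ) : Matrix (Fin nx) (Fin nx) ℝ :=
  D.A - D.Bu * D.Kx P

/-- `Y = K_vᵀ H K_v`. -/
def Data.Y (D : Data nx nu nw) (P : Matrix (Fin nx) (Fin nx) ℝ) : Matrix (Fin nx) (Fin nx) ℝ :=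
  (D.Kv P)ᵀ * D.H P * D.Kv P

/-- `P` is a stabilizing positive semidefinite solution of the discrete-time algebraic Riccati
equation `0 = P - Aᵀ P A - Q + Aᵀ P B_u H⁻¹ B_uᵀ P A`. -/
structure Data.IsStabilizingSolution (D : Data nx nu nw) (P : Matrix (Fin nx) (Fin nx) ℝ) :
    Prop where
  posSemidef : P.PosSemidef
  H_posDef : (D.H P).PosDef
  dare : P - D.Aᵀ * P * D.A - D.Q + D.Aᵀ * P * D.Bu * (D.H P)⁻¹ * D.Buᵀ * P * D.A = 0
  schur : IsSchur (D.Ahat P)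

/-- `X` solves the Lyapunov equation `Âᵀ X Â - X + P B_w B_wᵀ P = 0`. -/
def Data.IsLyapunovSolution (D : Data nx nu nw) (P X : Matrix (Fin nx) (Fin nx) ℝ) : Prop :=
  (D.Ahat P)ᵀ * X * D.Ahat P - X + P * D.Bw * D.Bwᵀ * P = 0

/-- The state trajectory from `x₀` under the inputs `u` and disturbances `w`. -/
def Data.state (D : Data nx nu nw) (x₀ : Fin nx → ℝ) (u : ℕ → Fin nu → ℝ) (w : ℕ → Fin nw → ℝ) :
    ℕ → Fin nx → ℝ
  | 0 => x₀
  | t + 1 => D.A *ᵥ D.state x₀ u w t + D.Bu *ᵥ u t + D.Bw *ᵥ w t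

/-- The average per-step cost over the first `T` steps. -/
def Data.avgCost (D : Data nx nu nw) (x : ℕ → Fin nx → ℝ) (u : ℕ → Fin nu → ℝ) (T : ℕ) : ℝ :=
  (T : ℝ)⁻¹ * ∑ t ∈ Finset.range T, (x t ⬝ᵥ D.Q *ᵥ x t + u t ⬝ᵥ D.R *ᵥ u t)

/-- The average per-step cost over the infinite horizon of a trajectory. It is written as an upper
limit in `[0, ∞]`, so that it has a value for every trajectory; it is the limit of the averages
whenever that limit exists. -/
def Data.longRunCost (D : Data nx nu nw) (x : ℕ → Fin nx → ℝ) (u : ℕ → Fin nu → ℝ) : ℝ≥0∞ :=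
  limsup (fun T => ENNReal.ofReal (D.avgCost x u T)) atTop

/-! ### Disturbance, policies and the optimal finite preview cost -/

variable {Ω : Type*} [MeasurableSpace Ω]

/-- `w` is IID with `E[w_i] = 0` and `E[w_i w_jᵀ] = δ_{ij} I`. -/
structure IsWhiteNoise (μ : Measure Ω) (w : ℕ → Ω → Fin nw → ℝ) : Prop where
  measurable : ∀ i, Measurable (w i)
  indep : iIndepFun w μ
  identDistrib : ∀ i, IdentDistrib (w i) (w 0) μ μ
  memLp : ∀ i, MemLp (w i) 2 μ
  mean : ∀ i a, ∫ ω, w i ω a ∂μ = 0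
  cov : ∀ i j a b, ∫ ω, w i ω a * w j ω b ∂μ = if i = j ∧ a = b then 1 else 0

/-- The values of the information `{x_0, …, x_t, w_0, …, w_{t+p}}` available at time `t`. -/
abbrev Info (nx nw p t : ℕ) : Type :=
  (Fin (t + 1) → Fin nx → ℝ) × (Fin (t + p + 1) → Fin nw → ℝ)

/-- A (randomized) policy with `p` steps of preview: for each `t` a conditional law
`Prob(u_t | i_t)` of the action given the available information. -/
structure Policy (nx nu nw p : ℕ) where
  law : ∀ t, Kernel (Info nx nw p t) (Fin nu → ℝ)
  isMarkov : ∀ t, IsMarkovKernel (law t)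

/-- The information at time `t` along given state and disturbance sequences. -/
def info (p : ℕ) (x : ℕ → Fin nx → ℝ) (w : ℕ → Fin nw → ℝ) (t : ℕ) : Info nx nw p t :=
  (fun s => x s, fun s => w s)

/-- The σ-algebra generated by the whole disturbance sequence and by the inputs before time `t`. -/
abbrev pastInputs (w : ℕ → Ω → Fin nw → ℝ) (u : ℕ → Ω → Fin nu → ℝ) (t : ℕ) : MeasurableSpace Ω :=
  (⨆ s, MeasurableSpace.comap (w s) inferInstance) ⊔
    ⨆ s : Fin t, MeasurableSpace.comap (u s) inferInstance

/-- The input process `u` results from applying the policy `K` from the initial state `x₀`: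
given the disturbances and the earlier inputs, `u_t` is drawn from `K_t(· | i_t)`; in particular
the draw carries no information about disturbances beyond the preview window. -/
structure Data.IsClosedLoop (D : Data nx nu nw) {p : ℕ} (K : Policy nx nu nw p) (x₀ : Fin nx → ℝ)
    (μ : Measure Ω) (w : ℕ → Ω → Fin nw → ℝ) (u : ℕ → Ω → Fin nu → ℝ) : Prop where
  measurable : ∀ t, Measurable (u t)
  condLaw : ∀ t, ∀ S : Set (Fin nu → ℝ), MeasurableSet S →
    μ⟦u t ⁻¹' S | pastInputs w u t⟧ =ᵐ[μ] fun ω =>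
      (K.law t (info p (D.state x₀ (fun s => u s ω) (fun s => w s ω)) (fun s => w s ω) t)).real S

/-- The closed loop is stabilized: the state is uniformly bounded in mean and second moment. -/
def Data.IsStabilized (D : Data nx nu nw) (x₀ : Fin nx → ℝ)
    (μ : Measure Ω) (w : ℕ → Ω → Fin nw → ℝ) (u : ℕ → Ω → Fin nu → ℝ) : Prop :=
  let x : ℕ → Ω → Fin nx → ℝ := fun t ω => D.state x₀ (fun s => u s ω) (fun s => w s ω) t
  ∃ C : ℝ, ∀ t, MemLp (x t) 2 μ ∧ ‖∫ ω, x t ω ∂μ‖ ≤ C ∧ ∫ ω, x t ω ⬝ᵥ x t ω ∂μ ≤ C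

/-- The random cost `J_∞(K, w, x₀)` along the closed loop. -/
def Data.runCost (D : Data nx nu nw) (x₀ : Fin nx → ℝ)
    (w : ℕ → Ω → Fin nw → ℝ) (u : ℕ → Ω → Fin nu → ℝ) (ω : Ω) : ℝ≥0∞ :=
  D.longRunCost (D.state x₀ (fun s => u s ω) (fun s => w s ω)) (fun s => u s ω)

/-- The σ-algebra of the initial information `i_0 = {x_0, w_0, …, w_p}`, with `x_0` deterministic. -/
abbrev initialInfo (p : ℕ) (w : ℕ → Ω → Fin nw → ℝ) : MeasurableSpace Ω :=
  ⨆ s : Fin (p + 1), MeasurableSpace.comap (w s) inferInstance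

/-- `c` is the optimal cost `min E[J_∞(K, w, x₀) | i_0]` over the stabilizing policies `K` with `p`
steps of preview: almost surely no stabilizing policy does better than `c`, and some stabilizing
policy, along which the defining limit of the average cost exists, achieves `c`. -/
def Data.IsOptimalPreviewCost (D : Data nx nu nw) (μ : Measure Ω) (w : ℕ → Ω → Fin nw → ℝ)
    (x₀ : Fin nx → ℝ) (p : ℕ) (c : ℝ≥0) : Prop :=
  (∃ (K : Policy nx nu nw p) (u : ℕ → Ω → Fin nu → ℝ),
    D.IsClosedLoop K x₀ μ w u ∧ D.IsStabilized x₀ μ w u ∧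
    (∀ᵐ ω ∂μ, ∃ l : ℝ, Tendsto (D.avgCost (D.state x₀ (fun s => u s ω) (fun s => w s ω))
      (fun s => u s ω)) atTop (𝓝 l)) ∧
    condLExp (initialInfo p w) μ (D.runCost x₀ w u) =ᵐ[μ] fun _ => (c : ℝ≥0∞)) ∧
  ∀ (K : Policy nx nu nw p) (u : ℕ → Ω → Fin nu → ℝ),
    D.IsClosedLoop K x₀ μ w u → D.IsStabilized x₀ μ w u →
    (fun _ => (c : ℝ≥0∞)) ≤ᵐ[μ] condLExp (initialInfo p w) μ (D.runCost x₀ w u)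

/-! ### The noncausal controller and its expected cost -/

/-- The terms of the series `v_t = ∑_{j ≥ t} (Âᵀ)^{j-t+1} P B_w w_j`. -/
def Data.vTerm (D : Data nx nu nw) (P : Matrix (Fin nx) (Fin nx) ℝ) (w : ℕ → Fin nw → ℝ)
    (t l : ℕ) : Fin nx → ℝ :=
  ((D.Ahat P)ᵀ ^ (l + 1) * P * D.Bw) *ᵥ w (t + l)

/-- The noncausal preview signal `v^{nc}_t`. -/
def Data.vNC (D : Data nx nu nw) (P : Matrix (Fin nx) (Fin nx) ℝ) (w : ℕ → Fin nw → ℝ)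
    (t : ℕ) : Fin nx → ℝ :=
  ∑' l, D.vTerm P w t l

/-- The noncausal control law `u_t = -K_x x_t - K_w w_t - K_v v^{nc}_{t+1}`. -/
def Data.ncLaw (D : Data nx nu nw) (P : Matrix (Fin nx) (Fin nx) ℝ) (w : ℕ → Fin nw → ℝ)
    (t : ℕ) (x : Fin nx → ℝ) : Fin nu → ℝ :=
  -(D.Kx P *ᵥ x) - D.Kw P *ᵥ w t - D.Kv P *ᵥ D.vNC P w (t + 1)

/-- The state under the noncausal controller. -/
def Data.ncState (D : Data nx nu nw) (P : Matrix (Fin nx) (Fin nx) ℝ) (x₀ : Fin nx → ℝ)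
    (w : ℕ → Fin nw → ℝ) : ℕ → Fin nx → ℝ
  | 0 => x₀
  | t + 1 => D.A *ᵥ D.ncState P x₀ w t + D.Bu *ᵥ D.ncLaw P w t (D.ncState P x₀ w t) + D.Bw *ᵥ w t

/-- The input generated by the noncausal controller. -/
def Data.ncInput (D : Data nx nu nw) (P : Matrix (Fin nx) (Fin nx) ℝ) (x₀ : Fin nx → ℝ)
    (w : ℕ → Fin nw → ℝ) (t : ℕ) : Fin nu → ℝ :=
  D.ncLaw P w t (D.ncState P x₀ w t)

/-- `c` is the expected per-step cost `E[J_∞(K_nc, w, x₀)]` of the noncausal controller; the series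
defining the controller converge and the limit defining `J_∞` exists almost surely. -/
structure Data.IsNoncausalCost (D : Data nx nu nw) (P : Matrix (Fin nx) (Fin nx) ℝ)
    (μ : Measure Ω) (w : ℕ → Ω → Fin nw → ℝ) (x₀ : Fin nx → ℝ) (c : ℝ≥0) : Prop where
  summable : ∀ᵐ ω ∂μ, ∀ t, Summable (D.vTerm P (fun s => w s ω) t)
  limit : ∀ᵐ ω ∂μ, ∃ l : ℝ, Tendsto (D.avgCost (D.ncState P x₀ (fun s => w s ω))
    (D.ncInput P x₀ (fun s => w s ω))) atTop (𝓝 l)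
  cost : ∫⁻ ω, D.longRunCost (D.ncState P x₀ (fun s => w s ω))
    (D.ncInput P x₀ (fun s => w s ω)) ∂μ = c

end PreviewLQR

end

open PreviewLQR

open MeasureTheory ProbabilityTheory Filter Topology
open scoped ENNReal NNReal Matrix


namespace PreviewLQR

/-! ### Powers of Schur matrices -/

/-! The argument is a pathwise completion of squares. For any trajectory and any reference signal
`v`, the Riccati equation rewrites the accumulated cost (`one_step`, `sum_cost`) as a boundary term
plus a sum over `t` of three pieces: the `H`-norm squared of the deviation of `u t` from `-Kx x - Kw
w - Kv v (t+1)`; the pairing of `2 x t` with the defect `Âᵀ (P Bw w t + v (t+1)) - v t`; and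
`noiseCost`, which involves only noise and `v`.

For `v` take the preview signal truncated to `p` terms. The defect is then the single term
`(Âᵀ)^(p+1) P Bw w (t+p)`. Under a policy with `p` steps of preview, `x t` depends on noise before
time `t+p` and on randomization that carries no information about later noise (`indep_history`), so
the pairing averages to zero. The deviation term is nonnegative, so the average of `noiseCost`,
named `previewCost`, is a lower bound. It is attained when the deviation vanishes. For the full
series `vNC` the defect is identically zero and the average of `noiseCost` is `noncausalCost`.

White noise decorrelates distinct lags, so `previewCost` is `tr(Bwᵀ P Bw)` minus the first `p+1`
terms of `tr(Y X)`, where `X = ∑ (Âᵀ)^k P Bw Bwᵀ P Â^k`. `noncausalCost` subtracts all of `tr(Y X)`.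
The gap is the tail of that series, equal to `tr(Y (Âᵀ)^(p+1) X Â^(p+1))`, the squared Frobenius
norm of `X^(1/2) Â^(p+1) Y^(1/2)`. The norm and eigenvalue bounds follow from this form.

All limits are almost sure and use second moments only: `ae_tendsto_div_of_gap` gives a strong law
for orthogonal products, and the classical strong law handles equal lags. Boundary terms are
negligible because states and preview signals are `o(√T)`. For an arbitrary stabilizing policy this
is available only along a subsequence, which suffices to bound an upper limit from below. -/

theorem isSchur_iff_specRad_lt_one {n : ℕ} (M : Matrix (Fin n) (Fin n) ℝ) :
    spectralRadius ℂ (M.map (algebraMap ℝ ℂ)) ≠ ∞ ∧ (IsSchur M ↔ specRad M < 1) := by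
  have hfin : spectralRadius ℂ (M.map (algebraMap ℝ ℂ)) ≠ ∞ := by
    let _ := Matrix.linftyOpNormedRing (n := Fin n) (α := ℂ)
    let _ := Matrix.linftyOpNormedAlgebra (n := Fin n) (R := ℂ) (α := ℂ)
    have := spectrum.spectralRadius_le_pow_nnnorm_pow_one_div ℂ (M.map (algebraMap ℝ ℂ)) 0
    refine ne_top_of_le_ne_top ?_ this
    simp [ENNReal.mul_eq_top]
  refine ⟨hfin, ?_⟩
  rw [IsSchur, specRad, ← ENNReal.toReal_one,
    ENNReal.toReal_lt_toReal hfin ENNReal.one_ne_top]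

theorem specRad_nonneg {n : ℕ} (M : Matrix (Fin n) (Fin n) ℝ) : 0 ≤ specRad M :=
  ENNReal.toReal_nonneg

theorem map_pow_algebraMap {n : ℕ} (M : Matrix (Fin n) (Fin n) ℝ) (k : ℕ) :
    (M.map (algebraMap ℝ ℂ)) ^ k = (M ^ k).map (algebraMap ℝ ℂ) :=
  ((algebraMap ℝ ℂ).mapMatrix.map_pow M k).symm

/-- The entries of the powers of `M` are `O(r ^ k)` for each `r` above the spectral radius. -/
theorem exists_pow_entry_le {n : ℕ} (M : Matrix (Fin n) (Fin n) ℝ) {r : ℝ} (hr : specRad M < r) :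
    ∃ C, 0 ≤ C ∧ ∀ k i j, |(M ^ k) i j| ≤ C * r ^ k := by
  let _ := Matrix.linftyOpNormedRing (n := Fin n) (α := ℂ)
  let _ := Matrix.linftyOpNormedAlgebra (n := Fin n) (R := ℂ) (α := ℂ)
  have hr0 : 0 < r := (specRad_nonneg M).trans_lt hr
  set N := M.map (algebraMap ℝ ℂ) with hN
  have hlt : spectralRadius ℂ N < ENNReal.ofReal r := by
    rw [← ENNReal.ofReal_toReal (isSchur_iff_specRad_lt_one M).1]
    exact (ENNReal.ofReal_lt_ofReal_iff hr0).2 hr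
  have hev := (spectrum.pow_norm_pow_one_div_tendsto_nhds_spectralRadius N).eventually_lt_const hlt
  -- Gelfand's formula controls only large `k`. An eventually bounded real sequence is bounded,
  -- which absorbs the remaining finitely many powers into `C`.
  have hb : IsBoundedUnder (· ≤ ·) atTop (fun k => ‖N ^ k‖ / r ^ k) := by
    refine ⟨1, ?_⟩
    rw [eventually_map]
    filter_upwards [hev, eventually_gt_atTop 0] with k hk hk0
    rw [div_le_one (pow_pos hr0 k)]
    have h1 : ‖N ^ k‖ ^ (1 / (k : ℝ)) < r := (ENNReal.ofReal_lt_ofReal_iff hr0).1 hk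
    have h2 : (‖N ^ k‖ ^ (1 / (k : ℝ))) ^ k = ‖N ^ k‖ := by
      rw [one_div, Real.rpow_inv_natCast_pow (norm_nonneg _) hk0.ne']
    rw [← h2]
    exact pow_le_pow_left₀ (Real.rpow_nonneg (norm_nonneg _) _) h1.le k
  obtain ⟨C, hC⟩ := hb.bddAbove_range
  have hC' : ∀ k, ‖N ^ k‖ ≤ C * r ^ k := fun k => by
    rw [← div_le_iff₀ (pow_pos hr0 k)]
    exact hC ⟨k, rfl⟩
  refine ⟨C, ?_, fun k i j => ?_⟩
  · have := hC' 0
    simp only [pow_zero, mul_one] at this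
    exact (norm_nonneg _).trans this
  · refine le_trans ?_ (hC' k)
    rw [map_pow_algebraMap]
    have h3 : |(M ^ k) i j| = ‖((M ^ k).map (algebraMap ℝ ℂ)) i j‖ := by simp
    rw [h3]
    have h4 := Matrix.linfty_opNNNorm_def ((M ^ k).map (algebraMap ℝ ℂ))
    have h5 : ‖((M ^ k).map (algebraMap ℝ ℂ)) i j‖₊ ≤ ‖(M ^ k).map (algebraMap ℝ ℂ)‖₊ := by
      rw [h4]
      exact (Finset.single_le_sum (f := fun j => ‖((M ^ k).map (algebraMap ℝ ℂ)) i j‖₊)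
        (fun _ _ => zero_le) (Finset.mem_univ j)).trans
        (Finset.le_sup (f := fun i => ∑ j, ‖((M ^ k).map (algebraMap ℝ ℂ)) i j‖₊)
          (Finset.mem_univ i))
    exact_mod_cast h5

/-- The entries of the powers of `M` decay geometrically. -/
def PowDecay {n : ℕ} (M : Matrix (Fin n) (Fin n) ℝ) : Prop :=
  ∃ C r : ℝ, 0 ≤ C ∧ 0 < r ∧ r < 1 ∧ ∀ k i j, |(M ^ k) i j| ≤ C * r ^ k

theorem IsSchur.powDecay {n : ℕ} {M : Matrix (Fin n) (Fin n) ℝ} (h : IsSchur M) : PowDecay M := by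
  obtain ⟨r, hr1, hr2⟩ := exists_between ((isSchur_iff_specRad_lt_one M).2.1 h)
  obtain ⟨C, hC, hM⟩ := exists_pow_entry_le M hr1
  exact ⟨C, r, hC, (specRad_nonneg M).trans_lt hr1, hr2, hM⟩

theorem PowDecay.transpose {n : ℕ} {M : Matrix (Fin n) (Fin n) ℝ} (h : PowDecay M) :
    PowDecay Mᵀ := by
  obtain ⟨C, r, h0, h1, h2, h3⟩ := h
  refine ⟨C, r, h0, h1, h2, fun k i j => ?_⟩
  rw [← Matrix.transpose_pow]
  exact h3 k j i

/-- Products of decaying powers with a fixed matrix in between decay entrywise. -/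
theorem abs_mul_mul_entry_le {m n p q : ℕ} (L : Matrix (Fin m) (Fin n) ℝ)
    (W : Matrix (Fin n) (Fin p) ℝ) (N : Matrix (Fin p) (Fin q) ℝ) {a b : ℝ}
    (hL : ∀ i j, |L i j| ≤ a) (hN : ∀ i j, |N i j| ≤ b) (ha : 0 ≤ a) (i : Fin m) (j : Fin q) :
    |(L * W * N) i j| ≤ a * (∑ k, ∑ l, |W k l|) * b := by
  simp only [Matrix.mul_apply, Finset.sum_mul, Finset.mul_sum]
  rw [Finset.sum_comm]
  refine (Finset.abs_sum_le_sum_abs _ _).trans (Finset.sum_le_sum fun k _ => ?_)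
  refine (Finset.abs_sum_le_sum_abs _ _).trans (Finset.sum_le_sum fun l _ => ?_)
  rw [abs_mul, abs_mul]
  have := hL i k
  have := hN l j
  gcongr

/-- The Lyapunov series of a matrix with decaying powers. -/
theorem PowDecay.summable_lyapunov {n : ℕ} {M : Matrix (Fin n) (Fin n) ℝ} (h : PowDecay M)
    (W : Matrix (Fin n) (Fin n) ℝ) : Summable (fun k => (Mᵀ) ^ k * W * M ^ k) := by
  obtain ⟨C, r, h0, h1, h2, h3⟩ := h
  refine Pi.summable.2 fun i => Pi.summable.2 fun j => ?_
  have hr2 : r * r < 1 := by nlinarith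
  refine Summable.of_norm_bounded
    (g := fun k => (C * (∑ k, ∑ l, |W k l|) * C) * (r * r) ^ k)
    ((summable_geometric_of_lt_one (by positivity) hr2).mul_left _) fun k => ?_
  have := abs_mul_mul_entry_le ((Mᵀ) ^ k) W (M ^ k) (a := C * r ^ k) (b := C * r ^ k)
    (fun i j => by rw [← Matrix.transpose_pow]; exact h3 k j i) (h3 k) (by positivity) i j
  rw [Real.norm_eq_abs]
  refine this.trans (le_of_eq ?_)
  rw [mul_pow]; ring

theorem PowDecay.tendsto_zero {n : ℕ} {M N : Matrix (Fin n) (Fin n) ℝ} (hM : PowDecay M)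
    (hN : PowDecay N) (W : Matrix (Fin n) (Fin n) ℝ) :
    Tendsto (fun k => (Mᵀ) ^ k * W * N ^ k) atTop (𝓝 0) := by
  obtain ⟨C, r, h0, h1, h2, h3⟩ := hM
  obtain ⟨C', r', h0', h1', h2', h3'⟩ := hN
  refine tendsto_pi_nhds.2 fun i => tendsto_pi_nhds.2 fun j => ?_
  have hr2 : r * r' < 1 := by nlinarith
  refine squeeze_zero_norm (a := fun k => (C * (∑ k, ∑ l, |W k l|) * C') * (r * r') ^ k)
    (fun k => ?_) ?_
  · have := abs_mul_mul_entry_le ((Mᵀ) ^ k) W (N ^ k) (a := C * r ^ k) (b := C' * r' ^ k)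
      (fun i j => by rw [← Matrix.transpose_pow]; exact h3 k j i) (h3' k) (by positivity) i j
    rw [Real.norm_eq_abs]
    refine this.trans (le_of_eq ?_)
    rw [mul_pow]; ring
  · simpa using (tendsto_pow_atTop_nhds_zero_of_lt_one (by positivity) hr2).const_mul
      (C * (∑ k, ∑ l, |W k l|) * C')

/-- A homogeneous Sylvester equation with decaying powers has only the zero solution. -/
theorem PowDecay.eq_zero_of_eq {n : ℕ} {M N : Matrix (Fin n) (Fin n) ℝ} (hM : PowDecay M)
    (hN : PowDecay N) {W : Matrix (Fin n) (Fin n) ℝ} (hW : W = Mᵀ * W * N) : W = 0 := by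
  -- Iterating the equation makes `W` the constant value of a sequence that tends to zero.
  have hk : ∀ k, (Mᵀ) ^ k * W * N ^ k = W := by
    intro k
    induction k with
    | zero => simp
    | succ k ih =>
      calc Mᵀ ^ (k + 1) * W * N ^ (k + 1) = Mᵀ ^ k * (Mᵀ * W * N) * N ^ k := by
            rw [pow_succ, pow_succ']; simp only [Matrix.mul_assoc]
        _ = W := by rw [← hW, ih]
  have := hM.tendsto_zero hN W
  simp only [hk] at this
  exact tendsto_nhds_unique tendsto_const_nhds this

/-- The solution of the discrete Lyapunov equation. -/
theorem PowDecay.exists_lyapunov {n : ℕ} {M : Matrix (Fin n) (Fin n) ℝ} (h : PowDecay M)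
    (W : Matrix (Fin n) (Fin n) ℝ) : ∃ X, Mᵀ * X * M - X + W = 0 := by
  have hs := h.summable_lyapunov W
  refine ⟨∑' k, (Mᵀ) ^ k * W * M ^ k, ?_⟩
  rw [hs.tsum_eq_zero_add]
  have h1 : Mᵀ * (∑' k, (Mᵀ) ^ k * W * M ^ k) * M = ∑' k, (Mᵀ) ^ (k + 1) * W * M ^ (k + 1) := by
    rw [← hs.tsum_mul_left, ← (hs.mul_left _).tsum_mul_right]
    refine tsum_congr fun k => ?_
    rw [pow_succ', pow_succ M]; simp only [Matrix.mul_assoc]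
  rw [hs.tsum_eq_zero_add] at h1
  rw [h1]
  simp

theorem PowDecay.lyapunov_unique {n : ℕ} {M : Matrix (Fin n) (Fin n) ℝ} (h : PowDecay M)
    {W X X' : Matrix (Fin n) (Fin n) ℝ} (hX : Mᵀ * X * M - X + W = 0)
    (hX' : Mᵀ * X' * M - X' + W = 0) : X = X' := by
  refine sub_eq_zero.1 (h.eq_zero_of_eq h ?_)
  rw [Matrix.mul_sub, Matrix.sub_mul]
  have := hX.trans hX'.symm
  rw [← sub_eq_zero] at this ⊢
  rw [← neg_eq_zero, ← this]
  abel

/-- Unrolling `X = W + Mᵀ X M`. As `k → ∞` it exhibits `X` as a limit of partial sums. At `k = p +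
1` the partial sum is the part of `X` reached by `p` steps of preview, and the remainder produces
the gap. -/
theorem lyapunov_iterate {n : ℕ} {M W X : Matrix (Fin n) (Fin n) ℝ}
    (hX : Mᵀ * X * M - X + W = 0) (k : ℕ) :
    X = (∑ i ∈ Finset.range k, (Mᵀ) ^ i * W * M ^ i) + (Mᵀ) ^ k * X * M ^ k := by
  induction k with
  | zero => simp
  | succ k ih =>
    have h1 : X = W + Mᵀ * X * M := by
      rw [← sub_eq_zero, ← neg_eq_zero, ← hX]; abel
    rw [Finset.sum_range_succ, add_assoc]
    conv_lhs => rw [ih]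
    congr 1
    conv_lhs => rw [h1]
    rw [Matrix.mul_add, Matrix.add_mul, pow_succ, pow_succ' M]
    simp only [Matrix.mul_assoc]

theorem isClosed_posSemidef (n : ℕ) :
    IsClosed {M : Matrix (Fin n) (Fin n) ℝ | M.PosSemidef} := by
  simp only [Matrix.posSemidef_iff_dotProduct_mulVec, Matrix.IsHermitian, Set.ofPred_and,
    Set.ofPred_forall]
  refine IsClosed.inter (isClosed_eq (by fun_prop) (by fun_prop)) (isClosed_iInter fun x => ?_)
  exact isClosed_le (by fun_prop) (by fun_prop)

/-- Each partial sum of the Lyapunov series is a sum of congruences of `W`, and the positive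
semidefinite cone is closed. -/
theorem PowDecay.lyapunov_posSemidef {n : ℕ} {M : Matrix (Fin n) (Fin n) ℝ} (h : PowDecay M)
    {W X : Matrix (Fin n) (Fin n) ℝ} (hW : W.PosSemidef) (hX : Mᵀ * X * M - X + W = 0) :
    X.PosSemidef := by
  have h1 : ∀ k, (∑ i ∈ Finset.range k, (Mᵀ) ^ i * W * M ^ i) = X - (Mᵀ) ^ k * X * M ^ k :=
    fun k => eq_sub_of_add_eq (lyapunov_iterate hX k).symm
  have h2 : Tendsto (fun k => ∑ i ∈ Finset.range k, (Mᵀ) ^ i * W * M ^ i) atTop (𝓝 X) := by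
    simp only [h1]
    simpa using tendsto_const_nhds.sub (h.tendsto_zero h X)
  refine (isClosed_posSemidef n).mem_of_tendsto h2 (Eventually.of_forall fun k => ?_)
  refine Matrix.posSemidef_sum _ fun i _ => ?_
  have := hW.conjTranspose_mul_mul_same (M ^ i)
  rwa [Matrix.conjTranspose_eq_transpose_of_trivial, Matrix.transpose_pow] at this

end PreviewLQR

namespace PreviewLQR

/-! ### Eigenvectors and Schur matrices -/

theorem isSchur_iff_forall_eigenvector {n : ℕ} (M : Matrix (Fin n) (Fin n) ℝ) :
    IsSchur M ↔ ∀ (z : ℂ) (v : Fin n → ℂ), v ≠ 0 → M.map (algebraMap ℝ ℂ) *ᵥ v = z • v → ‖z‖ < 1 := by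
  let _ := Matrix.linftyOpNormedRing (n := Fin n) (α := ℂ)
  let _ := Matrix.linftyOpNormedAlgebra (n := Fin n) (R := ℂ) (α := ℂ)
  have hmem : ∀ z, z ∈ spectrum ℂ (M.map (algebraMap ℝ ℂ)) ↔
      ∃ v : Fin n → ℂ, v ≠ 0 ∧ M.map (algebraMap ℝ ℂ) *ᵥ v = z • v := by
    intro z
    rw [spectrum.mem_iff, Matrix.isUnit_iff_isUnit_det, isUnit_iff_ne_zero, not_not,
      ← Matrix.exists_mulVec_eq_zero_iff]
    simp only [Matrix.sub_mulVec, sub_eq_zero, Algebra.algebraMap_eq_smul_one, Matrix.smul_mulVec,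
      Matrix.one_mulVec, eq_comm]
  constructor
  · intro h z v hv hz
    have h1 : (‖z‖₊ : ℝ≥0∞) ≤ spectralRadius ℂ (M.map (algebraMap ℝ ℂ)) :=
      le_iSup₂ (f := fun k (_ : k ∈ spectrum ℂ (M.map (algebraMap ℝ ℂ))) => (‖k‖₊ : ℝ≥0∞)) z
        ((hmem z).2 ⟨v, hv, hz⟩)
    have h2 := h1.trans_lt h
    exact_mod_cast h2
  · intro h
    -- In dimension zero the spectrum is empty and its supremum is `0`. Otherwise the strict bound
    -- passes to the supremum.
    rcases Nat.eq_zero_or_pos n with rfl | hn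
    · rw [IsSchur, spectralRadius]
      simp
    · have : Nonempty (Fin n) := ⟨⟨0, hn⟩⟩
      rw [IsSchur, ← ENNReal.coe_one]
      refine spectrum.spectralRadius_lt_of_forall_lt _ fun z hz => ?_
      obtain ⟨v, hv, hz⟩ := (hmem z).1 hz
      exact_mod_cast h z v hv hz

/-- Schur matrices in terms of the real and imaginary parts of their eigenvectors. -/
theorem isSchur_iff_real {n : ℕ} (M : Matrix (Fin n) (Fin n) ℝ) :
    IsSchur M ↔ ∀ (α β : ℝ) (a b : Fin n → ℝ), (a ≠ 0 ∨ b ≠ 0) →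
      M *ᵥ a = α • a - β • b → M *ᵥ b = β • a + α • b → α ^ 2 + β ^ 2 < 1 := by
  have hnorm : ∀ z : ℂ, ‖z‖ < 1 ↔ z.re ^ 2 + z.im ^ 2 < 1 := by
    intro z
    rw [← sq_lt_one_iff₀ (norm_nonneg z), Complex.sq_norm, Complex.normSq_apply, sq, sq]
  have hre : ∀ (v : Fin n → ℂ) i, ((M.map (algebraMap ℝ ℂ) *ᵥ v) i).re =
      (M *ᵥ fun j => (v j).re) i := by
    intro v i
    simp [Matrix.mulVec, dotProduct]
  have him : ∀ (v : Fin n → ℂ) i, ((M.map (algebraMap ℝ ℂ) *ᵥ v) i).im =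
      (M *ᵥ fun j => (v j).im) i := by
    intro v i
    simp [Matrix.mulVec, dotProduct]
  rw [isSchur_iff_forall_eigenvector]
  constructor
  · intro h α β a b hab ha hb
    have := h ⟨α, β⟩ (fun j => ⟨a j, b j⟩) ?_ ?_
    · exact (hnorm _).1 this
    · intro h0
      rcases hab with h1 | h1
      · exact h1 (funext fun j => congrArg Complex.re (congrFun h0 j))
      · exact h1 (funext fun j => congrArg Complex.im (congrFun h0 j))
    · funext i
      apply Complex.ext
      · rw [hre]; simpa using congrFun ha i
      · rw [him]
        have := congrFun hb i
        simp only [Pi.add_apply, Pi.smul_apply, smul_eq_mul] at this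
        simp only [Pi.smul_apply, smul_eq_mul, Complex.mul_im]
        rw [this]; ring
  · intro h z v hv hz
    refine (hnorm z).2 (h z.re z.im (fun j => (v j).re) (fun j => (v j).im) ?_ ?_ ?_)
    · by_contra! h0
      exact hv (funext fun j => Complex.ext (congrFun h0.1 j) (congrFun h0.2 j))
    · funext i
      rw [← hre, hz]; simp
    · funext i
      rw [← him, hz]; simp; ring

/-! ### The Riccati equation -/

variable {nx nu nw : ℕ}

/-- The Riccati operator. -/
noncomputable def Data.ric (D : Data nx nu nw) (P : Matrix (Fin nx) (Fin nx) ℝ) : Matrix (Fin nx) (Fin nx) ℝ :=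
  D.Q + D.Aᵀ * P * D.A - D.Aᵀ * P * D.Bu * (D.H P)⁻¹ * D.Buᵀ * P * D.A

/-- One step of policy evaluation for the state feedback `u = K x`. -/
def Data.gainCost (D : Data nx nu nw) (P : Matrix (Fin nx) (Fin nx) ℝ)
    (K : Matrix (Fin nu) (Fin nx) ℝ) : Matrix (Fin nx) (Fin nx) ℝ :=
  (D.A + D.Bu * K)ᵀ * P * (D.A + D.Bu * K) + D.Q + Kᵀ * D.R * K

theorem posSemidef_transpose_eq {n : ℕ} {M : Matrix (Fin n) (Fin n) ℝ} (h : M.PosSemidef) :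
    Mᵀ = M := by
  have := h.isHermitian
  rwa [Matrix.IsHermitian, Matrix.conjTranspose_eq_transpose_of_trivial] at this

theorem posSemidef_transpose_mul_mul {n m : ℕ} {M : Matrix (Fin n) (Fin n) ℝ}
    (h : M.PosSemidef) (B : Matrix (Fin n) (Fin m) ℝ) : (Bᵀ * M * B).PosSemidef := by
  have := h.conjTranspose_mul_mul_same B
  rwa [Matrix.conjTranspose_eq_transpose_of_trivial] at this

theorem Data.H_posDef' (D : Data nx nu nw) (hR : D.R.PosDef) {P : Matrix (Fin nx) (Fin nx) ℝ}
    (hP : P.PosSemidef) : (D.H P).PosDef :=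
  hR.add_posSemidef (posSemidef_transpose_mul_mul hP D.Bu)

theorem Data.H_mul_Kx (D : Data nx nu nw) {P : Matrix (Fin nx) (Fin nx) ℝ}
    (hH : (D.H P).PosDef) : D.H P * D.Kx P = D.Buᵀ * P * D.A := by
  rw [Data.Kx]
  simp only [← Matrix.mul_assoc]
  rw [Matrix.mul_nonsing_inv _ ((Matrix.isUnit_iff_isUnit_det _).1 hH.isUnit), Matrix.one_mul]

theorem Data.KxT_mul_H (D : Data nx nu nw) {P : Matrix (Fin nx) (Fin nx) ℝ} (hP : Pᵀ = P)
    (hH : (D.H P).PosDef) : (D.Kx P)ᵀ * D.H P = D.Aᵀ * P * D.Bu := by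
  have h := congrArg Matrix.transpose (D.H_mul_Kx hH)
  simpa [Matrix.transpose_mul, hP, posSemidef_transpose_eq hH.posSemidef, Matrix.mul_assoc] using h

/-- Completion of the square in `K`, the cross terms being supplied by `H Kx = Buᵀ P A`. As `H` is
positive definite, the Riccati operator is the minimum of the policy evaluations over all gains,
attained at `-Kx`. -/
theorem Data.gainCost_eq (D : Data nx nu nw) {P : Matrix (Fin nx) (Fin nx) ℝ} (hP : Pᵀ = P)
    (hH : (D.H P).PosDef) (K : Matrix (Fin nu) (Fin nx) ℝ) :
    D.gainCost P K = D.ric P + (K + D.Kx P)ᵀ * D.H P * (K + D.Kx P) := by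
  have h1 := D.H_mul_Kx hH
  have h2 := D.KxT_mul_H hP hH
  have h3 : D.Aᵀ * P * D.Bu * (D.H P)⁻¹ * D.Buᵀ * P * D.A = D.Aᵀ * P * D.Bu * D.Kx P := by
    simp only [Data.Kx, Matrix.mul_assoc]
  have h4 : (K + D.Kx P)ᵀ * D.H P * (K + D.Kx P) = Kᵀ * D.R * K + Kᵀ * D.Buᵀ * P * D.Bu * K +
      Kᵀ * D.Buᵀ * P * D.A + D.Aᵀ * P * D.Bu * K + D.Aᵀ * P * D.Bu * D.Kx P := by
    rw [Matrix.transpose_add, Matrix.add_mul, h2, Matrix.mul_add, Matrix.add_mul, Matrix.add_mul,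
      Matrix.mul_assoc Kᵀ (D.H P) (D.Kx P), h1, Data.H, Matrix.mul_add, Matrix.add_mul]
    simp only [Matrix.mul_assoc]
    abel
  rw [h4, Data.gainCost, Data.ric, h3]
  simp only [Matrix.transpose_add, Matrix.transpose_mul, Matrix.add_mul, Matrix.mul_add,
    ← Matrix.mul_assoc]
  abel

theorem Data.ric_eq_gainCost (D : Data nx nu nw) {P : Matrix (Fin nx) (Fin nx) ℝ} (hP : Pᵀ = P)
    (hH : (D.H P).PosDef) : D.ric P = D.gainCost P (-D.Kx P) := by
  rw [D.gainCost_eq hP hH]; simp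

open scoped MatrixOrder

theorem Data.gainCost_mono (D : Data nx nu nw) {P P' : Matrix (Fin nx) (Fin nx) ℝ} (h : P ≤ P')
    (K : Matrix (Fin nu) (Fin nx) ℝ) : D.gainCost P K ≤ D.gainCost P' K := by
  rw [Matrix.le_iff] at h ⊢
  have := posSemidef_transpose_mul_mul h (D.A + D.Bu * K)
  rw [Matrix.mul_sub, Matrix.sub_mul] at this
  have e : D.gainCost P' K - D.gainCost P K = (D.A + D.Bu * K)ᵀ * P' * (D.A + D.Bu * K) -
      (D.A + D.Bu * K)ᵀ * P * (D.A + D.Bu * K) := by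
    simp only [Data.gainCost]
    abel
  rwa [e]

theorem Data.ric_le_gainCost (D : Data nx nu nw) (hR : D.R.PosDef)
    {P : Matrix (Fin nx) (Fin nx) ℝ} (hP : P.PosSemidef) (K : Matrix (Fin nu) (Fin nx) ℝ) :
    D.ric P ≤ D.gainCost P K := by
  have hH := D.H_posDef' hR hP
  rw [D.gainCost_eq (posSemidef_transpose_eq hP) hH, Matrix.le_iff, add_sub_cancel_left]
  exact posSemidef_transpose_mul_mul hH.posSemidef _

/-- A minimum of monotone maps is monotone: the gain optimal for `P'` is merely admissible for `P`.
-/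
theorem Data.ric_mono (D : Data nx nu nw) (hR : D.R.PosDef)
    {P P' : Matrix (Fin nx) (Fin nx) ℝ} (hP : P.PosSemidef) (hP' : P'.PosSemidef) (h : P ≤ P') :
    D.ric P ≤ D.ric P' := by
  rw [D.ric_eq_gainCost (posSemidef_transpose_eq hP') (D.H_posDef' hR hP')]
  exact (D.ric_le_gainCost hR hP _).trans (D.gainCost_mono h _)

theorem Data.ric_posSemidef (D : Data nx nu nw) (hQ : D.Q.PosSemidef) (hR : D.R.PosDef)
    {P : Matrix (Fin nx) (Fin nx) ℝ} (hP : P.PosSemidef) : (D.ric P).PosSemidef := by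
  rw [D.ric_eq_gainCost (posSemidef_transpose_eq hP) (D.H_posDef' hR hP), Data.gainCost]
  exact ((posSemidef_transpose_mul_mul hP _).add hQ).add
    (posSemidef_transpose_mul_mul hR.posSemidef _)

/-- A monotone bounded sequence of positive semidefinite matrices converges. -/
theorem exists_tendsto_of_monotone_posSemidef {n : ℕ} {V : ℕ → Matrix (Fin n) (Fin n) ℝ}
    (hpos : ∀ k, (V k).PosSemidef) (hmono : Monotone V) {S : Matrix (Fin n) (Fin n) ℝ}
    (hS : ∀ k, V k ≤ S) : ∃ P, Tendsto V atTop (𝓝 P) := by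
  have hq : ∀ x : Fin n → ℝ, ∃ l, Tendsto (fun k => x ⬝ᵥ V k *ᵥ x) atTop (𝓝 l) := by
    intro x
    have hle : ∀ {M N : Matrix (Fin n) (Fin n) ℝ}, M ≤ N → x ⬝ᵥ M *ᵥ x ≤ x ⬝ᵥ N *ᵥ x := by
      intro M N h
      have := (Matrix.le_iff.1 h).dotProduct_mulVec_nonneg x
      rw [Matrix.sub_mulVec, dotProduct_sub] at this
      simpa using this
    exact ⟨_, tendsto_atTop_ciSup (fun i j hij => hle (hmono hij))
      ⟨x ⬝ᵥ S *ᵥ x, by rintro _ ⟨k, rfl⟩; exact hle (hS k)⟩⟩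
  choose l hl using hq
  -- Polarization recovers the limits of the entries from those of the quadratic forms, using
  -- symmetry of `V k`.
  refine ⟨fun i j => (l (Pi.single i 1 + Pi.single j 1) - l (Pi.single i 1 - Pi.single j 1)) / 4,
    tendsto_pi_nhds.2 fun i => tendsto_pi_nhds.2 fun j => ?_⟩
  refine (((hl (Pi.single i 1 + Pi.single j 1)).sub
    (hl (Pi.single i 1 - Pi.single j 1))).div_const 4).congr fun k => ?_
  have hsymm : V k j i = V k i j := by
    conv_lhs => rw [← posSemidef_transpose_eq (hpos k)]
    rfl
  simp only [Matrix.mulVec_add, Matrix.mulVec_sub, dotProduct_add, add_dotProduct, dotProduct_sub,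
    sub_dotProduct, single_one_dotProduct, Matrix.mulVec_single_one, Matrix.col_apply, hsymm]
  ring

theorem Data.continuousAt_ric (D : Data nx nu nw) {P : Matrix (Fin nx) (Fin nx) ℝ}
    (hH : (D.H P).PosDef) : ContinuousAt D.ric P := by
  have h1 : ContinuousAt D.H P := by
    unfold Data.H
    exact Continuous.continuousAt (by fun_prop)
  have h2 : ContinuousAt (fun P => (D.H P)⁻¹) P := by
    refine ContinuousAt.comp (g := fun M : Matrix (Fin nu) (Fin nu) ℝ => M⁻¹) ?_ h1
    refine continuousAt_matrix_inv _ ?_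
    have hu : (D.H P).det ≠ 0 := hH.det_pos.ne'
    rw [Ring.inverse_eq_inv']
    exact continuousAt_inv₀ hu
  have h3 : Continuous fun P : Matrix (Fin nx) (Fin nx) ℝ => D.Aᵀ * P * D.Bu := by fun_prop
  have h4 : Continuous fun P : Matrix (Fin nx) (Fin nx) ℝ => D.Buᵀ * P * D.A := by fun_prop
  have h5 : Continuous fun P => D.Q + D.Aᵀ * P * D.A := by fun_prop
  have h6 : ContinuousAt (fun P => D.Aᵀ * P * D.Bu * (D.H P)⁻¹ * (D.Buᵀ * P * D.A)) P := by
    have : Continuous fun t : Matrix (Fin nx) (Fin nu) ℝ × Matrix (Fin nu) (Fin nu) ℝ ×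
      Matrix (Fin nu) (Fin nx) ℝ => t.1 * t.2.1 * t.2.2 := by fun_prop
    exact this.continuousAt.comp (f := fun P => (D.Aᵀ * P * D.Bu, (D.H P)⁻¹, D.Buᵀ * P * D.A))
      (h3.continuousAt.prodMk (h2.prodMk h4.continuousAt))
  refine (h5.continuousAt.sub h6).congr (Eventually.of_forall fun P => ?_)
  simp only [Data.ric, Matrix.mul_assoc, Pi.sub_apply]

/-- Value iteration from `0` increases, since `ric 0` is positive semidefinite and `ric` is
monotone. It stays below the cost `S` of a stabilizing gain `F`, because `S` is fixed by evaluation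
of `F` and `ric` lies below that evaluation. The limit is a fixed point by continuity. -/
theorem Data.exists_ric_fixed (D : Data nx nu nw) (hstab : Stabilizable D.A D.Bu)
    (hQ : D.Q.PosSemidef) (hR : D.R.PosDef) :
    ∃ P : Matrix (Fin nx) (Fin nx) ℝ, P.PosSemidef ∧ D.ric P = P := by
  obtain ⟨F, hF⟩ := hstab
  have hW : (D.Q + Fᵀ * D.R * F).PosSemidef :=
    hQ.add (posSemidef_transpose_mul_mul hR.posSemidef _)
  obtain ⟨S, hS⟩ := hF.powDecay.exists_lyapunov (D.Q + Fᵀ * D.R * F)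
  have hSpos := hF.powDecay.lyapunov_posSemidef hW hS
  have hS' : D.gainCost S F = S := by
    rw [← sub_eq_zero, ← hS, Data.gainCost]; abel
  let V : ℕ → Matrix (Fin nx) (Fin nx) ℝ := fun k => D.ric^[k] 0
  have hV : ∀ k, V (k + 1) = D.ric (V k) := fun k => Function.iterate_succ_apply' _ _ _
  have hpos : ∀ k, (V k).PosSemidef := by
    intro k
    induction k with
    | zero => exact Matrix.PosSemidef.zero
    | succ k ih => rw [hV]; exact D.ric_posSemidef hQ hR ih
  have hmono : Monotone V := by
    refine monotone_nat_of_le_succ fun k => ?_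
    induction k with
    | zero => exact Matrix.nonneg_iff_posSemidef.2 (hpos 1)
    | succ k ih =>
      rw [hV (k + 1)]
      nth_rw 1 [hV k]
      exact D.ric_mono hR (hpos _) (hpos _) ih
  have hle : ∀ k, V k ≤ S := by
    intro k
    induction k with
    | zero => exact Matrix.nonneg_iff_posSemidef.2 hSpos
    | succ k ih =>
      rw [hV, ← hS']
      exact (D.ric_le_gainCost hR (hpos k) F).trans (D.gainCost_mono ih F)
  obtain ⟨P, hP⟩ := exists_tendsto_of_monotone_posSemidef hpos hmono hle
  have hPpos : P.PosSemidef := (isClosed_posSemidef nx).mem_of_tendsto hP (Eventually.of_forall hpos)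
  refine ⟨P, hPpos, ?_⟩
  have h1 : Tendsto (fun k => V (k + 1)) atTop (𝓝 (D.ric P)) := by
    simp only [hV]
    exact (D.continuousAt_ric (D.H_posDef' hR hPpos)).tendsto.comp hP
  exact tendsto_nhds_unique h1 (hP.comp (tendsto_add_atTop_nat 1))

/-- The real form of multiplying `a + ib` by `α + iβ`. The mixed terms cancel between the two
summands, so `P` need not be symmetric. -/
theorem quadForm_rotation {n : ℕ} (P : Matrix (Fin n) (Fin n) ℝ) (α β : ℝ)
    (a b : Fin n → ℝ) :
    (α • a - β • b) ⬝ᵥ P *ᵥ (α • a - β • b) + (β • a + α • b) ⬝ᵥ P *ᵥ (β • a + α • b) =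
      (α ^ 2 + β ^ 2) * (a ⬝ᵥ P *ᵥ a + b ⬝ᵥ P *ᵥ b) := by
  simp only [Matrix.mulVec_add, Matrix.mulVec_sub, Matrix.mulVec_smul, dotProduct_add,
    add_dotProduct, dotProduct_sub, sub_dotProduct, dotProduct_smul, smul_dotProduct, smul_eq_mul]
  ring

theorem dotProduct_transpose_mul_mul {n m : ℕ} (M : Matrix (Fin m) (Fin m) ℝ)
    (K : Matrix (Fin m) (Fin n) ℝ) (x y : Fin n → ℝ) :
    x ⬝ᵥ (Kᵀ * M * K) *ᵥ y = (K *ᵥ x) ⬝ᵥ M *ᵥ (K *ᵥ y) := by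
  rw [Matrix.mul_assoc, ← Matrix.mulVec_mulVec, Matrix.dotProduct_mulVec, Matrix.vecMul_transpose,
    Matrix.mulVec_mulVec]

theorem Data.ahat_eq (D : Data nx nu nw) (P : Matrix (Fin nx) (Fin nx) ℝ) :
    D.Ahat P = D.A + D.Bu * (-D.Kx P) := by
  rw [Data.Ahat, Matrix.mul_neg, sub_eq_add_neg]

/-- A Hautus-type argument on `P = Âᵀ P Â + Q + Kxᵀ R Kx`. Evaluated on an eigenvector of `Â` with
eigenvalue of modulus at least one, it forces the `Q` and `R` terms to vanish. The vector is then
killed by `Q` and `Kx`, so it is also an eigenvector of `A + L Q` with the same eigenvalue,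
contradicting detectability. -/
theorem Data.isSchur_of_ric_fixed (D : Data nx nu nw) (hdet : Detectable D.A D.Q)
    (hQ : D.Q.PosSemidef) (hR : D.R.PosDef) {P : Matrix (Fin nx) (Fin nx) ℝ}
    (hP : P.PosSemidef) (hfix : D.ric P = P) : IsSchur (D.Ahat P) := by
  obtain ⟨L, hL⟩ := hdet
  rw [isSchur_iff_real] at hL ⊢
  intro α β a b hab ha hb
  by_contra! hge
  have hP' := posSemidef_transpose_eq hP
  have hq : ∀ x, x ⬝ᵥ P *ᵥ x = (D.Ahat P *ᵥ x) ⬝ᵥ P *ᵥ (D.Ahat P *ᵥ x) + x ⬝ᵥ D.Q *ᵥ x +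
      (D.Kx P *ᵥ x) ⬝ᵥ D.R *ᵥ (D.Kx P *ᵥ x) := by
    intro x
    have : P = (D.Ahat P)ᵀ * P * D.Ahat P + D.Q + (D.Kx P)ᵀ * D.R * D.Kx P := by
      conv_lhs => rw [← hfix, D.ric_eq_gainCost hP' (D.H_posDef' hR hP), Data.gainCost, ← D.ahat_eq]
      simp
    conv_lhs => rw [this]
    rw [Matrix.add_mulVec, Matrix.add_mulVec, dotProduct_add, dotProduct_add,
      dotProduct_transpose_mul_mul, dotProduct_transpose_mul_mul]
  have hrot := quadForm_rotation P α β a b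
  rw [← ha, ← hb] at hrot
  have hPa := hP.dotProduct_mulVec_nonneg a
  have hPb := hP.dotProduct_mulVec_nonneg b
  have hQa := hQ.dotProduct_mulVec_nonneg a
  have hQb := hQ.dotProduct_mulVec_nonneg b
  have hRa := hR.posSemidef.dotProduct_mulVec_nonneg (D.Kx P *ᵥ a)
  have hRb := hR.posSemidef.dotProduct_mulVec_nonneg (D.Kx P *ᵥ b)
  simp only [star_trivial] at hPa hPb hQa hQb hRa hRb
  have h1 := hq a
  have h2 := hq b
  have hprod : a ⬝ᵥ P *ᵥ a + b ⬝ᵥ P *ᵥ b ≤ (α ^ 2 + β ^ 2) * (a ⬝ᵥ P *ᵥ a + b ⬝ᵥ P *ᵥ b) :=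
    le_mul_of_one_le_left (by linarith) hge
  have zQ : ∀ x, x ⬝ᵥ D.Q *ᵥ x = 0 → D.Q *ᵥ x = 0 := fun x hx =>
    (hQ.dotProduct_mulVec_zero_iff x).1 (by simpa using hx)
  have zR : ∀ x, x ⬝ᵥ D.R *ᵥ x = 0 → x = 0 := fun x hx => by
    by_contra h0
    have := hR.dotProduct_mulVec_pos h0
    simp only [star_trivial] at this
    linarith
  have eA : ∀ x, D.Q *ᵥ x = 0 → D.Kx P *ᵥ x = 0 → (D.A + L * D.Q) *ᵥ x = D.Ahat P *ᵥ x := by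
    intro x h1 h2
    rw [Data.Ahat, Matrix.add_mulVec, Matrix.sub_mulVec, ← Matrix.mulVec_mulVec,
      ← Matrix.mulVec_mulVec, h1, h2]
    simp
  have := hL α β a b hab
    (by rw [eA a (zQ a (by linarith)) (zR _ (by linarith)), ha])
    (by rw [eA b (zQ b (by linarith)) (zR _ (by linarith)), hb])
  linarith

theorem Data.dare_iff_ric (D : Data nx nu nw) (P : Matrix (Fin nx) (Fin nx) ℝ) :
    P - D.Aᵀ * P * D.A - D.Q + D.Aᵀ * P * D.Bu * (D.H P)⁻¹ * D.Buᵀ * P * D.A = 0 ↔ D.ric P = P := by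
  rw [← sub_eq_zero (a := D.ric P), ← neg_eq_zero, Data.ric]
  constructor <;> intro h <;> rw [← h] <;> abel

/-- Both products subtract the same matrix `Q + Kx₁ᵀ R Kx₂`. Hence `P₁ - P₂` is fixed by `W ↦ Â₁ᵀ W
Â₂`, and decay of the powers makes it zero; this is the uniqueness of the stabilizing solution. -/
theorem Data.IsStabilizingSolution.ahatT_mul_mul_ahat {D : Data nx nu nw}
    {P₁ P₂ : Matrix (Fin nx) (Fin nx) ℝ}
    (h₁ : D.IsStabilizingSolution P₁) (h₂ : D.IsStabilizingSolution P₂) :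
    (D.Ahat P₁)ᵀ * P₁ * D.Ahat P₂ = P₁ - D.Q - (D.Kx P₁)ᵀ * D.R * D.Kx P₂ ∧
      (D.Ahat P₁)ᵀ * P₂ * D.Ahat P₂ = P₂ - D.Q - (D.Kx P₁)ᵀ * D.R * D.Kx P₂ := by
  have key : ∀ {P : Matrix (Fin nx) (Fin nx) ℝ}, D.IsStabilizingSolution P →
      D.Aᵀ * P * D.Ahat P = P - D.Q ∧ D.Buᵀ * P * D.Ahat P = D.R * D.Kx P := by
    intro P h
    constructor
    · rw [← sub_eq_zero, ← neg_eq_zero, ← h.dare, Data.Ahat, Data.Kx]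
      simp only [Matrix.mul_sub, Matrix.mul_assoc]
      abel
    · have := D.H_mul_Kx h.H_posDef
      rw [Data.H, Matrix.add_mul] at this
      rw [Data.Ahat, Matrix.mul_sub, ← this]
      simp only [Matrix.mul_assoc]
      abel
  have s₁ := posSemidef_transpose_eq h₁.posSemidef
  obtain ⟨a₁, b₁⟩ := key h₁
  obtain ⟨a₂, b₂⟩ := key h₂
  constructor
  · have a₁' := congrArg Matrix.transpose a₁
    have b₁' := congrArg Matrix.transpose b₁
    -- Symmetry of `Q` and `R` is recovered from the Riccati equation and the definition of `H`, as
    -- `P₁` and `H` are symmetric.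
    have hQ : D.Qᵀ = D.Q := by
      have e := D.dare_iff_ric P₁ |>.1 h₁.dare
      have hH := posSemidef_transpose_eq h₁.H_posDef.inv.posSemidef
      have : D.Q = P₁ - D.Aᵀ * P₁ * D.A + D.Aᵀ * P₁ * D.Bu * (D.H P₁)⁻¹ * D.Buᵀ * P₁ * D.A := by
        rw [← sub_eq_zero, ← neg_eq_zero, ← h₁.dare]; abel
      rw [this]
      simp only [Matrix.transpose_add, Matrix.transpose_sub, Matrix.transpose_mul,
        Matrix.transpose_transpose, s₁, hH, Matrix.mul_assoc]
    have hR : D.Rᵀ = D.R := by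
      have : D.R = D.H P₁ - D.Buᵀ * P₁ * D.Bu := by rw [Data.H]; abel
      rw [this]
      simp only [Matrix.transpose_sub, Matrix.transpose_mul, Matrix.transpose_transpose, s₁,
        posSemidef_transpose_eq h₁.H_posDef.posSemidef, Matrix.mul_assoc]
    simp only [Matrix.transpose_mul, Matrix.transpose_sub, Matrix.transpose_transpose, s₁, hQ, hR,
      ← Matrix.mul_assoc] at a₁' b₁'
    nth_rw 2 [Data.Ahat]
    rw [Matrix.mul_sub, ← Matrix.mul_assoc _ D.Bu, a₁', b₁']
  · rw [Data.Ahat, Matrix.transpose_sub, Matrix.transpose_mul, Matrix.sub_mul, Matrix.sub_mul,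
      a₂, Matrix.mul_assoc (D.Kx P₁)ᵀ, Matrix.mul_assoc (D.Kx P₁)ᵀ, b₂, Matrix.mul_assoc]

/-- The Riccati equation has exactly one stabilizing solution. -/
theorem Data.existsUnique_isStabilizingSolution (D : Data nx nu nw)
    (hstab : Stabilizable D.A D.Bu) (hdet : Detectable D.A D.Q)
    (hQ : D.Q.PosSemidef) (hR : D.R.PosDef) : ∃! P, D.IsStabilizingSolution P := by
  obtain ⟨P, hP, hfix⟩ := D.exists_ric_fixed hstab hQ hR
  refine ⟨P, ⟨hP, D.H_posDef' hR hP, (D.dare_iff_ric P).2 hfix,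
    D.isSchur_of_ric_fixed hdet hQ hR hP hfix⟩, fun P' hP' => ?_⟩
  have h : D.IsStabilizingSolution P := ⟨hP, D.H_posDef' hR hP, (D.dare_iff_ric P).2 hfix,
    D.isSchur_of_ric_fixed hdet hQ hR hP hfix⟩
  obtain ⟨e₁, e₂⟩ := hP'.ahatT_mul_mul_ahat h
  refine sub_eq_zero.1 (hP'.schur.powDecay.eq_zero_of_eq h.schur.powDecay ?_)
  rw [Matrix.mul_sub, Matrix.sub_mul, e₁, e₂]
  abel

end PreviewLQR

namespace PreviewLQR

/-! ### Frobenius norm, smallest eigenvalues and the trace -/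

theorem frobNorm_nonneg {m n : ℕ} (M : Matrix (Fin m) (Fin n) ℝ) : 0 ≤ frobNorm M := by
  let _ := Matrix.frobeniusNormedAddCommGroup (m := Fin m) (n := Fin n) (α := ℝ)
  exact norm_nonneg M

theorem frobNorm_sq {m n : ℕ} (M : Matrix (Fin m) (Fin n) ℝ) :
    frobNorm M ^ 2 = ∑ i, ∑ j, M i j ^ 2 := by
  let _ := Matrix.frobeniusNormedAddCommGroup (m := Fin m) (n := Fin n) (α := ℝ)
  have h : frobNorm M = (∑ i, ∑ j, ‖M i j‖ ^ (2 : ℝ)) ^ (1 / 2 : ℝ) := Matrix.frobenius_norm_def M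
  have h0 : 0 ≤ ∑ i, ∑ j, ‖M i j‖ ^ (2 : ℝ) := by positivity
  rw [h, ← Real.sqrt_eq_rpow, Real.sq_sqrt h0]
  simp

theorem frobNorm_sq_eq_trace {m n : ℕ} (M : Matrix (Fin m) (Fin n) ℝ) :
    frobNorm M ^ 2 = (M * Mᵀ).trace := by
  rw [frobNorm_sq]
  simp [Matrix.trace, Matrix.mul_apply, sq]

theorem frobNorm_mul_le {l m n : ℕ} (M : Matrix (Fin l) (Fin m) ℝ) (N : Matrix (Fin m) (Fin n) ℝ) :
    frobNorm (M * N) ≤ frobNorm M * frobNorm N := by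
  exact Matrix.frobenius_norm_mul M N

/-- The Frobenius norm is submultiplicative but does not send `1` to `1`, so `ρ(N) ≤ ‖N‖` is derived
from Gelfand's formula, using positive powers only. It is then applied to `N = M ^ (k + 1)`. -/
theorem specRad_pow_le_frobNorm {n : ℕ} (M : Matrix (Fin n) (Fin n) ℝ) (k : ℕ) :
    specRad M ^ (k + 1) ≤ frobNorm (M ^ (k + 1)) := by
  let _ := Matrix.frobeniusNormedRing (m := Fin n) (α := ℂ)
  let _ := Matrix.frobeniusNormedAlgebra (m := Fin n) (R := ℂ) (α := ℂ)
  have h1 : ∀ N : Matrix (Fin n) (Fin n) ℂ, spectralRadius ℂ N ≤ ENNReal.ofReal ‖N‖ := by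
    intro N
    refine le_of_tendsto (spectrum.pow_norm_pow_one_div_tendsto_nhds_spectralRadius N) ?_
    filter_upwards [eventually_gt_atTop 0] with m hm
    refine ENNReal.ofReal_le_ofReal ?_
    rw [one_div]
    calc ‖N ^ m‖ ^ ((m : ℝ)⁻¹) ≤ (‖N‖ ^ m) ^ ((m : ℝ)⁻¹) :=
          Real.rpow_le_rpow (norm_nonneg _) (norm_pow_le' N hm) (by positivity)
      _ = ‖N‖ := Real.pow_rpow_inv_natCast (norm_nonneg _) hm.ne'
  have h2 := (spectrum.spectralRadius_pow_le (𝕜 := ℂ) (M.map (algebraMap ℝ ℂ)) (k + 1)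
    k.succ_ne_zero).trans (h1 _)
  rw [map_pow_algebraMap] at h2
  have h3 : ‖(M ^ (k + 1)).map (algebraMap ℝ ℂ)‖ = frobNorm (M ^ (k + 1)) :=
    Matrix.frobenius_norm_map_eq _ _ fun a => by simp
  rw [h3] at h2
  rw [specRad, ← ENNReal.toReal_pow]
  exact ENNReal.toReal_le_of_le_ofReal (frobNorm_nonneg _) h2

open scoped MatrixOrder in
theorem matSqrt_posSemidef {n : ℕ} (M : Matrix (Fin n) (Fin n) ℝ) : (matSqrt M).PosSemidef :=
  Matrix.nonneg_iff_posSemidef.1 (CFC.sqrt_nonneg M)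

open scoped MatrixOrder in
theorem matSqrt_mul_self {n : ℕ} {M : Matrix (Fin n) (Fin n) ℝ} (h : M.PosSemidef) :
    matSqrt M * matSqrt M = M :=
  CFC.sqrt_mul_sqrt_self M (Matrix.nonneg_iff_posSemidef.2 h)

/-- With `S` the square root of `M`, cyclicity turns the trace into that of the congruence `S N S`.
-/
theorem trace_mul_nonneg {n : ℕ} {M N : Matrix (Fin n) (Fin n) ℝ} (hM : M.PosSemidef)
    (hN : N.PosSemidef) : 0 ≤ (M * N).trace := by
  rw [← matSqrt_mul_self hM, Matrix.mul_assoc, Matrix.trace_mul_comm]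
  have h := posSemidef_transpose_mul_mul hN (matSqrt M)
  rw [posSemidef_transpose_eq (matSqrt_posSemidef M)] at h
  exact h.trace_nonneg

theorem spectrum_nonneg_of_posSemidef {n : ℕ} {M : Matrix (Fin n) (Fin n) ℝ} (h : M.PosSemidef) :
    ∀ x ∈ spectrum ℝ M, 0 ≤ x := fun _ hx =>
  (Matrix.posSemidef_iff_isHermitian_and_spectrum_nonneg.1 h).2 hx

theorem lamMin_nonneg {n : ℕ} {M : Matrix (Fin n) (Fin n) ℝ} (h : M.PosSemidef) : 0 ≤ lamMin M :=
  Real.sInf_nonneg (spectrum_nonneg_of_posSemidef h)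

theorem sub_lamMin_posSemidef {n : ℕ} {M : Matrix (Fin n) (Fin n) ℝ} (h : M.PosSemidef) :
    (M - lamMin M • 1).PosSemidef := by
  rw [Matrix.posSemidef_iff_isHermitian_and_spectrum_nonneg]
  constructor
  · rw [Matrix.IsHermitian, Matrix.conjTranspose_eq_transpose_of_trivial]
    simp [posSemidef_transpose_eq h]
  · intro x hx
    rw [← Algebra.algebraMap_eq_smul_one, ← spectrum.sub_singleton_eq] at hx
    obtain ⟨y, hy, z, hz, rfl⟩ := hx
    rw [Set.mem_singleton_iff.1 hz]
    exact sub_nonneg.2 (csInf_le ⟨0, spectrum_nonneg_of_posSemidef h⟩ hy)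

/-- `S² - λ² = (S - λ)² + 2λ (S - λ)` with `λ = lamMin S ≥ 0`. -/
theorem mul_self_sub_lamMin_posSemidef {n : ℕ} {S : Matrix (Fin n) (Fin n) ℝ} (h : S.PosSemidef) :
    (S * S - lamMin S ^ 2 • 1).PosSemidef := by
  have h1 := sub_lamMin_posSemidef h
  have h2 := posSemidef_transpose_mul_mul (Matrix.PosSemidef.one (n := Fin n) (R := ℝ))
    (S - lamMin S • 1)
  rw [posSemidef_transpose_eq h1, Matrix.mul_one] at h2
  have h3 := h2.add (h1.smul (mul_nonneg zero_le_two (lamMin_nonneg h)))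
  convert h3 using 1
  simp only [Matrix.sub_mul, Matrix.mul_sub, smul_sub, Matrix.smul_mul, Matrix.mul_smul,
    Matrix.one_mul, Matrix.mul_one, smul_smul]
  module

/-- The spectrum is finite and nonempty, so the smallest eigenvalue is attained, and its square is
an eigenvalue of `S * S`. In dimension zero both sides are the default infimum `0`. This converts
the lower bound in `X^(1/2)`, `Y^(1/2)` into one in `X`, `Y`. -/
theorem lamMin_mul_self_le {n : ℕ} {S : Matrix (Fin n) (Fin n) ℝ} (h : S.PosSemidef) :
    lamMin (S * S) ≤ lamMin S ^ 2 := by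
  rcases Nat.eq_zero_or_pos n with rfl | hn
  · simp [lamMin]
  · have : Nonempty (Fin n) := ⟨⟨0, hn⟩⟩
    have hne : (spectrum ℝ S).Nonempty := by
      rw [h.isHermitian.spectrum_real_eq_range_eigenvalues]
      exact Set.range_nonempty _
    have hfin : (spectrum ℝ S).Finite := by
      rw [h.isHermitian.spectrum_real_eq_range_eigenvalues]
      exact Set.finite_range _
    have hmem : lamMin S ∈ spectrum ℝ S := hne.csInf_mem hfin
    have hSS : (S * S).PosSemidef := by
      simpa [posSemidef_transpose_eq h] using
        posSemidef_transpose_mul_mul (Matrix.PosSemidef.one (n := Fin n) (R := ℝ)) S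
    have := spectrum.pow_mem_pow S 2 hmem
    rw [sq S] at this
    exact csInf_le ⟨0, spectrum_nonneg_of_posSemidef hSS⟩ this

/-- Lower and upper bounds for `trace (Y Mᵀ X M)`. -/
theorem trace_gap_bounds {n : ℕ} {X Y : Matrix (Fin n) (Fin n) ℝ} (hX : X.PosSemidef)
    (hY : Y.PosSemidef) (M : Matrix (Fin n) (Fin n) ℝ) :
    lamMin (matSqrt X) ^ 2 * lamMin (matSqrt Y) ^ 2 * frobNorm M ^ 2 ≤ (Y * Mᵀ * X * M).trace ∧
      (Y * Mᵀ * X * M).trace ≤ frobNorm (matSqrt X) ^ 2 * frobNorm (matSqrt Y) ^ 2 *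
        frobNorm M ^ 2 := by
  have sX := matSqrt_posSemidef X
  have sY := matSqrt_posSemidef Y
  constructor
  · have h1 := mul_self_sub_lamMin_posSemidef sX
    have h2 := mul_self_sub_lamMin_posSemidef sY
    rw [matSqrt_mul_self hX] at h1
    rw [matSqrt_mul_self hY] at h2
    have h3 := trace_mul_nonneg hY (posSemidef_transpose_mul_mul h1 M)
    have h4 := (posSemidef_transpose_mul_mul h2 Mᵀ).trace_nonneg
    have e3 : (Y * (Mᵀ * (X - lamMin (matSqrt X) ^ 2 • 1) * M)).trace =
        (Y * Mᵀ * X * M).trace - lamMin (matSqrt X) ^ 2 * (M * Y * Mᵀ).trace := by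
      rw [Matrix.mul_sub, Matrix.sub_mul, Matrix.mul_sub, Matrix.trace_sub, Matrix.mul_smul,
        Matrix.smul_mul, Matrix.mul_smul, Matrix.trace_smul, Matrix.mul_one, smul_eq_mul,
        ← Matrix.mul_assoc Y Mᵀ M, Matrix.trace_mul_comm (Y * Mᵀ) M]
      simp only [Matrix.mul_assoc]
    have e4 : (Mᵀᵀ * (Y - lamMin (matSqrt Y) ^ 2 • 1) * Mᵀ).trace =
        (M * Y * Mᵀ).trace - lamMin (matSqrt Y) ^ 2 * frobNorm M ^ 2 := by
      rw [frobNorm_sq_eq_trace, Matrix.transpose_transpose, Matrix.mul_sub, Matrix.sub_mul,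
        Matrix.trace_sub, Matrix.mul_smul, Matrix.smul_mul, Matrix.trace_smul, Matrix.mul_one,
        smul_eq_mul]
    rw [e3] at h3
    rw [e4] at h4
    nlinarith [mul_nonneg (sq_nonneg (lamMin (matSqrt X))) h4]
  -- The trace is a squared Frobenius norm, so submultiplicativity gives the upper bound.
  · have e : (Y * Mᵀ * X * M).trace = frobNorm (matSqrt X * M * matSqrt Y) ^ 2 := by
      rw [frobNorm_sq_eq_trace, Matrix.transpose_mul, Matrix.transpose_mul,
        posSemidef_transpose_eq sX, posSemidef_transpose_eq sY]
      conv_lhs => rw [← matSqrt_mul_self hX, ← matSqrt_mul_self hY]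
      rw [Matrix.trace_mul_comm (matSqrt X * M * matSqrt Y)]
      rw [show matSqrt Y * matSqrt Y * Mᵀ * (matSqrt X * matSqrt X) * M =
        matSqrt Y * (matSqrt Y * Mᵀ * (matSqrt X * matSqrt X) * M) by
          simp only [Matrix.mul_assoc], Matrix.trace_mul_comm]
      simp only [Matrix.mul_assoc]
    rw [e, ← mul_pow, ← mul_pow]
    refine pow_le_pow_left₀ (frobNorm_nonneg _) ?_ 2
    calc frobNorm (matSqrt X * M * matSqrt Y)
        ≤ frobNorm (matSqrt X) * frobNorm M * frobNorm (matSqrt Y) :=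
          (frobNorm_mul_le _ _).trans
            (mul_le_mul_of_nonneg_right (frobNorm_mul_le _ _) (frobNorm_nonneg _))
      _ = _ := by ring

theorem lamMin_mul_specRad_le {n : ℕ} {X Y : Matrix (Fin n) (Fin n) ℝ} (hX : X.PosSemidef)
    (hY : Y.PosSemidef) (M : Matrix (Fin n) (Fin n) ℝ) (p : ℕ) :
    lamMin X * lamMin Y * specRad M ^ (2 * (p + 1)) ≤
      lamMin (matSqrt X) ^ 2 * lamMin (matSqrt Y) ^ 2 * frobNorm (M ^ (p + 1)) ^ 2 := by
  have h1 := lamMin_mul_self_le (matSqrt_posSemidef X)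
  have h2 := lamMin_mul_self_le (matSqrt_posSemidef Y)
  rw [matSqrt_mul_self hX] at h1
  rw [matSqrt_mul_self hY] at h2
  have h3 := lamMin_nonneg hX
  have h4 := lamMin_nonneg hY
  have h5 := specRad_pow_le_frobNorm M p
  have h6 := specRad_nonneg M
  rw [mul_comm 2, pow_mul]
  gcongr

theorem exists_frobNorm_pow_sq_le {n : ℕ} (M : Matrix (Fin n) (Fin n) ℝ) {r : ℝ}
    (hr : specRad M < r) : ∃ C, ∀ k, frobNorm (M ^ k) ^ 2 ≤ C * r ^ (2 * k) := by
  obtain ⟨C, hC, h⟩ := exists_pow_entry_le M hr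
  refine ⟨n * (n * C ^ 2), fun k => ?_⟩
  rw [frobNorm_sq]
  calc ∑ i, ∑ j, (M ^ k) i j ^ 2 ≤ ∑ _i : Fin n, ∑ _j : Fin n, (C * r ^ k) ^ 2 := by
        refine Finset.sum_le_sum fun i _ => Finset.sum_le_sum fun j _ => ?_
        rw [← sq_abs]
        exact pow_le_pow_left₀ (abs_nonneg _) (h k i j) 2
    _ = _ := by
        simp only [Finset.sum_const, Finset.card_univ, Fintype.card_fin, nsmul_eq_mul]
        ring

end PreviewLQR

namespace PreviewLQR

/-! ### A strong law for sums with linearly growing variance -/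

section StrongLaw

variable {Ω : Type*} {mΩ : MeasurableSpace Ω} {μ : Measure Ω}

/-- If the increments of `S` over windows of length `k` have second moment `O(k)`, then
`S n / n → 0` almost surely. -/
theorem ae_tendsto_div_of_gap {S : ℕ → Ω → ℝ} (hS : ∀ n, AEMeasurable (S n) μ) {C : ℝ}
    (h0 : ∀ ω, S 0 ω = 0)
    (hgap : ∀ m k, ∫⁻ ω, ENNReal.ofReal ((S (m + k) ω - S m ω) ^ 2) ∂μ ≤ ENNReal.ofReal (C * k)) :
    ∀ᵐ ω ∂μ, Tendsto (fun n : ℕ => (n : ℝ)⁻¹ * S n ω) atTop (𝓝 0) := by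
  wlog hC : 0 ≤ C generalizing C
  · refine this (C := 0) (fun m k => (hgap m k).trans ?_) le_rfl
    push Not at hC
    exact ENNReal.ofReal_le_ofReal (by nlinarith [(Nat.cast_nonneg k : (0 : ℝ) ≤ k)])
  -- Times are cut into blocks starting at squares; the block from `(n+1)²` to `(n+2)²` has length
  -- `2n+3`. Throughout it, `2 * G n` dominates `(S T / T)²`. The integral of `G n` is `O(n⁻²)`, so
  -- the `G n` are almost surely summable and tend to zero.
  let q : ℕ → ℕ := fun n => (n + 1) ^ 2
  let G : ℕ → Ω → ℝ≥0∞ := fun n ω => ENNReal.ofReal (((n + 1 : ℝ) ^ 4)⁻¹) *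
    (ENNReal.ofReal ((S (q n) ω) ^ 2) +
      ∑ j ∈ Finset.range (2 * n + 3), ENNReal.ofReal ((S (q n + j) ω - S (q n) ω) ^ 2))
  have hm1 : ∀ n, AEMeasurable (fun ω => ENNReal.ofReal ((S n ω) ^ 2)) μ := fun n =>
    ((hS n).pow_const 2).ennreal_ofReal
  have hm2 : ∀ m n, AEMeasurable (fun ω => ENNReal.ofReal ((S m ω - S n ω) ^ 2)) μ := fun m n =>
    (((hS m).sub (hS n)).pow_const 2).ennreal_ofReal
  have hGm : ∀ n, AEMeasurable (G n) μ := fun n =>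
    ((hm1 _).add (Finset.aemeasurable_fun_sum _ fun j _ => hm2 _ _)).const_mul _
  -- The block start contributes `C (n+1)²`. At most `3(n+1)` increments, each of second moment at
  -- most `3C(n+1)`, contribute `9C(n+1)²`; together `10 C (n+1)²`, divided by `(n+1)⁴`.
  have hGi : ∀ n, ∫⁻ ω, G n ω ∂μ ≤ ENNReal.ofReal (10 * C * (1 / (n + 1 : ℝ) ^ 2)) := by
    intro n
    simp only [G]
    rw [lintegral_const_mul' _ _ ENNReal.ofReal_ne_top, lintegral_add_left' (hm1 _),
      lintegral_finsetSum' _ fun j _ => hm2 _ _]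
    have h1 : ∫⁻ ω, ENNReal.ofReal ((S (q n) ω) ^ 2) ∂μ ≤ ENNReal.ofReal (C * (n + 1) ^ 2) := by
      have := hgap 0 (q n)
      simpa [h0, q] using this
    have h2 : ∑ j ∈ Finset.range (2 * n + 3),
        ∫⁻ ω, ENNReal.ofReal ((S (q n + j) ω - S (q n) ω) ^ 2) ∂μ ≤
        ENNReal.ofReal (C * (9 * (n + 1) ^ 2)) := by
      calc _ ≤ ∑ j ∈ Finset.range (2 * n + 3), ENNReal.ofReal (C * (3 * (n + 1))) := by
            refine Finset.sum_le_sum fun j hj => (hgap _ _).trans (ENNReal.ofReal_le_ofReal ?_)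
            have : (j : ℝ) ≤ 3 * (n + 1) := by
              have := Finset.mem_range.1 hj
              have h : j ≤ 3 * (n + 1) := by omega
              exact_mod_cast h
            gcongr
        _ = ENNReal.ofReal ((2 * n + 3) * (C * (3 * (n + 1)))) := by
            rw [Finset.sum_const, Finset.card_range, nsmul_eq_mul,
              ENNReal.ofReal_mul (p := 2 * n + 3) (by positivity),
              show (2 * n + 3 : ℝ) = ((2 * n + 3 : ℕ) : ℝ) by push_cast; ring,
              ENNReal.ofReal_natCast]
        _ ≤ _ := by
            refine ENNReal.ofReal_le_ofReal ?_
            have hn : (0 : ℝ) ≤ n := Nat.cast_nonneg n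
            have : (2 * n + 3 : ℝ) ≤ 3 * (n + 1) := by linarith
            calc (2 * n + 3 : ℝ) * (C * (3 * (n + 1))) ≤ 3 * (n + 1) * (C * (3 * (n + 1))) := by
                  gcongr
              _ = _ := by ring
    calc _ ≤ ENNReal.ofReal (((n + 1 : ℝ) ^ 4)⁻¹) * (ENNReal.ofReal (C * (n + 1) ^ 2) +
          ENNReal.ofReal (C * (9 * (n + 1) ^ 2))) := by gcongr
      _ = _ := by
          rw [← ENNReal.ofReal_add (by positivity) (by positivity),
            ← ENNReal.ofReal_mul (by positivity)]
          congr 1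
          have : (n + 1 : ℝ) ≠ 0 := by positivity
          field_simp
          ring
  have hsum : ∫⁻ ω, ∑' n, G n ω ∂μ ≠ ∞ := by
    rw [lintegral_tsum hGm]
    have hs : Summable fun n : ℕ => 10 * C * (1 / (n + 1 : ℝ) ^ 2) := by
      have := (summable_nat_add_iff 1).2 (Real.summable_one_div_nat_pow.2 (by norm_num : 1 < 2))
      exact_mod_cast this.mul_left (10 * C)
    refine ne_top_of_le_ne_top ?_ (ENNReal.tsum_le_tsum hGi)
    rw [← ENNReal.ofReal_tsum_of_nonneg (fun n => by positivity) hs]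
    exact ENNReal.ofReal_ne_top
  filter_upwards [ae_lt_top' (AEMeasurable.tsum hGm) hsum] with ω hω
  have hG0 := ENNReal.tendsto_atTop_zero_of_tsum_ne_top hω.ne
  have hbound : ∀ T : ℕ, 1 ≤ T →
      ENNReal.ofReal (((T : ℝ)⁻¹ * S T ω) ^ 2) ≤ 2 * G (Nat.sqrt T - 1) ω := by
    intro T hT
    set n := Nat.sqrt T - 1 with hn
    have hs : n + 1 = Nat.sqrt T := Nat.sub_add_cancel (Nat.sqrt_pos.2 hT)
    have hq1 : q n ≤ T := by simp only [q]; rw [hs]; exact Nat.sqrt_le' T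
    have hq2 : T < q n + (2 * n + 3) := by
      have := Nat.lt_succ_sqrt' T
      rw [← hs] at this
      simp only [q]
      nlinarith [this]
    obtain ⟨j, hj⟩ := Nat.exists_eq_add_of_le hq1
    have hj' : j < 2 * n + 3 := by omega
    have hle : ENNReal.ofReal ((S (q n) ω) ^ 2 + (S (q n + j) ω - S (q n) ω) ^ 2) ≤
        ENNReal.ofReal ((S (q n) ω) ^ 2) +
          ∑ j ∈ Finset.range (2 * n + 3), ENNReal.ofReal ((S (q n + j) ω - S (q n) ω) ^ 2) := by
      rw [ENNReal.ofReal_add (sq_nonneg _) (sq_nonneg _)]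
      gcongr
      exact Finset.single_le_sum
        (f := fun j => ENNReal.ofReal ((S (q n + j) ω - S (q n) ω) ^ 2)) (fun _ _ => zero_le)
        (Finset.mem_range.2 hj')
    have hT4 : ((T : ℝ) ^ 2)⁻¹ ≤ ((n + 1 : ℝ) ^ 4)⁻¹ := by
      have h1 : ((n + 1 : ℝ)) ^ 2 ≤ T := by exact_mod_cast hq1
      have h2 : (n + 1 : ℝ) ^ 4 = ((n + 1 : ℝ) ^ 2) ^ 2 := by ring
      rw [h2]
      gcongr
    calc ENNReal.ofReal (((T : ℝ)⁻¹ * S T ω) ^ 2)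
        ≤ ENNReal.ofReal (2 * (((n + 1 : ℝ) ^ 4)⁻¹ *
          ((S (q n) ω) ^ 2 + (S (q n + j) ω - S (q n) ω) ^ 2))) := by
          refine ENNReal.ofReal_le_ofReal ?_
          rw [mul_pow, inv_pow]
          have h3 : (S T ω) ^ 2 ≤ 2 * ((S (q n) ω) ^ 2 + (S (q n + j) ω - S (q n) ω) ^ 2) := by
            rw [hj]; nlinarith [sq_nonneg (S (q n + j) ω - 2 * S (q n) ω)]
          calc ((T : ℝ) ^ 2)⁻¹ * (S T ω) ^ 2 ≤ ((n + 1 : ℝ) ^ 4)⁻¹ *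
                (2 * ((S (q n) ω) ^ 2 + (S (q n + j) ω - S (q n) ω) ^ 2)) := by gcongr
            _ = _ := by ring
      _ = 2 * (ENNReal.ofReal (((n + 1 : ℝ) ^ 4)⁻¹) *
          ENNReal.ofReal ((S (q n) ω) ^ 2 + (S (q n + j) ω - S (q n) ω) ^ 2)) := by
          rw [ENNReal.ofReal_mul (by norm_num), ENNReal.ofReal_mul (by positivity)]
          norm_num
      _ ≤ _ := by simp only [G]; gcongr
  have hsq : Tendsto (fun T => Nat.sqrt T - 1) atTop atTop := by
    refine tendsto_atTop.2 fun b => ?_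
    filter_upwards [eventually_ge_atTop ((b + 1) * (b + 1))] with T hT
    have := Nat.le_sqrt.2 hT
    omega
  have h2G : Tendsto (fun T => 2 * G (Nat.sqrt T - 1) ω) atTop (𝓝 0) := by
    have := ENNReal.Tendsto.const_mul (a := 2) (hG0.comp hsq) (Or.inr (by norm_num))
    simpa using this
  have h3 : Tendsto (fun T : ℕ => ENNReal.ofReal (((T : ℝ)⁻¹ * S T ω) ^ 2)) atTop (𝓝 0) :=
    tendsto_of_tendsto_of_tendsto_of_le_of_le' tendsto_const_nhds h2G
      (Eventually.of_forall fun _ => zero_le)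
      (by filter_upwards [eventually_ge_atTop 1] with T hT using hbound T hT)
  have h4 : Tendsto (fun T : ℕ => ((T : ℝ)⁻¹ * S T ω) ^ 2) atTop (𝓝 0) := by
    have := (ENNReal.tendsto_toReal ENNReal.zero_ne_top).comp h3
    refine (this.congr fun T => ?_)
    simp [ENNReal.toReal_ofReal (sq_nonneg _)]
  have h5 := h4.sqrt
  simp only [Real.sqrt_sq_eq_abs, Real.sqrt_zero] at h5
  exact (tendsto_zero_iff_abs_tendsto_zero _).2 h5

/-- The second moment of a finite sum of orthogonal square integrable variables. -/
theorem integral_sq_sum_of_orthogonal {ι : Type*} {d : ι → Ω → ℝ} (s : Finset ι)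
    (hd : ∀ t ∈ s, MemLp (d t) 2 μ)
    (horth : ∀ i ∈ s, ∀ j ∈ s, i ≠ j → ∫ ω, d i ω * d j ω ∂μ = 0) :
    ∫ ω, (∑ t ∈ s, d t ω) ^ 2 ∂μ = ∑ t ∈ s, ∫ ω, d t ω ^ 2 ∂μ := by
  have hint : ∀ i ∈ s, ∀ j ∈ s, Integrable (fun ω => d i ω * d j ω) μ := fun i hi j hj =>
    (hd i hi).integrable_mul (hd j hj)
  simp only [sq, Finset.sum_mul_sum]
  rw [integral_finsetSum _ fun i hi => integrable_finsetSum _ fun j hj => hint i hi j hj]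
  refine Finset.sum_congr rfl fun i hi => ?_
  rw [integral_finsetSum _ fun j hj => hint i hi j hj]
  exact Finset.sum_eq_single_of_mem i hi fun j hj hij => horth i hi j hj (Ne.symm hij)

theorem integral_mul_eq_zero_of_indep {G : MeasurableSpace Ω} {ζ η : Ω → ℝ} (hG : G ≤ mΩ)
    (hζ : Measurable[G] ζ) (hη : Measurable[mΩ] η)
    (hind : Indep G (MeasurableSpace.comap η inferInstance) μ) (h0 : ∫ ω, η ω ∂μ = 0) :
    ∫ ω, ζ ω * η ω ∂μ = 0 := by
  have h : IndepFun ζ η μ := by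
    rw [IndepFun_iff_Indep]
    exact indep_of_indep_of_le_left hind hζ.comap_le
  rw [h.integral_fun_mul_eq_mul_integral (hζ.mono hG le_rfl).aestronglyMeasurable
    hη.aestronglyMeasurable, h0, mul_zero]

/-- Products `ξ_t η_t` where `η_t` is centred and independent of a σ-algebra carrying `ξ_t`, and,
for any two indices, one of these σ-algebras carries the product at the other index. -/
structure IsOrthogonalProduct (μ : Measure Ω) (ξ η : ℕ → Ω → ℝ) (A B : ℝ) : Prop where
  exists_sigma : ∃ G : ℕ → MeasurableSpace Ω, (∀ t, G t ≤ mΩ) ∧ (∀ t, Measurable[G t] (ξ t)) ∧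
    (∀ t, Indep (G t) (MeasurableSpace.comap (η t) inferInstance) μ) ∧
    ∀ s t, s ≠ t → Measurable[G t] (fun ω => ξ s ω * η s ω) ∨ Measurable[G s] (fun ω => ξ t ω * η t ω)
  measurable_right : ∀ t, Measurable (η t)
  memLp_left : ∀ t, MemLp (ξ t) 2 μ
  memLp_right : ∀ t, MemLp (η t) 2 μ
  mean_right : ∀ t, ∫ ω, η t ω ∂μ = 0
  le_left : ∀ t, ∫ ω, ξ t ω ^ 2 ∂μ ≤ A
  le_right : ∀ t, ∫ ω, η t ω ^ 2 ∂μ ≤ B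

/-- Independence factors the second moment of the product, so no fourth moments are required. -/
theorem IsOrthogonalProduct.memLp_mul {ξ η : ℕ → Ω → ℝ} {A B : ℝ}
    (h : IsOrthogonalProduct μ ξ η A B) (t : ℕ) :
    MemLp (fun ω => ξ t ω * η t ω) 2 μ ∧ ∫ ω, (ξ t ω * η t ω) ^ 2 ∂μ ≤ A * B := by
  obtain ⟨G, hG, hξ, hind, -⟩ := h.exists_sigma
  have hi : IndepFun (ξ t) (η t) μ := by
    rw [IndepFun_iff_Indep]
    exact indep_of_indep_of_le_left (hind t) (hξ t).comap_le
  have hi2 : IndepFun (fun ω => ξ t ω ^ 2) (fun ω => η t ω ^ 2) μ :=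
    hi.comp (φ := fun x : ℝ => x ^ 2) (ψ := fun x : ℝ => x ^ 2) (by fun_prop) (by fun_prop)
  have h1 := (h.memLp_left t).integrable_sq
  have h2 := (h.memLp_right t).integrable_sq
  constructor
  · refine (memLp_two_iff_integrable_sq ((h.memLp_left t).1.mul (h.memLp_right t).1)).2 ?_
    simp only [Pi.mul_apply]
    simp only [mul_pow]
    exact hi2.integrable_mul h1 h2
  · simp only [mul_pow]
    rw [hi2.integral_fun_mul_eq_mul_integral h1.1 h2.1]
    exact mul_le_mul (h.le_left t) (h.le_right t) (integral_nonneg fun _ => sq_nonneg _)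
      ((integral_nonneg fun _ => sq_nonneg _).trans (h.le_left t))

/-- Whichever σ-algebra carries the other product, the centred factor at its own index is
independent of everything else in the integrand. Allowing either order covers increasing filtrations
of the past and decreasing ones of the future. -/
theorem IsOrthogonalProduct.integral_eq_zero {ξ η : ℕ → Ω → ℝ} {A B : ℝ}
    (h : IsOrthogonalProduct μ ξ η A B) {s t : ℕ} (hst : s ≠ t) :
    ∫ ω, (ξ s ω * η s ω) * (ξ t ω * η t ω) ∂μ = 0 := by
  obtain ⟨G, hG, hξ, hind, hor⟩ := h.exists_sigma
  have key : ∀ i j, Measurable[G j] (fun ω => ξ i ω * η i ω) →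
      ∫ ω, (ξ i ω * η i ω) * (ξ j ω * η j ω) ∂μ = 0 := by
    intro i j hm
    have := integral_mul_eq_zero_of_indep (hG j)
      (Measurable.mul hm (hξ j)) (h.measurable_right j) (hind j) (h.mean_right j)
    simpa only [mul_assoc, Pi.mul_apply] using this
  rcases hor s t hst with hm | hm
  · exact key s t hm
  · have := key t s hm
    simpa only [mul_comm] using this

theorem IsOrthogonalProduct.lintegral_gap_le {ξ η : ℕ → Ω → ℝ} {A B : ℝ}
    (h : IsOrthogonalProduct μ ξ η A B) (m k : ℕ) :
    ∫⁻ ω, ENNReal.ofReal ((∑ t ∈ Finset.range (m + k), ξ t ω * η t ω -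
      ∑ t ∈ Finset.range m, ξ t ω * η t ω) ^ 2) ∂μ ≤ ENNReal.ofReal (A * B * k) := by
  simp only [Finset.sum_range_add, add_sub_cancel_left]
  rw [← ofReal_integral_eq_lintegral_ofReal
    ((memLp_finsetSum _ fun x _ => (h.memLp_mul (m + x)).1).integrable_sq)
    (Eventually.of_forall fun _ => sq_nonneg _)]
  refine ENNReal.ofReal_le_ofReal ?_
  rw [integral_sq_sum_of_orthogonal (d := fun x ω => ξ (m + x) ω * η (m + x) ω) _
    (fun x _ => (h.memLp_mul (m + x)).1)
    (fun i _ j _ hij => h.integral_eq_zero (by omega))]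
  calc _ ≤ ∑ _x ∈ Finset.range k, A * B := Finset.sum_le_sum fun x _ => (h.memLp_mul (m + x)).2
    _ = _ := by simp [mul_comm]

/-- The averages of an orthogonal sequence of products converge to zero almost surely. -/
theorem IsOrthogonalProduct.ae_tendsto_avg {ξ η : ℕ → Ω → ℝ} {A B : ℝ}
    (h : IsOrthogonalProduct μ ξ η A B) : ∀ᵐ ω ∂μ, Tendsto
      (fun T : ℕ => (T : ℝ)⁻¹ * ∑ t ∈ Finset.range T, ξ t ω * η t ω) atTop (𝓝 0) :=
  ae_tendsto_div_of_gap (S := fun T ω => ∑ t ∈ Finset.range T, ξ t ω * η t ω)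
    (fun _ => Finset.aemeasurable_fun_sum _ fun t _ => (h.memLp_mul t).1.1.aemeasurable)
    (fun _ => by simp) h.lintegral_gap_le

end StrongLaw

end PreviewLQR

namespace PreviewLQR

/-! ### Averages of products of white noise -/

section WhiteNoise

variable {Ω : Type*} {nw : ℕ} {w : ℕ → Ω → Fin nw → ℝ}

/-- The σ-algebra generated by the disturbances with index in `S`. -/
abbrev noiseSigma (w : ℕ → Ω → Fin nw → ℝ) (S : Set ℕ) : MeasurableSpace Ω :=
  ⨆ i ∈ S, MeasurableSpace.comap (w i) inferInstance

theorem measurable_noiseSigma {S : Set ℕ} {i : ℕ} (hi : i ∈ S) :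
    Measurable[noiseSigma w S] (w i) := by
  rw [measurable_iff_comap_le]
  exact le_iSup₂ (f := fun i (_ : i ∈ S) => MeasurableSpace.comap (w i) inferInstance) i hi

theorem measurable_noiseSigma_coord {S : Set ℕ} {i : ℕ} (hi : i ∈ S) (a : Fin nw) :
    Measurable[noiseSigma w S] (fun ω => w i ω a) :=
  (measurable_pi_apply a).comp (measurable_noiseSigma hi)

theorem noiseSigma_mono {S T : Set ℕ} (h : S ⊆ T) : noiseSigma w S ≤ noiseSigma w T :=
  biSup_mono h

variable [mΩ : MeasurableSpace Ω] {μ : Measure Ω}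

theorem IsWhiteNoise.noiseSigma_le (hw : IsWhiteNoise μ w) (S : Set ℕ) : noiseSigma w S ≤ mΩ :=
  iSup₂_le fun i _ => (hw.measurable i).comap_le

theorem IsWhiteNoise.indep_noiseSigma (hw : IsWhiteNoise μ w) {S T : Set ℕ} (h : Disjoint S T) :
    Indep (noiseSigma w S) (noiseSigma w T) μ :=
  indep_iSup_of_disjoint (fun i => (hw.measurable i).comap_le)
    ((iIndepFun_iff_iIndep _ _ _).1 hw.indep) h

theorem IsWhiteNoise.indep_coord (hw : IsWhiteNoise μ w) {S : Set ℕ} {t : ℕ} (h : t ∉ S)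
    (a : Fin nw) : Indep (noiseSigma w S)
      (MeasurableSpace.comap (fun ω => w t ω a) inferInstance) μ := by
  refine indep_of_indep_of_le_right
    (hw.indep_noiseSigma (S := S) (T := {t}) (Set.disjoint_singleton_right.2 h)) ?_
  exact (measurable_noiseSigma_coord (Set.mem_singleton t) a).comap_le

theorem IsWhiteNoise.measurable_coord (hw : IsWhiteNoise μ w) (t : ℕ) (a : Fin nw) :
    Measurable (fun ω => w t ω a) :=
  (measurable_pi_apply a).comp (hw.measurable t)

theorem IsWhiteNoise.memLp_coord (hw : IsWhiteNoise μ w) (t : ℕ) (a : Fin nw) :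
    MemLp (fun ω => w t ω a) 2 μ :=
  (hw.memLp t).eval a

theorem IsWhiteNoise.integral_sq_coord (hw : IsWhiteNoise μ w) (t : ℕ) (a : Fin nw) :
    ∫ ω, w t ω a ^ 2 ∂μ = 1 := by
  simpa [sq] using hw.cov t t a a

/-- The later factor `w (t + l)` is centred and independent of the noise before time `t + l`, which
carries the earlier factor and all previous products. -/
theorem IsWhiteNoise.ae_tendsto_avg_mul_of_lt (hw : IsWhiteNoise μ w) {k l : ℕ} (hkl : k < l)
    (a b : Fin nw) : ∀ᵐ ω ∂μ, Tendsto (fun T : ℕ => (T : ℝ)⁻¹ *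
      ∑ t ∈ Finset.range T, w (t + k) ω a * w (t + l) ω b) atTop (𝓝 0) := by
  refine IsOrthogonalProduct.ae_tendsto_avg (A := 1) (B := 1)
    (ξ := fun t ω => w (t + k) ω a) (η := fun t ω => w (t + l) ω b)
    ⟨⟨fun t => noiseSigma w (Set.Iio (t + l)), fun t => hw.noiseSigma_le _, fun t => ?_, fun t => ?_,
      fun s t hst => ?_⟩, fun t => hw.measurable_coord _ _, fun t => hw.memLp_coord _ _,
      fun t => hw.memLp_coord _ _, fun t => hw.mean _ _, fun t => (hw.integral_sq_coord _ _).le,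
      fun t => (hw.integral_sq_coord _ _).le⟩
  · exact measurable_noiseSigma_coord (by simp; omega) a
  · exact hw.indep_coord (by simp) b
  · rcases lt_or_gt_of_ne hst with h | h
    · left
      exact Measurable.mul (measurable_noiseSigma_coord (by simp; omega) a)
        (measurable_noiseSigma_coord (by simp; omega) b)
    · right
      exact Measurable.mul (measurable_noiseSigma_coord (by simp; omega) a)
        (measurable_noiseSigma_coord (by simp; omega) b)

/-- At equal lags the products are independent and identically distributed but only integrable, so
the classical strong law replaces the orthogonality argument. -/
theorem IsWhiteNoise.ae_tendsto_avg_mul_self (hw : IsWhiteNoise μ w) (k : ℕ) (a b : Fin nw) :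
    ∀ᵐ ω ∂μ, Tendsto (fun T : ℕ => (T : ℝ)⁻¹ *
      ∑ t ∈ Finset.range T, w (t + k) ω a * w (t + k) ω b) atTop (𝓝 (if a = b then 1 else 0)) := by
  have hm : Measurable fun v : Fin nw → ℝ => v a * v b := by fun_prop
  have h := strong_law_ae_real (μ := μ) (fun t ω => w (t + k) ω a * w (t + k) ω b)
    ((hw.memLp_coord _ _).integrable_mul (hw.memLp_coord _ _))
    (fun s t hst => (hw.indep.indepFun (show s + k ≠ t + k by omega)).comp hm hm)
    (fun t => ((hw.identDistrib (t + k)).trans (hw.identDistrib (0 + k)).symm).comp hm)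
  have h0 : ∫ ω, w (0 + k) ω a * w (0 + k) ω b ∂μ = if a = b then 1 else 0 := by
    simpa using hw.cov (0 + k) (0 + k) a b
  rw [h0] at h
  filter_upwards [h] with ω hω
  exact hω.congr fun T => div_eq_inv_mul _ _

/-- The averages of the products of the noise at two fixed lags converge. -/
theorem IsWhiteNoise.ae_tendsto_avg_mul (hw : IsWhiteNoise μ w) (k l : ℕ) (a b : Fin nw) :
    ∀ᵐ ω ∂μ, Tendsto (fun T : ℕ => (T : ℝ)⁻¹ *
      ∑ t ∈ Finset.range T, w (t + k) ω a * w (t + l) ω b) atTop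
        (𝓝 (if k = l ∧ a = b then 1 else 0)) := by
  rcases lt_trichotomy k l with h | rfl | h
  · simpa [h.ne] using hw.ae_tendsto_avg_mul_of_lt h a b
  · simpa using hw.ae_tendsto_avg_mul_self k a b
  · simpa [h.ne', mul_comm] using hw.ae_tendsto_avg_mul_of_lt h b a

theorem IsWhiteNoise.integral_sq_series (hw : IsWhiteNoise μ w) (m : ℕ → Fin nw → ℝ) (n t : ℕ) :
    ∫ ω, (∑ l ∈ Finset.range n, ∑ c, m l c * w (t + 1 + l) ω c) ^ 2 ∂μ =
      ∑ l ∈ Finset.range n, ∑ c, m l c ^ 2 := by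
  simp only [← Finset.sum_product']
  rw [integral_sq_sum_of_orthogonal
    (d := fun (i : ℕ × Fin nw) ω => m i.1 i.2 * w (t + 1 + i.1) ω i.2)]
  · refine Finset.sum_congr rfl fun i _ => ?_
    simp only [mul_pow]
    rw [integral_const_mul, hw.integral_sq_coord, mul_one]
  · exact fun i _ => (hw.memLp_coord _ _).const_mul _
  · intro i _ j _ hij
    have h : ∀ ω, m i.1 i.2 * w (t + 1 + i.1) ω i.2 * (m j.1 j.2 * w (t + 1 + j.1) ω j.2) =
        m i.1 i.2 * m j.1 j.2 * (w (t + 1 + i.1) ω i.2 * w (t + 1 + j.1) ω j.2) := fun ω => by ring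
    simp only [h]
    rw [integral_const_mul, hw.cov, if_neg, mul_zero]
    rintro ⟨h1, h2⟩
    exact hij (Prod.ext (by omega) h2)

/-- Time runs backwards: the σ-algebra at `t` is that of the noise strictly after `t`. It carries
the series and all later products, while `w t` is independent of it. The bound `K` does not depend
on the truncation `n`. -/
theorem IsWhiteNoise.isOrthogonalProduct_series (hw : IsWhiteNoise μ w) (m : ℕ → Fin nw → ℝ)
    {K : ℝ} (hK : ∀ n, ∑ l ∈ Finset.range n, ∑ c, m l c ^ 2 ≤ K) (a : Fin nw) (n : ℕ) :
    IsOrthogonalProduct μ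
      (fun t ω => ∑ l ∈ Finset.range n, ∑ c, m l c * w (t + 1 + l) ω c)
      (fun t ω => w t ω a) K 1 := by
  have hmeas : ∀ S : Set ℕ, ∀ t, (∀ l, t + 1 + l ∈ S) → Measurable[noiseSigma w S]
      (fun ω => ∑ l ∈ Finset.range n, ∑ c, m l c * w (t + 1 + l) ω c) := fun S t hS =>
    Finset.measurable_fun_sum _ fun l _ => Finset.measurable_fun_sum _ fun c _ =>
      (measurable_noiseSigma_coord (hS l) c).const_mul _
  refine ⟨⟨fun t => noiseSigma w (Set.Ioi t), fun t => hw.noiseSigma_le _, fun t => ?_, fun t => ?_,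
      fun s t hst => ?_⟩, fun t => hw.measurable_coord _ _, fun t => ?_,
      fun t => hw.memLp_coord _ _, fun t => hw.mean _ _, fun t => ?_,
      fun t => (hw.integral_sq_coord _ _).le⟩
  · exact hmeas _ t fun l => by simp; omega
  · exact hw.indep_coord (by simp) a
  · rcases lt_or_gt_of_ne hst with h | h
    · right
      exact Measurable.mul (hmeas _ t fun l => by simp; omega)
        (measurable_noiseSigma_coord (by simp; omega) a)
    · left
      exact Measurable.mul (hmeas _ s fun l => by simp; omega)
        (measurable_noiseSigma_coord (by simp; omega) a)
  · exact memLp_finsetSum _ fun l _ => memLp_finsetSum _ fun c _ => (hw.memLp_coord _ _).const_mul _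
  · rw [hw.integral_sq_series]
    exact hK n

/-- The averages of the products of the noise with a square summable series in the future noise
converge to zero. -/
theorem IsWhiteNoise.ae_tendsto_avg_mul_series (hw : IsWhiteNoise μ w) (m : ℕ → Fin nw → ℝ)
    {K : ℝ} (hK : ∀ n, ∑ l ∈ Finset.range n, ∑ c, m l c ^ 2 ≤ K) (a : Fin nw) {ζ : ℕ → Ω → ℝ}
    (hζ : ∀ᵐ ω ∂μ, ∀ t, Tendsto (fun n => ∑ l ∈ Finset.range n, ∑ c, m l c * w (t + 1 + l) ω c) atTop
      (𝓝 (ζ t ω))) :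
    ∀ᵐ ω ∂μ, Tendsto (fun T : ℕ => (T : ℝ)⁻¹ * ∑ t ∈ Finset.range T, ζ t ω * w t ω a) atTop
      (𝓝 0) := by
  let S' : ℕ → ℕ → Ω → ℝ := fun n T ω =>
    ∑ t ∈ Finset.range T, (∑ l ∈ Finset.range n, ∑ c, m l c * w (t + 1 + l) ω c) * w t ω a
  have hS'm : ∀ n T, AEMeasurable (S' n T) μ := fun n T => Finset.aemeasurable_fun_sum _ fun t _ =>
    ((hw.isOrthogonalProduct_series m hK a n).memLp_mul t).1.1.aemeasurable
  have hlim : ∀ᵐ ω ∂μ, ∀ T, Tendsto (fun n => S' n T ω) atTop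
      (𝓝 (∑ t ∈ Finset.range T, ζ t ω * w t ω a)) := by
    filter_upwards [hζ] with ω hω T
    exact tendsto_finsetSum _ fun t _ => (hω t).mul_const _
  refine ae_tendsto_div_of_gap (C := K * 1)
    (S := fun T ω => ∑ t ∈ Finset.range T, ζ t ω * w t ω a)
    (fun T => aemeasurable_of_tendsto_metrizable_ae atTop (fun n => hS'm n T)
      (by filter_upwards [hlim] with ω hω using hω T)) (fun _ => by simp) fun i k => ?_
  have hae : ∀ᵐ ω ∂μ, ENNReal.ofReal ((∑ t ∈ Finset.range (i + k), ζ t ω * w t ω a -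
      ∑ t ∈ Finset.range i, ζ t ω * w t ω a) ^ 2) =
      liminf (fun n => ENNReal.ofReal ((S' n (i + k) ω - S' n i ω) ^ 2)) atTop := by
    filter_upwards [hlim] with ω hω
    refine (Tendsto.liminf_eq ?_).symm
    exact (ENNReal.continuous_ofReal.tendsto _).comp (((hω (i + k)).sub (hω i)).pow 2)
  -- Fatou's lemma carries the window bound, uniform in the truncation, to the full series.
  rw [lintegral_congr_ae hae]
  refine (lintegral_liminf_le' fun n =>
    (((hS'm n _).sub (hS'm n _)).pow_const 2).ennreal_ofReal).trans ?_
  refine liminf_le_of_le (by isBoundedDefault) fun b hb => ?_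
  obtain ⟨n, hn⟩ := hb.exists
  exact hn.trans ((hw.isOrthogonalProduct_series m hK a n).lintegral_gap_le i k)

end WhiteNoise

end PreviewLQR

namespace PreviewLQR

/-! ### Completion of squares along trajectories -/

section Pathwise

variable {nx nu nw : ℕ} {D : Data nx nu nw} {P : Matrix (Fin nx) (Fin nx) ℝ}

theorem dotProduct_mulVec_comm {n : ℕ} {M : Matrix (Fin n) (Fin n) ℝ} (hM : Mᵀ = M)
    (x y : Fin n → ℝ) : x ⬝ᵥ M *ᵥ y = y ⬝ᵥ M *ᵥ x := by
  rw [Matrix.dotProduct_mulVec, ← Matrix.mulVec_transpose, hM, dotProduct_comm]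

theorem dotProduct_transpose_mulVec {n m : ℕ} (M : Matrix (Fin m) (Fin n) ℝ)
    (x : Fin n → ℝ) (y : Fin m → ℝ) : x ⬝ᵥ Mᵀ *ᵥ y = (M *ᵥ x) ⬝ᵥ y := by
  rw [Matrix.dotProduct_mulVec, Matrix.vecMul_transpose]

theorem Data.IsStabilizingSolution.H_mul_Kv (h : D.IsStabilizingSolution P) :
    D.H P * D.Kv P = D.Buᵀ := by
  rw [Data.Kv, ← Matrix.mul_assoc,
    Matrix.mul_nonsing_inv _ ((Matrix.isUnit_iff_isUnit_det _).1 h.H_posDef.isUnit), Matrix.one_mul]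

theorem Data.IsStabilizingSolution.Y_posSemidef (h : D.IsStabilizingSolution P) :
    (D.Y P).PosSemidef :=
  posSemidef_transpose_mul_mul h.H_posDef.posSemidef _

theorem Data.IsStabilizingSolution.Y_eq (h : D.IsStabilizingSolution P) :
    D.Y P = D.Bu * (D.H P)⁻¹ * D.Buᵀ := by
  have hH := posSemidef_transpose_eq h.H_posDef.inv.posSemidef
  rw [Data.Y, Matrix.mul_assoc, h.H_mul_Kv, Data.Kv, Matrix.transpose_mul, hH,
    Matrix.transpose_transpose]

theorem Data.Kx_eq_Kv_mul : D.Kx P = D.Kv P * (P * D.A) := by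
  simp only [Data.Kx, Data.Kv, Matrix.mul_assoc]

/-- The tail of the stage cost after completing the square in the input. -/
noncomputable def Data.noiseCost (D : Data nx nu nw) (P : Matrix (Fin nx) (Fin nx) ℝ) (d v : Fin nx → ℝ) : ℝ :=
  d ⬝ᵥ P *ᵥ d + 2 * (d ⬝ᵥ v) - (P *ᵥ d + v) ⬝ᵥ D.Y P *ᵥ (P *ᵥ d + v)

/-- The deviation of the input from the optimal one, given the signal `s`. -/
noncomputable def Data.inputGap (D : Data nx nu nw) (P : Matrix (Fin nx) (Fin nx) ℝ) (x : Fin nx → ℝ)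
    (u : Fin nu → ℝ) (s : Fin nx → ℝ) : Fin nu → ℝ :=
  u + (D.Kx P *ᵥ x + D.Kv P *ᵥ s)

/-- With `s = P d + v` and `g = P A x + s`, the terms in `u` are `uᵀ H u + 2 (Bu u)·g`, a square
centred at `-Kv g` minus `gᵀ Y g`. The Riccati equation, as `P = Q + Aᵀ P A - (P A)ᵀ Y (P A)`,
settles the part quadratic in `x`. The part linear in `x` becomes `Âᵀ s`, because `Â = A - Y P A`.
-/
theorem Data.IsStabilizingSolution.one_step (h : D.IsStabilizingSolution P) (x : Fin nx → ℝ)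
    (u : Fin nu → ℝ) (d v : Fin nx → ℝ) :
    x ⬝ᵥ D.Q *ᵥ x + u ⬝ᵥ D.R *ᵥ u +
        (D.A *ᵥ x + D.Bu *ᵥ u + d) ⬝ᵥ P *ᵥ (D.A *ᵥ x + D.Bu *ᵥ u + d) +
        2 * ((D.A *ᵥ x + D.Bu *ᵥ u + d) ⬝ᵥ v) =
      D.inputGap P x u (P *ᵥ d + v) ⬝ᵥ D.H P *ᵥ D.inputGap P x u (P *ᵥ d + v) +
        x ⬝ᵥ P *ᵥ x + 2 * (x ⬝ᵥ (D.Ahat P)ᵀ *ᵥ (P *ᵥ d + v)) + D.noiseCost P d v := by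
  have hP := posSemidef_transpose_eq h.posSemidef
  have hH := posSemidef_transpose_eq h.H_posDef.posSemidef
  have hY := posSemidef_transpose_eq h.Y_posSemidef
  set s := P *ᵥ d + v with hs
  set a := D.A *ᵥ x with ha
  set b := D.Bu *ᵥ u with hb
  obtain ⟨g, hg⟩ : ∃ g, g = P *ᵥ a + s := ⟨_, rfl⟩
  clear_value s a b
  have e1 : D.inputGap P x u s = u + D.Kv P *ᵥ g := by
    rw [Data.inputGap, hg, Matrix.mulVec_add, Data.Kx_eq_Kv_mul, ha, ← Matrix.mulVec_mulVec,
      ← Matrix.mulVec_mulVec]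
  have e2 : u ⬝ᵥ D.H P *ᵥ (D.Kv P *ᵥ g) = b ⬝ᵥ g := by
    rw [Matrix.mulVec_mulVec, h.H_mul_Kv, dotProduct_transpose_mulVec, ← hb]
  have e3 : (D.Kv P *ᵥ g) ⬝ᵥ D.H P *ᵥ (D.Kv P *ᵥ g) = g ⬝ᵥ D.Y P *ᵥ g := by
    rw [Data.Y, dotProduct_transpose_mul_mul]
  have e4 : u ⬝ᵥ D.H P *ᵥ u = u ⬝ᵥ D.R *ᵥ u + b ⬝ᵥ P *ᵥ b := by
    rw [Data.H, Matrix.add_mulVec, dotProduct_add, dotProduct_transpose_mul_mul, ← hb]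
  have e5 : x ⬝ᵥ P *ᵥ x = x ⬝ᵥ D.Q *ᵥ x + a ⬝ᵥ P *ᵥ a - (P *ᵥ a) ⬝ᵥ D.Y P *ᵥ (P *ᵥ a) := by
    have hdare : P = D.Q + D.Aᵀ * P * D.A - (P * D.A)ᵀ * D.Y P * (P * D.A) := by
      rw [h.Y_eq, Matrix.transpose_mul, hP, ← sub_eq_zero, ← h.dare]
      simp only [Matrix.mul_assoc]
      abel
    conv_lhs => rw [hdare]
    rw [Matrix.sub_mulVec, Matrix.add_mulVec, dotProduct_sub, dotProduct_add,
      dotProduct_transpose_mul_mul, dotProduct_transpose_mul_mul, ← Matrix.mulVec_mulVec, ← ha]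
  have e6 : x ⬝ᵥ (D.Ahat P)ᵀ *ᵥ s = a ⬝ᵥ s - (P *ᵥ a) ⬝ᵥ D.Y P *ᵥ s := by
    have : D.Ahat P = D.A - D.Y P * (P * D.A) := by
      rw [h.Y_eq, Data.Ahat, Data.Kx]; simp only [Matrix.mul_assoc]
    rw [dotProduct_transpose_mulVec, this, Matrix.sub_mulVec, sub_dotProduct,
      ← Matrix.mulVec_mulVec, ← Matrix.mulVec_mulVec, dotProduct_comm (D.Y P *ᵥ _),
      dotProduct_mulVec_comm hY, ← ha]
  have e7 : a ⬝ᵥ s = a ⬝ᵥ P *ᵥ d + a ⬝ᵥ v := by rw [hs, dotProduct_add]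
  have e8 : b ⬝ᵥ g = b ⬝ᵥ P *ᵥ a + b ⬝ᵥ P *ᵥ d + b ⬝ᵥ v := by
    rw [hg, hs, dotProduct_add, dotProduct_add]; ring
  have e9 : g ⬝ᵥ D.Y P *ᵥ g = (P *ᵥ a) ⬝ᵥ D.Y P *ᵥ (P *ᵥ a) + 2 * ((P *ᵥ a) ⬝ᵥ D.Y P *ᵥ s) +
      s ⬝ᵥ D.Y P *ᵥ s := by
    rw [hg]
    simp only [Matrix.mulVec_add, dotProduct_add, add_dotProduct]
    rw [dotProduct_mulVec_comm hY s]; ring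
  have e10 : (u + D.Kv P *ᵥ g) ⬝ᵥ D.H P *ᵥ (u + D.Kv P *ᵥ g) =
      u ⬝ᵥ D.R *ᵥ u + b ⬝ᵥ P *ᵥ b + 2 * (b ⬝ᵥ g) + g ⬝ᵥ D.Y P *ᵥ g := by
    rw [Matrix.mulVec_add, dotProduct_add, add_dotProduct, add_dotProduct, e2,
      dotProduct_mulVec_comm hH (D.Kv P *ᵥ g) u, e2, e3, e4]
    ring
  rw [e1, e10, e5, e6, e7, e8, e9, Data.noiseCost, ← hs]
  simp only [Matrix.mulVec_add, dotProduct_add, add_dotProduct]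
  rw [dotProduct_mulVec_comm hP d a, dotProduct_mulVec_comm hP d b, dotProduct_mulVec_comm hP a b]
  ring

/-- The accumulated cost along a trajectory, for an arbitrary reference signal `v`. -/
theorem Data.IsStabilizingSolution.sum_cost (h : D.IsStabilizingSolution P)
    {x : ℕ → Fin nx → ℝ} {u : ℕ → Fin nu → ℝ} {w : ℕ → Fin nw → ℝ} (v : ℕ → Fin nx → ℝ)
    (hx : ∀ t, x (t + 1) = D.A *ᵥ x t + D.Bu *ᵥ u t + D.Bw *ᵥ w t) (T : ℕ) :
    ∑ t ∈ Finset.range T, (x t ⬝ᵥ D.Q *ᵥ x t + u t ⬝ᵥ D.R *ᵥ u t) =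
      (x 0 ⬝ᵥ P *ᵥ x 0 + 2 * (x 0 ⬝ᵥ v 0)) - (x T ⬝ᵥ P *ᵥ x T + 2 * (x T ⬝ᵥ v T)) +
      ∑ t ∈ Finset.range T,
        (D.inputGap P (x t) (u t) (P *ᵥ (D.Bw *ᵥ w t) + v (t + 1)) ⬝ᵥ D.H P *ᵥ
          D.inputGap P (x t) (u t) (P *ᵥ (D.Bw *ᵥ w t) + v (t + 1)) +
        2 * (x t ⬝ᵥ ((D.Ahat P)ᵀ *ᵥ (P *ᵥ (D.Bw *ᵥ w t) + v (t + 1)) - v t)) +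
        D.noiseCost P (D.Bw *ᵥ w t) (v (t + 1))) := by
  induction T with
  | zero => simp
  | succ T ih =>
    have := h.one_step (x T) (u T) (D.Bw *ᵥ w T) (v (T + 1))
    rw [← hx] at this
    rw [Finset.sum_range_succ, Finset.sum_range_succ, ih, dotProduct_sub]
    linarith

/-! ### Averages of quadratic forms -/

/-- Convergence of the averages of a sequence. -/
def TendstoAvg (f : ℕ → ℝ) (c : ℝ) : Prop :=
  Tendsto (fun T : ℕ => (T : ℝ)⁻¹ * ∑ t ∈ Finset.range T, f t) atTop (𝓝 c)

theorem TendstoAvg.add {f g : ℕ → ℝ} {a b : ℝ} (hf : TendstoAvg f a) (hg : TendstoAvg g b) :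
    TendstoAvg (fun t => f t + g t) (a + b) := by
  refine (Tendsto.add hf hg).congr fun T => ?_
  rw [Finset.sum_add_distrib, mul_add]

theorem TendstoAvg.const_mul {f : ℕ → ℝ} {a : ℝ} (hf : TendstoAvg f a) (c : ℝ) :
    TendstoAvg (fun t => c * f t) (c * a) := by
  refine (Tendsto.const_mul c hf).congr fun T => ?_
  rw [← Finset.mul_sum]; ring

theorem TendstoAvg.sub {f g : ℕ → ℝ} {a b : ℝ} (hf : TendstoAvg f a) (hg : TendstoAvg g b) :
    TendstoAvg (fun t => f t - g t) (a - b) := by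
  refine (Tendsto.sub hf hg).congr fun T => ?_
  rw [Finset.sum_sub_distrib, mul_sub]

theorem TendstoAvg.sum {ι : Type*} {s : Finset ι} {f : ι → ℕ → ℝ} {a : ι → ℝ}
    (hf : ∀ i ∈ s, TendstoAvg (f i) (a i)) : TendstoAvg (fun t => ∑ i ∈ s, f i t) (∑ i ∈ s, a i) := by
  refine (tendsto_finsetSum s hf).congr fun T => ?_
  rw [Finset.sum_comm, Finset.mul_sum]

theorem TendstoAvg.congr {f g : ℕ → ℝ} {a : ℝ} (hf : TendstoAvg f a) (h : ∀ t, f t = g t) :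
    TendstoAvg g a := by
  rwa [← funext h]

theorem TendstoAvg.dotProduct_mulVec {m n : ℕ} {x : ℕ → Fin m → ℝ} {y : ℕ → Fin n → ℝ}
    {c : Fin m → Fin n → ℝ} (h : ∀ i j, TendstoAvg (fun t => x t i * y t j) (c i j))
    (M : Matrix (Fin m) (Fin n) ℝ) :
    TendstoAvg (fun t => x t ⬝ᵥ M *ᵥ y t) (∑ i, ∑ j, M i j * c i j) := by
  refine (TendstoAvg.sum fun i _ => TendstoAvg.sum fun j _ => (h i j).const_mul (M i j)).congr
    fun t => ?_
  simp only [dotProduct, Matrix.mulVec, Finset.mul_sum]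
  exact Finset.sum_congr rfl fun i _ => Finset.sum_congr rfl fun j _ => by ring

/-- Telescoping sums with `o(T)` boundary terms average to zero. -/
theorem tendstoAvg_telescope {f : ℕ → ℝ} (hf : Tendsto (fun T : ℕ => (T : ℝ)⁻¹ * f T) atTop (𝓝 0)) :
    TendstoAvg (fun t => f (t + 1) - f t) 0 := by
  have h0 : Tendsto (fun T : ℕ => (T : ℝ)⁻¹ * f 0) atTop (𝓝 0) := by
    simpa using (tendsto_inv_atTop_nhds_zero_nat (𝕜 := ℝ)).mul_const (f 0)
  have h := hf.sub h0
  rw [sub_zero] at h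
  refine Tendsto.congr (fun T => ?_) h
  rw [Finset.sum_range_sub, mul_sub]

/-- The pathwise laws of large numbers for white noise. -/
def HasWhiteAverages (w : ℕ → Fin nw → ℝ) : Prop :=
  ∀ k l a b, TendstoAvg (fun t => w (t + k) a * w (t + l) b) (if k = l ∧ a = b then 1 else 0)

theorem HasWhiteAverages.dotProduct_mulVec {w : ℕ → Fin nw → ℝ} (hw : HasWhiteAverages w)
    (k l : ℕ) (M : Matrix (Fin nw) (Fin nw) ℝ) :
    TendstoAvg (fun t => w (t + k) ⬝ᵥ M *ᵥ w (t + l)) (if k = l then M.trace else 0) := by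
  have := TendstoAvg.dotProduct_mulVec (fun i j => hw k l i j) M
  convert this using 1
  by_cases h : k = l <;> simp [h, Matrix.trace]

theorem dotProduct_mulVec_mulVec {l m n k : ℕ} (M : Matrix (Fin m) (Fin n) ℝ)
    (K : Matrix (Fin m) (Fin l) ℝ) (L : Matrix (Fin n) (Fin k) ℝ) (x : Fin l → ℝ) (y : Fin k → ℝ) :
    (K *ᵥ x) ⬝ᵥ M *ᵥ (L *ᵥ y) = x ⬝ᵥ (Kᵀ * M * L) *ᵥ y := by
  rw [← Matrix.mulVec_mulVec, ← Matrix.mulVec_mulVec, dotProduct_transpose_mulVec]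

/-! ### Truncated preview -/

/-- The preview signal truncated to `p` steps. -/
noncomputable def Data.vPre (D : Data nx nu nw) (P : Matrix (Fin nx) (Fin nx) ℝ) (w : ℕ → Fin nw → ℝ)
    (p t : ℕ) : Fin nx → ℝ :=
  ∑ l ∈ Finset.range p, D.vTerm P w t l

theorem Data.ahatT_mulVec_vTerm (D : Data nx nu nw) (P : Matrix (Fin nx) (Fin nx) ℝ)
    (w : ℕ → Fin nw → ℝ) (t l : ℕ) :
    (D.Ahat P)ᵀ *ᵥ D.vTerm P w (t + 1) l = D.vTerm P w t (l + 1) := by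
  rw [Data.vTerm, Data.vTerm, Matrix.mulVec_mulVec, pow_succ' _ (l + 1), add_right_comm, add_assoc]
  simp only [Matrix.mul_assoc]

theorem Data.ahatT_mulVec_noise (D : Data nx nu nw) (P : Matrix (Fin nx) (Fin nx) ℝ)
    (w : ℕ → Fin nw → ℝ) (t : ℕ) :
    (D.Ahat P)ᵀ *ᵥ (P *ᵥ (D.Bw *ᵥ w t)) = D.vTerm P w t 0 := by
  simp [Data.vTerm, Matrix.mulVec_mulVec, Matrix.mul_assoc]

/-- Applying `Âᵀ` shifts the series by one place and overshoots the truncation by one term. That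
term involves only `w (t + p)`, which no input before time `t` has seen. -/
theorem Data.ahatT_mulVec_add_vPre (D : Data nx nu nw) (P : Matrix (Fin nx) (Fin nx) ℝ)
    (w : ℕ → Fin nw → ℝ) (p t : ℕ) :
    (D.Ahat P)ᵀ *ᵥ (P *ᵥ (D.Bw *ᵥ w t) + D.vPre P w p (t + 1)) =
      D.vPre P w p t + D.vTerm P w t p := by
  rw [Matrix.mulVec_add, D.ahatT_mulVec_noise, Data.vPre, Matrix.mulVec_sum, Data.vPre,
    ← Finset.sum_range_succ, Finset.sum_range_succ']
  simp only [D.ahatT_mulVec_vTerm]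
  exact add_comm _ _

theorem Data.add_vPre_eq_sum (D : Data nx nu nw) (P : Matrix (Fin nx) (Fin nx) ℝ)
    (w : ℕ → Fin nw → ℝ) (p t : ℕ) :
    P *ᵥ (D.Bw *ᵥ w t) + D.vPre P w p (t + 1) =
      ∑ k ∈ Finset.range (p + 1), ((D.Ahat P)ᵀ ^ k * P * D.Bw) *ᵥ w (t + k) := by
  rw [Finset.sum_range_succ', add_comm, Data.vPre]
  congr 1
  · refine Finset.sum_congr rfl fun l _ => ?_
    rw [Data.vTerm, add_assoc, add_comm 1 l]
  · simp [Matrix.mulVec_mulVec]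

/-- The optimal cost with `p` steps of preview. -/
noncomputable def Data.previewCost (D : Data nx nu nw) (P : Matrix (Fin nx) (Fin nx) ℝ) (p : ℕ) : ℝ :=
  (D.Bwᵀ * P * D.Bw).trace - ∑ k ∈ Finset.range (p + 1),
    (((D.Ahat P)ᵀ ^ k * P * D.Bw)ᵀ * D.Y P * ((D.Ahat P)ᵀ ^ k * P * D.Bw)).trace

/-- The cost of the noncausal controller. -/
noncomputable def Data.noncausalCost (D : Data nx nu nw) (P X : Matrix (Fin nx) (Fin nx) ℝ) : ℝ :=
  (D.Bwᵀ * P * D.Bw).trace - (D.Y P * X).trace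

/-- Unrolling the Lyapunov equation `p + 1` times splits `tr(Y X)` into the sum subtracted in
`previewCost` and the stated remainder. -/
theorem Data.previewCost_sub_noncausalCost (hP : Pᵀ = P)
    {X : Matrix (Fin nx) (Fin nx) ℝ} (hX : D.IsLyapunovSolution P X) (p : ℕ) :
    D.previewCost P p - D.noncausalCost P X =
      (D.Y P * (D.Ahat P)ᵀ ^ (p + 1) * X * D.Ahat P ^ (p + 1)).trace := by
  have h1 := lyapunov_iterate hX (p + 1)
  have h2 : ∀ k, (((D.Ahat P)ᵀ ^ k * P * D.Bw)ᵀ * D.Y P * ((D.Ahat P)ᵀ ^ k * P * D.Bw)).trace =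
      (D.Y P * ((D.Ahat P)ᵀ ^ k * (P * D.Bw * D.Bwᵀ * P) * D.Ahat P ^ k)).trace := by
    intro k
    rw [Matrix.mul_assoc, Matrix.trace_mul_comm]
    simp only [Matrix.transpose_mul, Matrix.transpose_pow, Matrix.transpose_transpose, hP,
      Matrix.mul_assoc]
  rw [Data.previewCost, Data.noncausalCost]
  have h3 : (D.Y P * X).trace = (∑ k ∈ Finset.range (p + 1),
      (((D.Ahat P)ᵀ ^ k * P * D.Bw)ᵀ * D.Y P * ((D.Ahat P)ᵀ ^ k * P * D.Bw)).trace) +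
      (D.Y P * (D.Ahat P)ᵀ ^ (p + 1) * X * D.Ahat P ^ (p + 1)).trace := by
    conv_lhs => rw [h1]
    rw [Finset.sum_congr rfl fun k _ => h2 k, Matrix.mul_add, Matrix.trace_add, Matrix.mul_sum,
      Matrix.trace_sum]
    simp only [Matrix.mul_assoc]
  rw [h3]
  ring

/-- Products at distinct lags average to zero. The noise is therefore uncorrelated with the preview
signal ahead of it, and only the diagonal of the double sum for the `Y` term survives. -/
theorem HasWhiteAverages.noiseCost_vPre {w : ℕ → Fin nw → ℝ} (hw : HasWhiteAverages w) (p : ℕ) :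
    TendstoAvg (fun t => D.noiseCost P (D.Bw *ᵥ w t) (D.vPre P w p (t + 1)))
      (D.previewCost P p) := by
  have h1 : TendstoAvg (fun t => (D.Bw *ᵥ w t) ⬝ᵥ P *ᵥ (D.Bw *ᵥ w t)) (D.Bwᵀ * P * D.Bw).trace := by
    have := hw.dotProduct_mulVec 0 0 (D.Bwᵀ * P * D.Bw)
    simp only [add_zero, if_true] at this
    exact this.congr fun t => (dotProduct_mulVec_mulVec _ _ _ _ _).symm
  have h2 : TendstoAvg (fun t => (D.Bw *ᵥ w t) ⬝ᵥ D.vPre P w p (t + 1)) 0 := by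
    have := TendstoAvg.sum (s := Finset.range p) fun (l : ℕ) _ =>
      hw.dotProduct_mulVec 0 (l + 1) (D.Bwᵀ * (1 : Matrix (Fin nx) (Fin nx) ℝ) * ((D.Ahat P)ᵀ ^ (l + 1) * P * D.Bw))
    simp only [(Nat.succ_ne_zero _).symm, if_false, Finset.sum_const_zero] at this
    refine this.congr fun t => ?_
    rw [Data.vPre, dotProduct_sum]
    refine Finset.sum_congr rfl fun l _ => ?_
    rw [← dotProduct_mulVec_mulVec, Matrix.one_mulVec, Data.vTerm, add_zero, add_assoc, add_comm 1 l]
  have h3 : TendstoAvg (fun t => (P *ᵥ (D.Bw *ᵥ w t) + D.vPre P w p (t + 1)) ⬝ᵥ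
      D.Y P *ᵥ (P *ᵥ (D.Bw *ᵥ w t) + D.vPre P w p (t + 1))) (∑ k ∈ Finset.range (p + 1),
    (((D.Ahat P)ᵀ ^ k * P * D.Bw)ᵀ * D.Y P * ((D.Ahat P)ᵀ ^ k * P * D.Bw)).trace) := by
    have := TendstoAvg.sum (s := Finset.range (p + 1)) fun (k : ℕ) _ =>
      TendstoAvg.sum (s := Finset.range (p + 1)) fun (l : ℕ) _ => hw.dotProduct_mulVec k l
        (((D.Ahat P)ᵀ ^ k * P * D.Bw)ᵀ * D.Y P * ((D.Ahat P)ᵀ ^ l * P * D.Bw))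
    have e : ∀ k ∈ Finset.range (p + 1), (∑ l ∈ Finset.range (p + 1), if k = l then
        (((D.Ahat P)ᵀ ^ k * P * D.Bw)ᵀ * D.Y P * ((D.Ahat P)ᵀ ^ l * P * D.Bw)).trace else 0) =
        (((D.Ahat P)ᵀ ^ k * P * D.Bw)ᵀ * D.Y P * ((D.Ahat P)ᵀ ^ k * P * D.Bw)).trace := by
      intro k hk
      rw [Finset.sum_ite_eq, if_pos hk]
    rw [Finset.sum_congr rfl e] at this
    refine this.congr fun t => ?_
    rw [D.add_vPre_eq_sum, sum_dotProduct]
    refine Finset.sum_congr rfl fun k _ => ?_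
    rw [Matrix.mulVec_sum, dotProduct_sum]
    exact Finset.sum_congr rfl fun l _ => (dotProduct_mulVec_mulVec _ _ _ _ _).symm
  have := (h1.add (h2.const_mul 2)).sub h3
  rw [mul_zero, add_zero] at this
  exact this

end Pathwise

end PreviewLQR

namespace PreviewLQR

/-! ### Sequences growing slower than the square root -/

section Growth

/-- The sequence `g` is `o(√t)`. -/
def SqrtLittle {n : ℕ} (g : ℕ → Fin n → ℝ) : Prop :=
  Asymptotics.IsLittleO atTop g (fun t : ℕ => √(t : ℝ))

variable {n m : ℕ}

theorem sqrtLittle_iff_tendsto {g : ℕ → Fin n → ℝ} :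
    SqrtLittle g ↔ Tendsto (fun t : ℕ => ‖g t‖ / √(t : ℝ)) atTop (𝓝 0) := by
  rw [SqrtLittle, ← Asymptotics.isLittleO_norm_left, Asymptotics.isLittleO_iff_tendsto']
  filter_upwards [eventually_gt_atTop 0] with t ht h
  have : (0 : ℝ) < t := by exact_mod_cast ht
  exact absurd h (Real.sqrt_pos.2 this).ne'

theorem SqrtLittle.exists_bound {g : ℕ → Fin n → ℝ} (hg : SqrtLittle g) :
    ∃ B, 0 ≤ B ∧ ∀ t, ‖g t‖ ≤ B * √((t : ℝ) + 1) := by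
  have hpos : ∀ t : ℕ, 0 < √((t : ℝ) + 1) := fun t => Real.sqrt_pos.2 (by positivity)
  have hb : IsBoundedUnder (· ≤ ·) atTop (fun t : ℕ => ‖g t‖ / √((t : ℝ) + 1)) := by
    refine ⟨1, ?_⟩
    rw [eventually_map]
    filter_upwards [hg.bound one_pos] with t ht
    rw [div_le_one (hpos t)]
    refine ht.trans ?_
    rw [one_mul, Real.norm_of_nonneg (Real.sqrt_nonneg _)]
    exact Real.sqrt_le_sqrt (by linarith)
  obtain ⟨B, hB⟩ := hb.bddAbove_range
  have h : ∀ t, ‖g t‖ ≤ B * √((t : ℝ) + 1) := fun t => by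
    rw [← div_le_iff₀ (hpos t)]
    exact hB ⟨t, rfl⟩
  refine ⟨B, ?_, h⟩
  have := (norm_nonneg _).trans (h 0)
  simpa using this

theorem SqrtLittle.shift {g : ℕ → Fin n → ℝ} (hg : SqrtLittle g) (k : ℕ) :
    SqrtLittle (fun t => g (t + k)) := by
  have h1 : Asymptotics.IsLittleO atTop (fun t => g (t + k)) (fun t : ℕ => √((t + k : ℕ) : ℝ)) :=
    Asymptotics.IsLittleO.comp_tendsto hg (tendsto_add_atTop_nat k)
  refine h1.trans_isBigO (Asymptotics.IsBigO.of_bound (√((k : ℝ) + 1)) ?_)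
  filter_upwards [eventually_ge_atTop 1] with t ht
  rw [Real.norm_of_nonneg (Real.sqrt_nonneg _), Real.norm_of_nonneg (Real.sqrt_nonneg _),
    ← Real.sqrt_mul (by positivity)]
  refine Real.sqrt_le_sqrt ?_
  have : (1 : ℝ) ≤ t := by exact_mod_cast ht
  push_cast
  nlinarith [(Nat.cast_nonneg k : (0 : ℝ) ≤ k)]

theorem exists_mulVec_norm_le (M : Matrix (Fin m) (Fin n) ℝ) :
    ∃ C, 0 ≤ C ∧ ∀ v, ‖M *ᵥ v‖ ≤ C * ‖v‖ := by
  obtain ⟨C, hC, h⟩ := (LinearMap.toContinuousLinearMap M.mulVecLin).bound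
  exact ⟨C, hC.le, h⟩

theorem SqrtLittle.mulVec {g : ℕ → Fin n → ℝ} (hg : SqrtLittle g) (M : Matrix (Fin m) (Fin n) ℝ) :
    SqrtLittle (fun t => M *ᵥ g t) := by
  obtain ⟨C, -, h⟩ := exists_mulVec_norm_le M
  exact (Asymptotics.IsBigO.of_bound C (Eventually.of_forall fun t => h (g t))).trans_isLittleO hg

theorem SqrtLittle.add {g g' : ℕ → Fin n → ℝ} (hg : SqrtLittle g) (hg' : SqrtLittle g') :
    SqrtLittle (fun t => g t + g' t) :=
  Asymptotics.IsLittleO.add hg hg'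

theorem SqrtLittle.sum {ι : Type*} {s : Finset ι} {g : ι → ℕ → Fin n → ℝ}
    (hg : ∀ i ∈ s, SqrtLittle (g i)) : SqrtLittle (fun t => ∑ i ∈ s, g i t) := by
  have := Asymptotics.IsLittleO.sum hg
  rwa [Finset.sum_fn] at this

theorem tendsto_dotProduct_of_isLittleO {l : Filter ℕ} {x y : ℕ → Fin n → ℝ}
    (hx : Asymptotics.IsLittleO l x fun t : ℕ => √(t : ℝ))
    (hy : Asymptotics.IsLittleO l y fun t : ℕ => √(t : ℝ)) :
    Tendsto (fun T : ℕ => (T : ℝ)⁻¹ * (x T ⬝ᵥ y T)) l (𝓝 0) := by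
  have h : Asymptotics.IsLittleO l (fun T => x T ⬝ᵥ y T) (fun T : ℕ => (T : ℝ)) := by
    have hi : ∀ i ∈ Finset.univ, Asymptotics.IsLittleO l (fun T => x T i * y T i)
        (fun T : ℕ => (T : ℝ)) := by
      intro i _
      refine ((Asymptotics.isLittleO_pi.1 hx i).mul (Asymptotics.isLittleO_pi.1 hy i)).congr_right
        fun T => ?_
      exact Real.mul_self_sqrt (Nat.cast_nonneg T)
    have := Asymptotics.IsLittleO.sum hi
    rwa [Finset.sum_fn] at this
  exact h.tendsto_div_nhds_zero.congr fun T => div_eq_inv_mul _ _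

/-- `(w T)² / T` is `(T+1)/T` times the average of squares up to `T+1` minus the average up to `T`,
and both tend to `1`. -/
theorem HasWhiteAverages.sqrtLittle {w : ℕ → Fin n → ℝ} (hw : HasWhiteAverages w) :
    SqrtLittle w := by
  refine Asymptotics.isLittleO_pi.2 fun a => ?_
  have h := hw 0 0 a a
  simp only [add_zero, and_self, if_true, TendstoAvg] at h
  have h1 : Tendsto (fun T : ℕ => ((T : ℝ) + 1) / T) atTop (𝓝 1) := by
    have := (tendsto_inv_atTop_nhds_zero_nat (𝕜 := ℝ)).const_add 1
    rw [add_zero] at this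
    refine this.congr' ?_
    filter_upwards [eventually_gt_atTop 0] with T hT
    have : (T : ℝ) ≠ 0 := by positivity
    field_simp
  have h2 := (h1.mul (h.comp (tendsto_add_atTop_nat 1))).sub h
  rw [mul_one, sub_self] at h2
  have h3 : Tendsto (fun T : ℕ => (w T a / √(T : ℝ)) ^ 2) atTop (𝓝 0) := by
    refine h2.congr' ?_
    filter_upwards [eventually_gt_atTop 0] with T hT
    have h0 : (T : ℝ) ≠ 0 := by positivity
    have h0' : (T : ℝ) + 1 ≠ 0 := by positivity
    simp only [Function.comp_apply]
    rw [Finset.sum_range_succ, div_pow, Real.sq_sqrt (Nat.cast_nonneg T)]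
    push_cast
    field_simp
    ring
  have h4 := h3.sqrt
  simp only [Real.sqrt_sq_eq_abs, Real.sqrt_zero] at h4
  rw [Asymptotics.isLittleO_iff_tendsto']
  · exact (tendsto_zero_iff_abs_tendsto_zero _).2 h4
  · filter_upwards [eventually_gt_atTop 0] with t ht h
    have : (0 : ℝ) < t := by exact_mod_cast ht
    exact absurd h (Real.sqrt_pos.2 this).ne'

theorem PowDecay.exists_mulVec_le {M : Matrix (Fin n) (Fin n) ℝ} (h : PowDecay M) :
    ∃ C r : ℝ, 0 ≤ C ∧ 0 < r ∧ r < 1 ∧ ∀ k v, ‖M ^ k *ᵥ v‖ ≤ C * r ^ k * ‖v‖ := by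
  obtain ⟨C, r, h0, h1, h2, h3⟩ := h
  refine ⟨n * C, r, by positivity, h1, h2, fun k v => ?_⟩
  refine (pi_norm_le_iff_of_nonneg (by positivity)).2 fun i => ?_
  calc ‖(M ^ k *ᵥ v) i‖ ≤ ∑ j, ‖(M ^ k) i j * v j‖ :=
          norm_sum_le Finset.univ fun j => (M ^ k) i j * v j
    _ ≤ ∑ _j : Fin n, C * r ^ k * ‖v‖ := by
        refine Finset.sum_le_sum fun j _ => ?_
        rw [norm_mul]
        exact mul_le_mul (h3 k i j) (norm_le_pi_norm v j) (norm_nonneg _) (by positivity)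
    _ = _ := by simp; ring

theorem eq_pow_mulVec_add_sum {M : Matrix (Fin n) (Fin n) ℝ} {x g : ℕ → Fin n → ℝ}
    (hx : ∀ t, x (t + 1) = M *ᵥ x t + g t) (T : ℕ) :
    x T = M ^ T *ᵥ x 0 + ∑ k ∈ Finset.range T, M ^ k *ᵥ g (T - 1 - k) := by
  induction T with
  | zero => simp
  | succ T ih =>
    rw [hx, ih, Finset.sum_range_succ', Matrix.mulVec_add, Matrix.mulVec_mulVec, ← pow_succ',
      Matrix.mulVec_sum, add_assoc]
    congr 2
    · refine Finset.sum_congr rfl fun k _ => ?_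
      rw [Matrix.mulVec_mulVec, ← pow_succ']
      congr 2
      omega
    · simp

/-- Exponentially weighted sums over the past of an `o(√t)` sequence are `o(√t)`. -/
theorem SqrtLittle.tendsto_past {g : ℕ → Fin n → ℝ} (hg : SqrtLittle g) {r : ℝ} (h0 : 0 < r)
    (h1 : r < 1) : Tendsto (fun T : ℕ =>
      (∑ k ∈ Finset.range T, r ^ k * ‖g (T - 1 - k)‖) / √(T : ℝ)) atTop (𝓝 0) := by
  obtain ⟨B, hB, hbd⟩ := hg.exists_bound
  -- Extending by zero beyond `k < T` gives a series over a fixed index set. Dominated convergence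
  -- applies because `‖g (T-1-k)‖ ≤ B √T` for those `k`.
  let f : ℕ → ℕ → ℝ := fun T k => if k < T then r ^ k * (‖g (T - 1 - k)‖ / √(T : ℝ)) else 0
  have hf : ∀ T : ℕ, (∑ k ∈ Finset.range T, r ^ k * ‖g (T - 1 - k)‖) / √(T : ℝ) = ∑' k, f T k := by
    intro T
    rw [tsum_eq_sum (s := Finset.range T) fun k hk => if_neg (by simpa using hk), Finset.sum_div]
    refine Finset.sum_congr rfl fun k hk => ?_
    rw [if_pos (Finset.mem_range.1 hk), mul_div_assoc]
  simp only [hf]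
  rw [← tsum_zero (α := ℝ) (β := ℕ)]
  refine tendsto_tsum_of_dominated_convergence (bound := fun k => r ^ k * B)
    ((summable_geometric_of_lt_one h0.le h1).mul_right B) (fun k => ?_)
    (Eventually.of_forall fun T k => ?_)
  · have h2 : Tendsto (fun T : ℕ => r ^ k * (‖g (T - 1 - k)‖ / √((T - 1 - k : ℕ) : ℝ))) atTop
        (𝓝 0) := by
      have := ((sqrtLittle_iff_tendsto.1 hg).comp (tendsto_sub_atTop_nat (1 + k))).const_mul (r ^ k)
      rw [mul_zero] at this
      refine this.congr fun T => ?_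
      simp only [Function.comp_apply, Nat.sub_sub]
    refine tendsto_of_tendsto_of_tendsto_of_le_of_le' tendsto_const_nhds h2
      (Eventually.of_forall fun T => ?_) ?_
    · simp only [f]; split_ifs <;> positivity
    · filter_upwards [eventually_gt_atTop (k + 1)] with T hT
      simp only [f]
      rw [if_pos (by omega)]
      have h3 : (0 : ℝ) < ((T - 1 - k : ℕ) : ℝ) := by
        have : 0 < T - 1 - k := by omega
        exact_mod_cast this
      have h4 : ((T - 1 - k : ℕ) : ℝ) ≤ T := by
        have : T - 1 - k ≤ T := by omega
        exact_mod_cast this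
      have h5 := Real.sqrt_pos.2 h3
      gcongr
  · simp only [f]
    split_ifs with hk
    · have hT : (0 : ℝ) < T := by
        have : 0 < T := by omega
        exact_mod_cast this
      rw [Real.norm_of_nonneg (by positivity)]
      refine mul_le_mul_of_nonneg_left ?_ (by positivity)
      rw [div_le_iff₀ (Real.sqrt_pos.2 hT)]
      refine (hbd _).trans (mul_le_mul_of_nonneg_left (Real.sqrt_le_sqrt ?_) hB)
      have : T - 1 - k + 1 ≤ T := by omega
      exact_mod_cast this
    · rw [norm_zero]; positivity

theorem SqrtLittle.summable_future {g : ℕ → Fin n → ℝ} (hg : SqrtLittle g) {r : ℝ} (h0 : 0 < r)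
    (h1 : r < 1) (t : ℕ) : Summable (fun l => r ^ l * ‖g (t + l)‖) := by
  obtain ⟨B, hB, hbd⟩ := hg.exists_bound
  have hs : Summable fun l : ℕ => B * ((t + 1 : ℝ) * r ^ l + (l : ℝ) ^ 1 * r ^ l) :=
    (((summable_geometric_of_lt_one h0.le h1).mul_left _).add
      (summable_pow_mul_geometric_of_norm_lt_one 1
        (by rwa [Real.norm_of_nonneg h0.le]))).mul_left B
  refine Summable.of_nonneg_of_le (fun l => by positivity) (fun l => ?_) hs
  have h2 : √(((t + l : ℕ) : ℝ) + 1) ≤ t + 1 + l := by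
    rw [Real.sqrt_le_left (by positivity)]
    push_cast
    nlinarith [(Nat.cast_nonneg t : (0 : ℝ) ≤ t), (Nat.cast_nonneg l : (0 : ℝ) ≤ l)]
  calc r ^ l * ‖g (t + l)‖ ≤ r ^ l * (B * (t + 1 + l)) := by
        gcongr
        exact (hbd _).trans (mul_le_mul_of_nonneg_left h2 hB)
    _ = _ := by ring

/-- Exponentially weighted sums over the future of an `o(√t)` sequence are `o(√t)`. -/
theorem SqrtLittle.tendsto_future {g : ℕ → Fin n → ℝ} (hg : SqrtLittle g) {r : ℝ} (h0 : 0 < r)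
    (h1 : r < 1) : Tendsto (fun T : ℕ => (∑' l, r ^ l * ‖g (T + l)‖) / √(T : ℝ)) atTop (𝓝 0) := by
  obtain ⟨B, hB, hbd⟩ := hg.exists_bound
  have hf : ∀ T : ℕ, (∑' l, r ^ l * ‖g (T + l)‖) / √(T : ℝ) =
      ∑' l, r ^ l * (‖g (T + l)‖ / √(T : ℝ)) := by
    intro T
    rw [← tsum_div_const]
    exact tsum_congr fun l => mul_div_assoc _ _ _
  simp only [hf]
  rw [← tsum_zero (α := ℝ) (β := ℕ)]
  have hs : Summable fun l : ℕ => B * (2 * r ^ l + (l : ℝ) ^ 1 * r ^ l) :=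
    (((summable_geometric_of_lt_one h0.le h1).mul_left _).add
      (summable_pow_mul_geometric_of_norm_lt_one 1
        (by rwa [Real.norm_of_nonneg h0.le]))).mul_left B
  refine tendsto_tsum_of_dominated_convergence hs (fun l => ?_)
    (eventually_atTop.2 ⟨1, fun T hT l => ?_⟩)
  · have hl := sqrtLittle_iff_tendsto.1 (hg.shift l)
    simpa using hl.const_mul (r ^ l)
  · have hT' : (1 : ℝ) ≤ T := by exact_mod_cast hT
    rw [Real.norm_of_nonneg (by positivity)]
    -- For `T ≥ 1` the growth of `g` beyond `T` costs only a factor linear in `l`, which the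
    -- geometric weight sums.
    have h2 : √(((T + l : ℕ) : ℝ) + 1) ≤ (2 + l) * √(T : ℝ) := by
      rw [Real.sqrt_le_left (by positivity), mul_pow, Real.sq_sqrt (by positivity)]
      push_cast
      nlinarith [(Nat.cast_nonneg l : (0 : ℝ) ≤ l), mul_nonneg (Nat.cast_nonneg l : (0 : ℝ) ≤ l)
        (sub_nonneg.2 hT'), mul_nonneg (mul_nonneg (Nat.cast_nonneg l : (0 : ℝ) ≤ l)
        (Nat.cast_nonneg l : (0 : ℝ) ≤ l)) (sub_nonneg.2 hT')]
    have h3 : ‖g (T + l)‖ / √(T : ℝ) ≤ B * (2 + l) := by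
      rw [div_le_iff₀ (Real.sqrt_pos.2 (by linarith)), mul_assoc]
      exact (hbd _).trans (mul_le_mul_of_nonneg_left h2 hB)
    calc r ^ l * (‖g (T + l)‖ / √(T : ℝ)) ≤ r ^ l * (B * (2 + l)) := by gcongr
      _ = _ := by ring

/-- A stable linear recursion driven by an `o(√t)` sequence is `o(√t)`. -/
theorem PowDecay.sqrtLittle {M : Matrix (Fin n) (Fin n) ℝ} (h : PowDecay M) {x g : ℕ → Fin n → ℝ}
    (hg : SqrtLittle g) (hx : ∀ t, x (t + 1) = M *ᵥ x t + g t) : SqrtLittle x := by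
  obtain ⟨C, r, hC, h0, h1, h2⟩ := h.exists_mulVec_le
  rw [sqrtLittle_iff_tendsto]
  have hlim : Tendsto (fun T : ℕ => C * ‖x 0‖ * (√(T : ℝ))⁻¹ +
      C * ((∑ k ∈ Finset.range T, r ^ k * ‖g (T - 1 - k)‖) / √(T : ℝ))) atTop (𝓝 0) := by
    have h3 : Tendsto (fun T : ℕ => (√(T : ℝ))⁻¹) atTop (𝓝 0) :=
      tendsto_inv_atTop_zero.comp (Real.tendsto_sqrt_atTop.comp tendsto_natCast_atTop_atTop)
    simpa using (h3.const_mul (C * ‖x 0‖)).add ((hg.tendsto_past h0 h1).const_mul C)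
  refine squeeze_zero (fun T => by positivity) (fun T => ?_) hlim
  rw [← div_eq_mul_inv, ← mul_div_assoc, ← add_div]
  refine div_le_div_of_nonneg_right ?_ (Real.sqrt_nonneg _)
  rw [eq_pow_mulVec_add_sum hx T, Finset.mul_sum]
  refine (norm_add_le _ _).trans (add_le_add ?_ ((norm_sum_le _ _).trans
    (Finset.sum_le_sum fun k _ => ?_)))
  · refine (h2 _ _).trans ?_
    have := pow_le_one₀ (n := T) h0.le h1.le
    calc C * r ^ T * ‖x 0‖ ≤ C * 1 * ‖x 0‖ := by gcongr
      _ = _ := by ring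
  · exact (h2 _ _).trans (le_of_eq (by ring))

end Growth

/-! ### Growth of the truncated and infinite preview signals -/

section Preview

variable {nx nu nw : ℕ} {D : Data nx nu nw} {P : Matrix (Fin nx) (Fin nx) ℝ}
  {w : ℕ → Fin nw → ℝ}

theorem vTerm_eq (t l : ℕ) :
    D.vTerm P w t l = (D.Ahat P)ᵀ ^ l *ᵥ (((D.Ahat P)ᵀ * P * D.Bw) *ᵥ w (t + l)) := by
  rw [Data.vTerm, Matrix.mulVec_mulVec, pow_succ]
  simp only [Matrix.mul_assoc]

theorem SqrtLittle.norm_vTerm_le (hd : PowDecay (D.Ahat P)) :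
    ∃ C r : ℝ, 0 ≤ C ∧ 0 < r ∧ r < 1 ∧ ∀ t l, ‖D.vTerm P w t l‖ ≤
      C * (r ^ l * ‖((D.Ahat P)ᵀ * P * D.Bw) *ᵥ w (t + l)‖) := by
  obtain ⟨C, r, hC, h0, h1, h2⟩ := hd.transpose.exists_mulVec_le
  refine ⟨C, r, hC, h0, h1, fun t l => ?_⟩
  rw [vTerm_eq, ← mul_assoc]
  exact h2 _ _

theorem SqrtLittle.summable_vTerm (hw : SqrtLittle w) (hd : PowDecay (D.Ahat P)) (t : ℕ) :
    Summable (D.vTerm P w t) := by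
  obtain ⟨C, r, hC, h0, h1, h2⟩ := SqrtLittle.norm_vTerm_le (w := w) hd
  exact Summable.of_norm_bounded (((hw.mulVec _).summable_future h0 h1 t).mul_left C) (h2 t)

theorem SqrtLittle.vNC (hw : SqrtLittle w) (hd : PowDecay (D.Ahat P)) : SqrtLittle (D.vNC P w) := by
  obtain ⟨C, r, hC, h0, h1, h2⟩ := SqrtLittle.norm_vTerm_le (w := w) hd
  have hg := hw.mulVec ((D.Ahat P)ᵀ * P * D.Bw)
  rw [sqrtLittle_iff_tendsto]
  have hlim := (hg.tendsto_future h0 h1).const_mul C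
  rw [mul_zero] at hlim
  refine squeeze_zero (fun T => by positivity) (fun T => ?_) hlim
  rw [← mul_div_assoc]
  refine div_le_div_of_nonneg_right ?_ (Real.sqrt_nonneg _)
  rw [← tsum_mul_left]
  exact tsum_of_norm_bounded ((hg.summable_future h0 h1 T).mul_left C).hasSum (h2 T)

theorem SqrtLittle.vPre (hw : SqrtLittle w) (p : ℕ) : SqrtLittle (D.vPre P w p) :=
  SqrtLittle.sum fun l _ => (hw.shift l).mulVec _

/-- For the full series the shift leaves no remainder, so the state drops out of the cost identity
apart from the boundary and deviation terms. -/
theorem SqrtLittle.ahatT_mulVec_add_vNC (hw : SqrtLittle w) (hd : PowDecay (D.Ahat P)) (t : ℕ) :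
    (D.Ahat P)ᵀ *ᵥ (P *ᵥ (D.Bw *ᵥ w t) + D.vNC P w (t + 1)) = D.vNC P w t := by
  rw [Matrix.mulVec_add, D.ahatT_mulVec_noise, Data.vNC, Data.vNC,
    (hw.summable_vTerm hd t).tsum_eq_zero_add]
  congr 1
  have := (LinearMap.toContinuousLinearMap (D.Ahat P)ᵀ.mulVecLin).map_tsum
    (hw.summable_vTerm (P := P) (D := D) hd (t + 1))
  simp only [LinearMap.coe_toContinuousLinearMap', Matrix.mulVecLin_apply] at this
  rw [this]
  exact tsum_congr fun l => D.ahatT_mulVec_vTerm P w t l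

end Preview

end PreviewLQR

namespace PreviewLQR

/-! ### Average costs along trajectories -/

section AverageCost

variable {nx nu nw : ℕ} {D : Data nx nu nw} {P : Matrix (Fin nx) (Fin nx) ℝ}
  {w : ℕ → Fin nw → ℝ} {x : ℕ → Fin nx → ℝ} {u : ℕ → Fin nu → ℝ}

theorem Data.Kv_mulVec_noise (D : Data nx nu nw) (P : Matrix (Fin nx) (Fin nx) ℝ)
    (d : Fin nw → ℝ) (v : Fin nx → ℝ) :
    D.Kv P *ᵥ (P *ᵥ (D.Bw *ᵥ d) + v) = D.Kw P *ᵥ d + D.Kv P *ᵥ v := by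
  simp only [Matrix.mulVec_add, Matrix.mulVec_mulVec, Data.Kv, Data.Kw, Matrix.mul_assoc]

theorem Data.inputGap_eq_zero (D : Data nx nu nw) (P : Matrix (Fin nx) (Fin nx) ℝ)
    (x : Fin nx → ℝ) (d : Fin nw → ℝ) (v : Fin nx → ℝ) :
    D.inputGap P x (-(D.Kx P *ᵥ x) - D.Kw P *ᵥ d - D.Kv P *ᵥ v) (P *ᵥ (D.Bw *ᵥ d) + v) = 0 := by
  rw [Data.inputGap, D.Kv_mulVec_noise]
  abel

/-- The closed loop under the optimal input for the reference signal `v`. -/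
theorem Data.closedLoop_step (D : Data nx nu nw) (P : Matrix (Fin nx) (Fin nx) ℝ)
    (x : Fin nx → ℝ) (d : Fin nw → ℝ) (v : Fin nx → ℝ) :
    D.A *ᵥ x + D.Bu *ᵥ (-(D.Kx P *ᵥ x) - D.Kw P *ᵥ d - D.Kv P *ᵥ v) + D.Bw *ᵥ d =
      D.Ahat P *ᵥ x + ((D.Bw - D.Bu * D.Kw P) *ᵥ d + (-(D.Bu * D.Kv P)) *ᵥ v) := by
  rw [Data.Ahat, Matrix.sub_mulVec, Matrix.sub_mulVec, Matrix.neg_mulVec]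
  simp only [Matrix.mulVec_sub, Matrix.mulVec_neg, Matrix.mulVec_mulVec]
  abel

theorem tendsto_inv_mul_const (c : ℝ) : Tendsto (fun T : ℕ => (T : ℝ)⁻¹ * c) atTop (𝓝 0) := by
  simpa using (tendsto_inv_atTop_nhds_zero_nat (𝕜 := ℝ)).mul_const c

/-- The average cost of a trajectory, compared with the optimal cost with preview `p`. -/
theorem Data.IsStabilizingSolution.avgCost_eq (h : D.IsStabilizingSolution P)
    (hw : HasWhiteAverages w) (p : ℕ)
    (hx : ∀ t, x (t + 1) = D.A *ᵥ x t + D.Bu *ᵥ u t + D.Bw *ᵥ w t)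
    (hxw : ∀ i j, TendstoAvg (fun t => x t i * w (t + p) j) 0) :
    ∃ E : ℕ → ℝ, Tendsto E atTop (𝓝 (D.previewCost P p)) ∧ ∀ T, D.avgCost x u T =
      E T - (T : ℝ)⁻¹ * (x T ⬝ᵥ P *ᵥ x T + 2 * (x T ⬝ᵥ D.vPre P w p T)) +
      (T : ℝ)⁻¹ * ∑ t ∈ Finset.range T,
        D.inputGap P (x t) (u t) (P *ᵥ (D.Bw *ᵥ w t) + D.vPre P w p (t + 1)) ⬝ᵥ D.H P *ᵥ
          D.inputGap P (x t) (u t) (P *ᵥ (D.Bw *ᵥ w t) + D.vPre P w p (t + 1)) := by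
  have h1 : TendstoAvg (fun t => x t ⬝ᵥ D.vTerm P w t p) 0 := by
    have := TendstoAvg.dotProduct_mulVec hxw ((D.Ahat P)ᵀ ^ (p + 1) * P * D.Bw)
    simpa [Data.vTerm] using this
  have h2 := (h1.const_mul 2).add (hw.noiseCost_vPre (D := D) (P := P) p)
  rw [mul_zero, zero_add] at h2
  refine ⟨_, by simpa using (tendsto_inv_mul_const
    (x 0 ⬝ᵥ P *ᵥ x 0 + 2 * (x 0 ⬝ᵥ D.vPre P w p 0))).add h2, fun T => ?_⟩
  rw [Data.avgCost, h.sum_cost (D.vPre P w p) hx]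
  simp only [D.ahatT_mulVec_add_vPre, add_sub_cancel_left, Finset.sum_add_distrib]
  ring

theorem Data.avgCost_nonneg (hQ : D.Q.PosSemidef) (hR : D.R.PosDef) (x : ℕ → Fin nx → ℝ)
    (u : ℕ → Fin nu → ℝ) (T : ℕ) : 0 ≤ D.avgCost x u T := by
  refine mul_nonneg (by positivity) (Finset.sum_nonneg fun t _ => add_nonneg ?_ ?_)
  · simpa using hQ.dotProduct_mulVec_nonneg (x t)
  · simpa using hR.posSemidef.dotProduct_mulVec_nonneg (u t)

theorem Data.longRunCost_of_tendsto {c : ℝ} (h : Tendsto (D.avgCost x u) atTop (𝓝 c)) :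
    D.longRunCost x u = ENNReal.ofReal c :=
  ((ENNReal.continuous_ofReal.tendsto c).comp h).limsup_eq

/-- No trajectory that is `o(√t)` along a subsequence beats the optimal cost with preview `p`. -/
theorem Data.IsStabilizingSolution.previewCost_le_longRunCost (h : D.IsStabilizingSolution P)
    (hw : HasWhiteAverages w) (p : ℕ)
    (hx : ∀ t, x (t + 1) = D.A *ᵥ x t + D.Bu *ᵥ u t + D.Bw *ᵥ w t)
    (hxw : ∀ i j, TendstoAvg (fun t => x t i * w (t + p) j) 0) {l : Filter ℕ} [l.NeBot]
    (hl : l ≤ atTop) (hxl : Asymptotics.IsLittleO l x fun t : ℕ => √(t : ℝ)) :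
    ENNReal.ofReal (D.previewCost P p) ≤ D.longRunCost x u := by
  obtain ⟨E, hE, hav⟩ := h.avgCost_eq hw p hx hxw
  obtain ⟨C, -, hC⟩ := exists_mulVec_norm_le P
  have hPx : Asymptotics.IsLittleO l (fun t => P *ᵥ x t) fun t : ℕ => √(t : ℝ) :=
    (Asymptotics.IsBigO.of_bound C (Eventually.of_forall fun t => hC (x t))).trans_isLittleO hxl
  have hV : Tendsto (fun T : ℕ => E T -
      (T : ℝ)⁻¹ * (x T ⬝ᵥ P *ᵥ x T + 2 * (x T ⬝ᵥ D.vPre P w p T))) l (𝓝 (D.previewCost P p)) := by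
    have h1 := tendsto_dotProduct_of_isLittleO hxl hPx
    have h2 := tendsto_dotProduct_of_isLittleO hxl
      (Asymptotics.IsLittleO.mono (hw.sqrtLittle.vPre (D := D) (P := P) p) hl)
    have := (hE.mono_left hl).sub (h1.add (h2.const_mul 2))
    simp only [mul_zero, add_zero, sub_zero] at this
    refine this.congr fun T => ?_
    ring
  -- Discarding the nonnegative deviation term leaves a quantity that converges along `l`, and a
  -- limsup along a finer filter is at most the limsup along `atTop`.
  calc ENNReal.ofReal (D.previewCost P p)
      = limsup (fun T => ENNReal.ofReal (E T -
        (T : ℝ)⁻¹ * (x T ⬝ᵥ P *ᵥ x T + 2 * (x T ⬝ᵥ D.vPre P w p T)))) l :=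
        (((ENNReal.continuous_ofReal.tendsto _).comp hV).limsup_eq).symm
    _ ≤ limsup (fun T => ENNReal.ofReal (D.avgCost x u T)) l := by
        refine limsup_le_limsup (Eventually.of_forall fun T => ENNReal.ofReal_le_ofReal ?_)
        rw [hav T]
        refine le_add_of_nonneg_right (mul_nonneg (by positivity) (Finset.sum_nonneg fun t _ => ?_))
        simpa using h.H_posDef.posSemidef.dotProduct_mulVec_nonneg (D.inputGap P (x t) (u t) _)
    _ ≤ _ := limsup_le_limsup_of_le hl

/-- The control law with `p` steps of preview. -/
noncomputable def Data.previewLaw (D : Data nx nu nw) (P : Matrix (Fin nx) (Fin nx) ℝ) (p : ℕ)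
    (w : ℕ → Fin nw → ℝ) (t : ℕ) (x : Fin nx → ℝ) : Fin nu → ℝ :=
  -(D.Kx P *ᵥ x) - D.Kw P *ᵥ w t - D.Kv P *ᵥ D.vPre P w p (t + 1)

/-- The deviation vanishes identically. The closed loop is a stable recursion driven by `o(√t)`
signals, so the boundary terms vanish along the whole sequence. -/
theorem Data.IsStabilizingSolution.tendsto_avgCost_preview (h : D.IsStabilizingSolution P)
    (hw : HasWhiteAverages w) (p : ℕ)
    (hx : ∀ t, x (t + 1) = D.A *ᵥ x t + D.Bu *ᵥ u t + D.Bw *ᵥ w t)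
    (hu : ∀ t, u t = D.previewLaw P p w t (x t))
    (hxw : ∀ i j, TendstoAvg (fun t => x t i * w (t + p) j) 0) :
    Tendsto (D.avgCost x u) atTop (𝓝 (D.previewCost P p)) := by
  obtain ⟨E, hE, hav⟩ := h.avgCost_eq hw p hx hxw
  have hwl := hw.sqrtLittle
  have hv : SqrtLittle (D.vPre P w p) := hwl.vPre p
  have hxl : SqrtLittle x := by
    refine h.schur.powDecay.sqrtLittle (g := fun t => (D.Bw - D.Bu * D.Kw P) *ᵥ w t +
      (-(D.Bu * D.Kv P)) *ᵥ D.vPre P w p (t + 1))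
      ((hwl.mulVec _).add ((hv.shift 1).mulVec _)) fun t => ?_
    rw [hx, hu, Data.previewLaw, D.closedLoop_step]
  have h1 := tendsto_dotProduct_of_isLittleO hxl (hxl.mulVec P)
  have h2 := tendsto_dotProduct_of_isLittleO hxl hv
  have := hE.sub (h1.add (h2.const_mul 2))
  simp only [mul_zero, add_zero, sub_zero] at this
  refine this.congr fun T => ?_
  rw [hav T]
  have h0 : ∀ t, D.inputGap P (x t) (u t) (P *ᵥ (D.Bw *ᵥ w t) + D.vPre P w p (t + 1)) = 0 :=
    fun t => by rw [hu, Data.previewLaw, D.inputGap_eq_zero]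
  simp only [h0, zero_dotProduct, Finset.sum_const_zero, mul_zero]
  ring

/-- A double series over all lags is avoided by means of the dual Lyapunov solution `N = Y + Â N
Âᵀ`. As `Âᵀ` maps `P Bw w t + v (t+1)` to `v t`, the `Y` form there is its `N` form minus the `N`
form at `v t`. The preview part telescopes, leaving equal-time noise and cross terms that average to
zero. -/
theorem Data.IsStabilizingSolution.tendsto_avgCost_nc (h : D.IsStabilizingSolution P)
    {X : Matrix (Fin nx) (Fin nx) ℝ} (hX : D.IsLyapunovSolution P X) (hw : HasWhiteAverages w)
    (hvw : ∀ i j, TendstoAvg (fun t => D.vNC P w (t + 1) i * w t j) 0) (x₀ : Fin nx → ℝ) :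
    Tendsto (D.avgCost (D.ncState P x₀ w) (D.ncInput P x₀ w)) atTop
      (𝓝 (D.noncausalCost P X)) := by
  have hd := h.schur.powDecay
  have hwl := hw.sqrtLittle
  have hP := posSemidef_transpose_eq h.posSemidef
  set x := D.ncState P x₀ w with hxdef
  set u := D.ncInput P x₀ w with hudef
  set v := D.vNC P w with hvdef
  have hx : ∀ t, x (t + 1) = D.A *ᵥ x t + D.Bu *ᵥ u t + D.Bw *ᵥ w t := fun t => rfl
  have hu : ∀ t, u t = -(D.Kx P *ᵥ x t) - D.Kw P *ᵥ w t - D.Kv P *ᵥ v (t + 1) := fun t => rfl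
  have hv : SqrtLittle v := hwl.vNC hd
  have hrec : ∀ t, (D.Ahat P)ᵀ *ᵥ (P *ᵥ (D.Bw *ᵥ w t) + v (t + 1)) = v t :=
    fun t => hwl.ahatT_mulVec_add_vNC hd t
  clear_value x u v
  have hxl : SqrtLittle x := by
    refine hd.sqrtLittle (g := fun t => (D.Bw - D.Bu * D.Kw P) *ᵥ w t +
      (-(D.Bu * D.Kv P)) *ᵥ v (t + 1))
      ((hwl.mulVec _).add ((hv.shift 1).mulVec _)) fun t => ?_
    rw [hx, hu, D.closedLoop_step]
  obtain ⟨N, hN⟩ := hd.transpose.exists_lyapunov (D.Y P)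
  have hNsymm := posSemidef_transpose_eq (hd.transpose.lyapunov_posSemidef h.Y_posSemidef hN)
  -- Duality of the two Lyapunov equations: substituting each and using cyclicity moves `Â` from `N`
  -- to `X`.
  have htr : (D.Y P * X).trace = ((P * D.Bw)ᵀ * N * (P * D.Bw)).trace := by
    have hY : D.Y P = N - D.Ahat P * N * (D.Ahat P)ᵀ := by
      rw [← sub_eq_zero, ← hN, Matrix.transpose_transpose]; abel
    have hW : P * D.Bw * D.Bwᵀ * P = X - (D.Ahat P)ᵀ * X * D.Ahat P := by
      rw [← sub_eq_zero, ← show _ = _ from hX]; abel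
    have e1 : ((P * D.Bw)ᵀ * N * (P * D.Bw)).trace = (N * (P * D.Bw * D.Bwᵀ * P)).trace := by
      rw [Matrix.mul_assoc, Matrix.trace_mul_comm, Matrix.transpose_mul, hP]
      simp only [Matrix.mul_assoc]
    have e2 : (D.Ahat P * N * (D.Ahat P)ᵀ * X).trace = (N * ((D.Ahat P)ᵀ * X * D.Ahat P)).trace := by
      rw [show D.Ahat P * N * (D.Ahat P)ᵀ * X = D.Ahat P * (N * (D.Ahat P)ᵀ * X) by
        simp only [Matrix.mul_assoc], Matrix.trace_mul_comm]
      simp only [Matrix.mul_assoc]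
    rw [e1, hW, hY, Matrix.sub_mul, Matrix.mul_sub, Matrix.trace_sub, Matrix.trace_sub, e2]
  have h1 : TendstoAvg (fun t => (D.Bw *ᵥ w t) ⬝ᵥ P *ᵥ (D.Bw *ᵥ w t)) (D.Bwᵀ * P * D.Bw).trace := by
    have := hw.dotProduct_mulVec 0 0 (D.Bwᵀ * P * D.Bw)
    simp only [add_zero, if_true] at this
    exact this.congr fun t => (dotProduct_mulVec_mulVec _ _ _ _ _).symm
  have h2 : TendstoAvg (fun t => (P *ᵥ (D.Bw *ᵥ w t)) ⬝ᵥ N *ᵥ (P *ᵥ (D.Bw *ᵥ w t)))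
      (D.Y P * X).trace := by
    have := hw.dotProduct_mulVec 0 0 ((P * D.Bw)ᵀ * N * (P * D.Bw))
    simp only [add_zero, if_true] at this
    rw [htr]
    refine this.congr fun t => ?_
    rw [Matrix.mulVec_mulVec, dotProduct_mulVec_mulVec]
  have hcross : ∀ M : Matrix (Fin nx) (Fin nw) ℝ, TendstoAvg (fun t => v (t + 1) ⬝ᵥ M *ᵥ w t) 0 := by
    intro M
    simpa using TendstoAvg.dotProduct_mulVec hvw M
  have h3 : TendstoAvg (fun t => v (t + 1) ⬝ᵥ N *ᵥ v (t + 1) - v t ⬝ᵥ N *ᵥ v t) 0 :=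
    tendstoAvg_telescope (f := fun t => v t ⬝ᵥ N *ᵥ v t)
      (tendsto_dotProduct_of_isLittleO hv (hv.mulVec N))
  have hq : TendstoAvg (fun t => D.noiseCost P (D.Bw *ᵥ w t) (v (t + 1))) (D.noncausalCost P X) := by
    have := ((h1.add ((hcross D.Bw).const_mul 2)).sub
      ((h2.add ((hcross (N * P * D.Bw)).const_mul 2)).add h3))
    simp only [mul_zero, add_zero] at this
    refine this.congr fun t => ?_
    have hs : (P *ᵥ (D.Bw *ᵥ w t) + v (t + 1)) ⬝ᵥ D.Y P *ᵥ (P *ᵥ (D.Bw *ᵥ w t) + v (t + 1)) =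
        (P *ᵥ (D.Bw *ᵥ w t) + v (t + 1)) ⬝ᵥ N *ᵥ (P *ᵥ (D.Bw *ᵥ w t) + v (t + 1)) -
          v t ⬝ᵥ N *ᵥ v t := by
      have hY : D.Y P = N - ((D.Ahat P)ᵀ)ᵀ * N * (D.Ahat P)ᵀ := by
        rw [← sub_eq_zero, ← hN]; abel
      rw [hY, Matrix.sub_mulVec, dotProduct_sub, dotProduct_transpose_mul_mul, hrec]
    rw [Data.noiseCost, hs]
    simp only [Matrix.mulVec_add, dotProduct_add, add_dotProduct]
    rw [dotProduct_mulVec_comm hNsymm (P *ᵥ (D.Bw *ᵥ w t)) (v (t + 1)),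
      dotProduct_comm (D.Bw *ᵥ w t) (v (t + 1))]
    simp only [Matrix.mulVec_mulVec, Matrix.mul_assoc]
    ring
  have e1 := tendsto_dotProduct_of_isLittleO hxl (hxl.mulVec P)
  have e2 := tendsto_dotProduct_of_isLittleO hxl hv
  have := ((tendsto_inv_mul_const (x 0 ⬝ᵥ P *ᵥ x 0 + 2 * (x 0 ⬝ᵥ v 0))).add hq).sub
    (e1.add (e2.const_mul 2))
  simp only [mul_zero, add_zero, sub_zero, zero_add] at this
  refine this.congr fun T => ?_
  have h0 : ∀ t, D.inputGap P (x t) (u t) (P *ᵥ (D.Bw *ᵥ w t) + v (t + 1)) = 0 :=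
    fun t => by rw [hu, D.inputGap_eq_zero]
  rw [Data.avgCost, h.sum_cost v hx]
  simp only [h0, hrec, zero_dotProduct, sub_self, dotProduct_zero, mul_zero, zero_add]
  ring

end AverageCost

end PreviewLQR

namespace PreviewLQR

/-! ### Closed loops of preview policies -/

section ClosedLoop

variable {Ω : Type*} {nx nu nw p : ℕ} {D : Data nx nu nw}
  {w : ℕ → Ω → Fin nw → ℝ} {u : ℕ → Ω → Fin nu → ℝ} {x₀ : Fin nx → ℝ}

/-- The σ-algebra of the disturbances before time `n` and the inputs before time `t`. -/
abbrev historySigma (w : ℕ → Ω → Fin nw → ℝ) (u : ℕ → Ω → Fin nu → ℝ) (t n : ℕ) :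
    MeasurableSpace Ω :=
  noiseSigma w (Set.Iio n) ⊔ ⨆ s ∈ Set.Iio t, MeasurableSpace.comap (u s) inferInstance

theorem historySigma_mono {t t' n n' : ℕ} (ht : t ≤ t') (hn : n ≤ n') :
    historySigma w u t n ≤ historySigma w u t' n' :=
  sup_le_sup (noiseSigma_mono (Set.Iio_subset_Iio hn)) (biSup_mono (Set.Iio_subset_Iio ht))

theorem measurable_historySigma_noise {t n i : ℕ} (hi : i < n) :
    Measurable[historySigma w u t n] (w i) :=
  (measurable_noiseSigma (w := w) (S := Set.Iio n) hi).mono le_sup_left le_rfl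

theorem measurable_historySigma_input {t n s : ℕ} (hs : s < t) :
    Measurable[historySigma w u t n] (u s) := by
  rw [measurable_iff_comap_le]
  exact (le_iSup₂ (f := fun s (_ : s ∈ Set.Iio t) => MeasurableSpace.comap (u s) inferInstance)
    s hs).trans le_sup_right

theorem measurable_mulVec {m n : ℕ} (M : Matrix (Fin m) (Fin n) ℝ) :
    Measurable fun v : Fin n → ℝ => M *ᵥ v :=
  (Continuous.matrix_mulVec continuous_const continuous_id).measurable

theorem measurable_state_of_lt {G : MeasurableSpace Ω} {t : ℕ}
    (hw : ∀ s < t, Measurable[G] (w s)) (hu : ∀ s < t, Measurable[G] (u s)) :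
    Measurable[G] (fun ω => D.state x₀ (fun s => u s ω) (fun s => w s ω) t) := by
  induction t with
  | zero => exact measurable_const
  | succ t ih =>
    have h1 := ih (fun s hs => hw s (hs.trans t.lt_succ_self)) fun s hs => hu s (hs.trans t.lt_succ_self)
    exact (((measurable_mulVec D.A).comp h1).add
      ((measurable_mulVec D.Bu).comp (hu t t.lt_succ_self))).add
      ((measurable_mulVec D.Bw).comp (hw t t.lt_succ_self))

theorem measurable_state_historySigma {t n : ℕ} (hn : t ≤ n) : Measurable[historySigma w u t n]
    (fun ω => D.state x₀ (fun s => u s ω) (fun s => w s ω) t) :=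
  measurable_state_of_lt (fun _ hs => measurable_historySigma_noise (hs.trans_le hn))
    fun _ hs => measurable_historySigma_input hs

theorem measurable_info_of_lt {G : MeasurableSpace Ω} {t : ℕ}
    (hw : ∀ s < t + p + 1, Measurable[G] (w s)) (hu : ∀ s < t, Measurable[G] (u s)) :
    Measurable[G] (fun ω =>
      info p (D.state x₀ (fun s => u s ω) (fun s => w s ω)) (fun s => w s ω) t) := by
  refine Measurable.prodMk (measurable_pi_iff.2 fun s => ?_) (measurable_pi_iff.2 fun s => ?_)
  · exact measurable_state_of_lt (fun _ hs => hw _ (by omega)) fun _ hs => hu _ (by omega)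
  · exact hw _ s.2

theorem noiseSigma_le_pastInputs (S : Set ℕ) (t : ℕ) : noiseSigma w S ≤ pastInputs w u t :=
  (iSup₂_le fun i _ => le_iSup (fun i => MeasurableSpace.comap (w i) inferInstance) i).trans
    le_sup_left

theorem historySigma_le_pastInputs (t n : ℕ) : historySigma w u t n ≤ pastInputs w u t := by
  refine sup_le (noiseSigma_le_pastInputs _ t) (iSup₂_le fun s hs => ?_)
  exact (le_iSup (fun s : Fin t => MeasurableSpace.comap (u s) inferInstance) ⟨s, hs⟩).trans
    le_sup_right

variable [mΩ : MeasurableSpace Ω] {μ : Measure Ω}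

theorem historySigma_le (hw : ∀ t, Measurable (w t)) (hu : ∀ t, Measurable (u t)) (t n : ℕ) :
    historySigma w u t n ≤ mΩ :=
  sup_le (iSup₂_le fun i _ => (hw i).comap_le) (iSup₂_le fun i _ => (hu i).comap_le)

theorem pastInputs_le (hw : ∀ t, Measurable (w t)) (hu : ∀ t, Measurable (u t)) (t : ℕ) :
    pastInputs w u t ≤ mΩ :=
  sup_le (iSup_le fun i => (hw i).comap_le) (iSup_le fun i => (hu i).comap_le)

theorem IsWhiteNoise.ae_hasWhiteAverages (hw : IsWhiteNoise μ w) :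
    ∀ᵐ ω ∂μ, HasWhiteAverages fun t => w t ω := by
  simp only [HasWhiteAverages, ae_all_iff]
  exact fun k l a b => hw.ae_tendsto_avg_mul k l a b

/-- Along a subsequence the state of a stabilized closed loop is almost surely `o(√t)`. -/
theorem Data.IsStabilized.exists_subseq (hst : D.IsStabilized x₀ μ w u) :
    ∃ ns : ℕ → ℕ, StrictMono ns ∧ ∀ᵐ ω ∂μ, Asymptotics.IsLittleO (map ns atTop)
      (D.state x₀ (fun s => u s ω) (fun s => w s ω)) fun t : ℕ => √(t : ℝ) := by
  obtain ⟨C, hC⟩ := hst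
  let x : ℕ → Ω → Fin nx → ℝ := fun t ω => D.state x₀ (fun s => u s ω) (fun s => w s ω) t
  let f : ℕ → Ω → ℝ := fun T ω => (T : ℝ)⁻¹ * (x T ω ⬝ᵥ x T ω)
  have hint : ∀ T, Integrable (fun ω => x T ω ⬝ᵥ x T ω) μ := fun T => by
    simp only [dotProduct]
    exact integrable_finsetSum _ fun i _ => ((hC T).1.eval i).integrable_mul ((hC T).1.eval i)
  have hnn : ∀ T ω, 0 ≤ x T ω ⬝ᵥ x T ω := fun T ω =>
    Finset.sum_nonneg fun i _ => mul_self_nonneg _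
  -- Bounded second moments make `|x T|² / T` tend to zero in `L¹`, hence in measure, hence almost
  -- surely along a subsequence.
  have hf : Tendsto (fun T => eLpNorm (f T - 0) 1 μ) atTop (𝓝 0) := by
    have h1 : Tendsto (fun T : ℕ => ENNReal.ofReal ((T : ℝ)⁻¹ * C)) atTop (𝓝 0) := by
      have := (ENNReal.continuous_ofReal.tendsto 0).comp (tendsto_inv_mul_const C)
      rw [ENNReal.ofReal_zero] at this
      exact this
    refine tendsto_of_tendsto_of_tendsto_of_le_of_le tendsto_const_nhds h1 (fun _ => zero_le)
      fun T => ?_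
    rw [sub_zero, eLpNorm_one_eq_lintegral_enorm,
      ← ofReal_integral_norm_eq_lintegral_enorm ((hint T).const_mul _)]
    refine ENNReal.ofReal_le_ofReal ?_
    have h2 : ∀ ω, ‖f T ω‖ = (T : ℝ)⁻¹ * (x T ω ⬝ᵥ x T ω) := fun ω =>
      Real.norm_of_nonneg (mul_nonneg (by positivity) (hnn T ω))
    rw [integral_congr_ae (Eventually.of_forall h2), integral_const_mul]
    exact mul_le_mul_of_nonneg_left (hC T).2.2 (by positivity)
  obtain ⟨ns, hns, hae⟩ := (tendstoInMeasure_of_tendsto_eLpNorm one_ne_zero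
    (fun T => ((hint T).const_mul _).1) aestronglyMeasurable_const hf).exists_seq_tendsto_ae
  refine ⟨ns, hns, ?_⟩
  filter_upwards [hae] with ω hω
  rw [Asymptotics.isLittleO_map, Asymptotics.isLittleO_iff]
  intro c hc
  filter_upwards [hω.eventually_lt_const (sq_pos_of_pos hc : (0 : ℝ) < c ^ 2),
    hns.tendsto_atTop.eventually_gt_atTop 0] with k hk hk0
  have hT : (0 : ℝ) < (ns k : ℝ) := by exact_mod_cast hk0
  simp only [Function.comp_apply] at hk ⊢
  rw [inv_mul_lt_iff₀ hT] at hk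
  rw [Real.norm_of_nonneg (Real.sqrt_nonneg _)]
  refine (pi_norm_le_iff_of_nonneg (by positivity)).2 fun i => ?_
  rw [Real.norm_eq_abs]
  refine abs_le_of_sq_le_sq ?_ (by positivity)
  rw [mul_pow, Real.sq_sqrt hT.le]
  have h3 : x (ns k) ω i * x (ns k) ω i ≤ x (ns k) ω ⬝ᵥ x (ns k) ω :=
    Finset.single_le_sum (f := fun i => x (ns k) ω i * x (ns k) ω i)
      (fun i _ => mul_self_nonneg _) (Finset.mem_univ i)
  rw [← sq] at h3
  have : (x (ns k) ω i) ^ 2 ≤ c ^ 2 * (ns k : ℝ) := by linarith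
  exact this

variable [IsProbabilityMeasure μ]

/-- The integrated form of `condLaw`: on events known from the noise and past inputs, `u t ∈ S` may
be replaced by its conditional probability. -/
theorem Data.IsClosedLoop.setIntegral_law {K : Policy nx nu nw p} (hcl : D.IsClosedLoop K x₀ μ w u)
    (hw : ∀ t, Measurable (w t)) (t : ℕ) {S : Set (Fin nu → ℝ)} (hS : MeasurableSet S) {A : Set Ω}
    (hA : MeasurableSet[pastInputs w u t] A) :
    ∫ ω in A, (K.law t (info p (D.state x₀ (fun s => u s ω) (fun s => w s ω))
      (fun s => w s ω) t)).real S ∂μ = μ.real (A ∩ u t ⁻¹' S) := by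
  have hm := pastInputs_le hw hcl.measurable t
  have hSm : MeasurableSet (u t ⁻¹' S) := hcl.measurable t hS
  rw [← setIntegral_congr_ae (hm _ hA) ((hcl.condLaw t S hS).mono fun ω h _ => h),
    setIntegral_condExp hm ((integrable_const (1 : ℝ)).indicator hSm) hA,
    setIntegral_indicator hSm]
  simp

/-- Induction on the number of inputs. For `n ≥ t + 1 + p` the law of `u t` depends only on noise
before `n` and earlier inputs. Conditioning on all noise thus turns `u t ∈ S` into a function of a
history already independent of the noise from `n` on. -/
theorem Data.IsClosedLoop.indep_history {K : Policy nx nu nw p} (hcl : D.IsClosedLoop K x₀ μ w u)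
    (hw : IsWhiteNoise μ w) (t : ℕ) : ∀ n, t + p ≤ n →
      Indep (historySigma w u t n) (noiseSigma w (Set.Ici n)) μ := by
  induction t with
  | zero =>
    intro n _
    have h : historySigma w u 0 n = noiseSigma w (Set.Iio n) := by
      simp [historySigma]
    rw [h]
    exact hw.indep_noiseSigma (Set.disjoint_left.2 fun i hi hi' =>
      absurd (Set.mem_Iio.1 hi) (not_lt.2 (Set.mem_Ici.1 hi')))
  | succ t ih =>
    intro n hn
    have hle := historySigma_le hw.measurable hcl.measurable
    have hG : historySigma w u t n ≤ mΩ := hle t n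
    -- Adding `u t` to the history yields the σ-algebra generated by this π-system, on which
    -- independence is checked.
    let p1 : Set (Set Ω) := {A | ∃ B S, MeasurableSet[historySigma w u t n] B ∧ MeasurableSet S ∧ A = B ∩ u t ⁻¹' S}
    have hpi : IsPiSystem p1 := by
      rintro _ ⟨B, S, hB, hS, rfl⟩ _ ⟨B', S', hB', hS', rfl⟩ -
      refine ⟨B ∩ B', S ∩ S', hB.inter hB', hS.inter hS', ?_⟩
      rw [Set.preimage_inter, Set.inter_inter_inter_comm]
    have hgen : historySigma w u (t + 1) n = MeasurableSpace.generateFrom p1 := by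
      refine le_antisymm (sup_le ?_ (iSup₂_le fun s hs => ?_)) (MeasurableSpace.generateFrom_le ?_)
      · intro B hB
        exact MeasurableSpace.measurableSet_generateFrom
          ⟨B, Set.univ, le_sup_left (a := noiseSigma w (Set.Iio n)) _ hB, MeasurableSet.univ, by simp⟩
      · rcases (Nat.lt_succ_iff_lt_or_eq.1 hs) with h | rfl
        · intro B hB
          refine MeasurableSpace.measurableSet_generateFrom
            ⟨B, Set.univ, ?_, MeasurableSet.univ, by simp⟩
          exact (measurable_historySigma_input (w := w) (u := u) (n := n) h).comap_le _ hB
        · rintro _ ⟨S, hS, rfl⟩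
          exact MeasurableSpace.measurableSet_generateFrom
            ⟨Set.univ, S, MeasurableSet.univ, hS, by simp⟩
      · rintro _ ⟨B, S, hB, hS, rfl⟩
        exact (historySigma_mono t.le_succ le_rfl _ hB).inter
          (measurable_historySigma_input (w := w) (u := u) (n := n) t.lt_succ_self hS)
    refine IndepSets.indep (hle _ _) (hw.noiseSigma_le _) hpi
      (@MeasurableSpace.isPiSystem_measurableSet _ (noiseSigma w (Set.Ici n))) hgen
      (@MeasurableSpace.generateFrom_measurableSet _ (noiseSigma w (Set.Ici n))).symm ?_
    rw [IndepSets_iff]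
    rintro _ T ⟨B, S, hB, hS, rfl⟩ hT
    have hTm : MeasurableSet T := hw.noiseSigma_le _ _ hT
    have hBm : MeasurableSet B := hG _ hB
    let f : Ω → ℝ := fun ω => (K.law t (info p (D.state x₀ (fun s => u s ω) (fun s => w s ω))
      (fun s => w s ω) t)).real S
    have hf : Measurable[historySigma w u t n] f :=
      ((Kernel.measurable_coe (K.law t) hS).ennreal_toReal).comp
        (measurable_info_of_lt (D := D) (x₀ := x₀)
          (fun _ hs => measurable_historySigma_noise (by omega))
          fun _ hs => measurable_historySigma_input hs)
    have hBp : MeasurableSet[pastInputs w u t] B := historySigma_le_pastInputs t n _ hB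
    have hTp : MeasurableSet[pastInputs w u t] T := noiseSigma_le_pastInputs _ t _ hT
    have hind : IndepFun (B.indicator f) (T.indicator fun _ => (1 : ℝ)) μ := by
      rw [IndepFun_iff_Indep]
      refine indep_of_indep_of_le_left (indep_of_indep_of_le_right (ih n (by omega)) ?_) ?_
      · exact ((@measurable_const _ _ _ (noiseSigma w (Set.Ici n)) _).indicator hT).comap_le
      · exact (Measurable.indicator hf hB).comap_le
    have hfm : Measurable f := hf.mono hG le_rfl
    have key := hind.integral_fun_mul_eq_mul_integral
      (hfm.indicator hBm).aestronglyMeasurable (measurable_const.indicator hTm).aestronglyMeasurable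
    have e1 : (fun ω => B.indicator f ω * T.indicator (fun _ => (1 : ℝ)) ω) =
        (B ∩ T).indicator f := by
      funext ω
      by_cases h1 : ω ∈ B <;> by_cases h2 : ω ∈ T <;> simp [h1, h2]
    rw [e1, integral_indicator (hBm.inter hTm), integral_indicator hBm, integral_indicator hTm,
      hcl.setIntegral_law hw.measurable t hS hBp,
      hcl.setIntegral_law hw.measurable t hS (hBp.inter hTp)] at key
    simp only [setIntegral_const, smul_eq_mul, mul_one] at key
    rw [Set.inter_right_comm]
    simp only [measureReal_def, ← ENNReal.toReal_mul] at key
    exact (ENNReal.toReal_eq_toReal_iff' (measure_ne_top _ _)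
      (ENNReal.mul_ne_top (measure_ne_top _ _) (measure_ne_top _ _))).1 key

/-- The inputs before `t` have seen the noise only up to `t + p - 1`, so `w (t + p)` is independent
of the history carrying `x t` and the earlier products. Stabilization bounds the second moments of
the state. -/
theorem Data.IsClosedLoop.ae_tendstoAvg {K : Policy nx nu nw p} (hcl : D.IsClosedLoop K x₀ μ w u)
    (hst : D.IsStabilized x₀ μ w u) (hw : IsWhiteNoise μ w) (i : Fin nx) (j : Fin nw) :
    ∀ᵐ ω ∂μ, TendstoAvg (fun t => D.state x₀ (fun s => u s ω) (fun s => w s ω) t i *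
      w (t + p) ω j) 0 := by
  obtain ⟨C, hC⟩ := hst
  have hmx : ∀ t n, t ≤ n → Measurable[historySigma w u t n]
      (fun ω => D.state x₀ (fun s => u s ω) (fun s => w s ω) t i) := fun t n hn =>
    (measurable_pi_apply i).comp (measurable_state_historySigma hn)
  refine IsOrthogonalProduct.ae_tendsto_avg (A := C) (B := 1)
    (ξ := fun t ω => D.state x₀ (fun s => u s ω) (fun s => w s ω) t i)
    (η := fun t ω => w (t + p) ω j)
    ⟨⟨fun t => historySigma w u t (t + p), fun t => historySigma_le hw.measurable hcl.measurable _ _,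
      fun t => hmx t _ (by omega), fun t => ?_, fun s t hst => ?_⟩,
      fun t => hw.measurable_coord _ _, fun t => (hC t).1.eval i,
      fun t => hw.memLp_coord _ _, fun t => hw.mean _ _, fun t => ?_,
      fun t => (hw.integral_sq_coord _ _).le⟩
  · refine indep_of_indep_of_le_right (hcl.indep_history hw t (t + p) le_rfl) ?_
    exact (measurable_noiseSigma_coord (w := w) (S := Set.Ici (t + p)) Set.self_mem_Ici j).comap_le
  · have key : ∀ s t, s < t → Measurable[historySigma w u t (t + p)] (fun ω =>
        D.state x₀ (fun s => u s ω) (fun s => w s ω) s i * w (s + p) ω j) := by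
      intro s t h
      refine Measurable.mul ((hmx s (s + p) (by omega)).mono
        (historySigma_mono h.le (by omega)) le_rfl) ?_
      exact (measurable_pi_apply j).comp (measurable_historySigma_noise (by omega))
    rcases lt_or_gt_of_ne hst with h | h
    · exact Or.inl (key s t h)
    · exact Or.inr (key t s h)
  · refine (integral_mono ((hC t).1.eval i).integrable_sq ?_ fun ω => ?_).trans (hC t).2.2
    · simp only [dotProduct]
      exact integrable_finsetSum _ fun i _ => ((hC t).1.eval i).integrable_mul ((hC t).1.eval i)
    · simp only [dotProduct]
      rw [sq]
      exact Finset.single_le_sum (f := fun i =>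
        D.state x₀ (fun s => u s ω) (fun s => w s ω) t i *
          D.state x₀ (fun s => u s ω) (fun s => w s ω) t i)
        (fun i _ => mul_self_nonneg _) (Finset.mem_univ i)

/-- No stabilizing policy with `p` steps of preview beats `previewCost`. -/
theorem Data.IsClosedLoop.ae_previewCost_le {P : Matrix (Fin nx) (Fin nx) ℝ}
    {K : Policy nx nu nw p} (hcl : D.IsClosedLoop K x₀ μ w u)
    (hst : D.IsStabilized x₀ μ w u) (hw : IsWhiteNoise μ w) (hP : D.IsStabilizingSolution P) :
    ∀ᵐ ω ∂μ, ENNReal.ofReal (D.previewCost P p) ≤ D.runCost x₀ w u ω := by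
  obtain ⟨ns, hns, hae⟩ := hst.exists_subseq
  have hx : ∀ᵐ ω ∂μ, ∀ i j, TendstoAvg (fun t =>
      D.state x₀ (fun s => u s ω) (fun s => w s ω) t i * w (t + p) ω j) 0 := by
    simp only [ae_all_iff]
    exact fun i j => hcl.ae_tendstoAvg hst hw i j
  filter_upwards [hw.ae_hasWhiteAverages, hae, hx] with ω h1 h2 h3
  exact hP.previewCost_le_longRunCost h1 p (fun t => rfl) h3 hns.tendsto_atTop h2

end ClosedLoop

end PreviewLQR

namespace PreviewLQR

/-! ### Processes bounded in mean square -/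

section L2Bdd

variable {Ω : Type*} [MeasurableSpace Ω] {μ : Measure Ω} {m n : ℕ}

/-- A process of random vectors that is uniformly bounded in `L²`. -/
def L2Bdd (μ : Measure Ω) (g : ℕ → Ω → Fin n → ℝ) : Prop :=
  (∀ t, AEStronglyMeasurable (g t) μ) ∧ ∃ C : ℝ≥0∞, C ≠ ∞ ∧ ∀ t, eLpNorm (g t) 2 μ ≤ C

theorem aestronglyMeasurable_mulVec (M : Matrix (Fin m) (Fin n) ℝ) {f : Ω → Fin n → ℝ}
    (hf : AEStronglyMeasurable f μ) : AEStronglyMeasurable (fun ω => M *ᵥ f ω) μ :=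
  (Continuous.matrix_mulVec continuous_const continuous_id).comp_aestronglyMeasurable hf

theorem L2Bdd.mulVec {g : ℕ → Ω → Fin n → ℝ} (hg : L2Bdd μ g) (M : Matrix (Fin m) (Fin n) ℝ) :
    L2Bdd μ fun t ω => M *ᵥ g t ω := by
  obtain ⟨h1, C, hC, h2⟩ := hg
  obtain ⟨c, -, hc⟩ := exists_mulVec_norm_le M
  exact ⟨fun t => aestronglyMeasurable_mulVec M (h1 t), ENNReal.ofReal c * C,
    ENNReal.mul_ne_top ENNReal.ofReal_ne_top hC, fun t =>
    (eLpNorm_le_mul_eLpNorm_of_ae_le_mul (Eventually.of_forall fun ω => hc (g t ω)) 2).trans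
      (mul_le_mul_right (h2 t) _)⟩

theorem L2Bdd.add {g g' : ℕ → Ω → Fin n → ℝ} (hg : L2Bdd μ g) (hg' : L2Bdd μ g') :
    L2Bdd μ fun t ω => g t ω + g' t ω := by
  obtain ⟨h1, C, hC, h2⟩ := hg
  obtain ⟨h1', C', hC', h2'⟩ := hg'
  exact ⟨fun t => (h1 t).add (h1' t), C + C', ENNReal.add_ne_top.2 ⟨hC, hC'⟩, fun t =>
    (eLpNorm_add_le (h1 t) (h1' t) one_le_two).trans (add_le_add (h2 t) (h2' t))⟩

theorem L2Bdd.sum {g : ℕ → ℕ → Ω → Fin n → ℝ} (hg : ∀ l, L2Bdd μ (g l)) (k : ℕ) :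
    L2Bdd μ fun t ω => ∑ l ∈ Finset.range k, g l t ω := by
  induction k with
  | zero =>
    simp only [Finset.range_zero, Finset.sum_empty]
    exact ⟨fun _ => aestronglyMeasurable_const, 0, ENNReal.zero_ne_top, fun _ => by simp⟩
  | succ k ih =>
    simp only [Finset.sum_range_succ]
    exact ih.add (hg k)

theorem L2Bdd.shift {g : ℕ → Ω → Fin n → ℝ} (hg : L2Bdd μ g) (k : ℕ) :
    L2Bdd μ fun t ω => g (t + k) ω := by
  obtain ⟨h1, C, hC, h2⟩ := hg
  exact ⟨fun t => h1 (t + k), C, hC, fun t => h2 (t + k)⟩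

/-- A stable linear system driven by an `L²`-bounded process has an `L²`-bounded state. -/
theorem PowDecay.l2Bdd {M : Matrix (Fin n) (Fin n) ℝ} (h : PowDecay M) {x g : ℕ → Ω → Fin n → ℝ}
    (hg : L2Bdd μ g) (hx : ∀ t ω, x (t + 1) ω = M *ᵥ x t ω + g t ω) (hx0 : MemLp (x 0) 2 μ) :
    L2Bdd μ x := by
  obtain ⟨h1, C, hC, h2⟩ := hg
  obtain ⟨c, r, hc, hr0, hr1, hM⟩ := h.exists_mulVec_le
  have hsol : ∀ T, x T = (fun ω => M ^ T *ᵥ x 0 ω) +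
      ∑ k ∈ Finset.range T, fun ω => M ^ k *ᵥ g (T - 1 - k) ω := fun T => by
    funext ω
    rw [Pi.add_apply, Finset.sum_apply]
    exact eq_pow_mulVec_add_sum (x := fun t => x t ω) (fun t => hx t ω) T
  have hm : ∀ T k, AEStronglyMeasurable (fun ω => M ^ k *ᵥ g (T - 1 - k) ω) μ := fun T k =>
    aestronglyMeasurable_mulVec _ (h1 _)
  have hm0 : ∀ T, AEStronglyMeasurable (fun ω => M ^ T *ᵥ x 0 ω) μ := fun T =>
    aestronglyMeasurable_mulVec _ hx0.1
  have hms : ∀ T, AEStronglyMeasurable (∑ k ∈ Finset.range T, fun ω => M ^ k *ᵥ g (T - 1 - k) ω) μ :=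
    fun T => Finset.aestronglyMeasurable_sum _ fun k _ => hm T k
  have hb : ∀ (f : Ω → Fin n → ℝ) k, eLpNorm (fun ω => M ^ k *ᵥ f ω) 2 μ ≤
      ENNReal.ofReal (c * r ^ k) * eLpNorm f 2 μ := fun f k =>
    eLpNorm_le_mul_eLpNorm_of_ae_le_mul (Eventually.of_forall fun ω => hM k (f ω)) 2
  -- The bound is the decayed initial state plus the geometric series `∑ c rᵏ` times the bound on
  -- the driving process.
  refine ⟨fun T => ?_, ENNReal.ofReal c * eLpNorm (x 0) 2 μ + ENNReal.ofReal (c * (1 - r)⁻¹) * C,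
    ENNReal.add_ne_top.2 ⟨ENNReal.mul_ne_top ENNReal.ofReal_ne_top hx0.2.ne,
      ENNReal.mul_ne_top ENNReal.ofReal_ne_top hC⟩, fun T => ?_⟩
  · rw [hsol T]
    exact (hm0 T).add (hms T)
  · rw [hsol T]
    refine (eLpNorm_add_le (hm0 T) (hms T) one_le_two).trans (add_le_add ?_ ?_)
    · refine (hb _ T).trans (mul_le_mul_left (ENNReal.ofReal_le_ofReal ?_) _)
      exact mul_le_of_le_one_right hc (pow_le_one₀ hr0.le hr1.le)
    · calc eLpNorm (∑ k ∈ Finset.range T, fun ω => M ^ k *ᵥ g (T - 1 - k) ω) 2 μ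
          ≤ ∑ k ∈ Finset.range T, eLpNorm (fun ω => M ^ k *ᵥ g (T - 1 - k) ω) 2 μ :=
            eLpNorm_sum_le (fun k _ => hm T k) one_le_two
        _ ≤ ∑ k ∈ Finset.range T, ENNReal.ofReal (c * r ^ k) * C :=
            Finset.sum_le_sum fun k _ => (hb _ k).trans (mul_le_mul_right (h2 _) _)
        _ ≤ _ := by
            rw [← Finset.sum_mul, ← ENNReal.ofReal_sum_of_nonneg fun k _ => by positivity,
              ← Finset.mul_sum]
            refine mul_le_mul_left (ENNReal.ofReal_le_ofReal (mul_le_mul_of_nonneg_left ?_ hc)) _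
            rw [← tsum_geometric_of_lt_one hr0.le hr1]
            exact (summable_geometric_of_lt_one hr0.le hr1).sum_le_tsum _ fun _ _ => by positivity

theorem IsWhiteNoise.l2Bdd {w : ℕ → Ω → Fin n → ℝ} (hw : IsWhiteNoise μ w) : L2Bdd μ w :=
  ⟨fun t => (hw.memLp t).1, eLpNorm (w 0) 2 μ, (hw.memLp 0).2.ne,
    fun t => ((hw.identDistrib t).eLpNorm_eq 2).le⟩

theorem L2Bdd.memLp {g : ℕ → Ω → Fin n → ℝ} (hg : L2Bdd μ g) (t : ℕ) : MemLp (g t) 2 μ := by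
  obtain ⟨h1, C, hC, h2⟩ := hg
  exact ⟨h1 t, (h2 t).trans_lt hC.lt_top⟩

theorem L2Bdd.exists_bound [IsProbabilityMeasure μ] {g : ℕ → Ω → Fin n → ℝ} (hg : L2Bdd μ g) :
    ∃ C : ℝ, ∀ t, ‖∫ ω, g t ω ∂μ‖ ≤ C ∧ ∫ ω, g t ω ⬝ᵥ g t ω ∂μ ≤ C := by
  have hmem := hg.memLp
  obtain ⟨h1, C, hC, h2⟩ := hg
  have hsq : ∀ t, ∫ ω, ‖g t ω‖ ^ 2 ∂μ ≤ C.toReal ^ 2 := fun t => by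
    have h3 := (hmem t).eLpNorm_eq_integral_rpow_norm two_ne_zero ENNReal.ofNat_ne_top
    have h4 : (0 : ℝ) ≤ ∫ ω, ‖g t ω‖ ^ 2 ∂μ := integral_nonneg fun ω => by positivity
    have h5 := h2 t
    rw [h3] at h5
    have h6 := (ENNReal.ofReal_le_iff_le_toReal hC).1 h5
    simp only [ENNReal.toReal_ofNat, Real.rpow_two] at h6
    have h7 : ((∫ ω, ‖g t ω‖ ^ 2 ∂μ) ^ (2 : ℝ)⁻¹) ^ 2 = ∫ ω, ‖g t ω‖ ^ 2 ∂μ := by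
      rw [← Real.rpow_natCast, ← Real.rpow_mul h4]
      norm_num
    rw [← h7]
    exact pow_le_pow_left₀ (Real.rpow_nonneg h4 _) h6 2
  -- The mean is bounded through `‖g‖ ≤ 1 + ‖g‖²`. The norm is the sup norm, so passing to the dot
  -- product costs a factor `n`.
  refine ⟨max (1 + C.toReal ^ 2) (n * C.toReal ^ 2), fun t => ⟨le_max_of_le_left ?_,
    le_max_of_le_right ?_⟩⟩
  · have hi : Integrable (fun ω => ‖g t ω‖ ^ 2) μ := (hmem t).integrable_norm_pow two_ne_zero
    calc ‖∫ ω, g t ω ∂μ‖ ≤ ∫ ω, ‖g t ω‖ ∂μ := norm_integral_le_integral_norm _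
      _ ≤ ∫ ω, (1 + ‖g t ω‖ ^ 2) ∂μ := by
          refine integral_mono ((hmem t).integrable one_le_two).norm
            ((integrable_const 1).add hi) fun ω => ?_
          show ‖g t ω‖ ≤ 1 + ‖g t ω‖ ^ 2
          nlinarith [sq_nonneg (‖g t ω‖ - 1)]
      _ ≤ 1 + C.toReal ^ 2 := by
          rw [integral_add (integrable_const 1) hi]
          simpa using hsq t
  · have hi : Integrable (fun ω => ‖g t ω‖ ^ 2) μ := (hmem t).integrable_norm_pow two_ne_zero
    calc ∫ ω, g t ω ⬝ᵥ g t ω ∂μ ≤ ∫ ω, n * ‖g t ω‖ ^ 2 ∂μ := by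
          refine integral_mono_of_nonneg (Eventually.of_forall fun ω =>
            Finset.sum_nonneg fun i _ => mul_self_nonneg _) (hi.const_mul _)
            (Eventually.of_forall fun ω => ?_)
          calc g t ω ⬝ᵥ g t ω ≤ ∑ _i : Fin n, ‖g t ω‖ ^ 2 := by
                refine Finset.sum_le_sum fun i _ => ?_
                rw [← sq, ← sq_abs]
                exact pow_le_pow_left₀ (abs_nonneg _) (norm_le_pi_norm (g t ω) i) 2
            _ = _ := by simp
      _ ≤ n * C.toReal ^ 2 := by
          rw [integral_const_mul]
          exact mul_le_mul_of_nonneg_left (hsq t) (by positivity)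

end L2Bdd

/-! ### The optimal preview policy -/

section Preview

variable {nx nu nw : ℕ} {D : Data nx nu nw} {P : Matrix (Fin nx) (Fin nx) ℝ}

theorem Data.vPre_congr {w w' : ℕ → Fin nw → ℝ} {p t : ℕ} (h : ∀ s < t + p, w s = w' s) :
    D.vPre P w p t = D.vPre P w' p t :=
  Finset.sum_congr rfl fun l hl => by
    rw [Data.vTerm, Data.vTerm, h _ (by have := Finset.mem_range.1 hl; omega)]

/-- The law at time `t` reads the noise only up to `t + p`, so it is a function of the available
information and extending the known noise by zero is harmless. -/
theorem Data.previewLaw_congr {w w' : ℕ → Fin nw → ℝ} {p t : ℕ}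
    (h : ∀ s < t + p + 1, w s = w' s) (x : Fin nx → ℝ) :
    D.previewLaw P p w t x = D.previewLaw P p w' t x := by
  rw [Data.previewLaw, Data.previewLaw, h t (by omega), Data.vPre_congr fun s hs => h s (by omega)]

theorem Data.measurable_previewLaw {α : Type*} {G : MeasurableSpace α} {w : ℕ → α → Fin nw → ℝ}
    {x : α → Fin nx → ℝ} {p t : ℕ} (hw : ∀ s < t + p + 1, Measurable[G] (w s))
    (hx : Measurable[G] x) :
    Measurable[G] fun a => D.previewLaw P p (fun s => w s a) t (x a) := by
  refine (((measurable_mulVec _).comp hx).neg.sub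
    ((measurable_mulVec _).comp (hw t (by omega)))).sub ((measurable_mulVec _).comp ?_)
  refine Finset.measurable_fun_sum _ fun l hl => ?_
  exact (measurable_mulVec _).comp (hw _ (by have := Finset.mem_range.1 hl; omega))

/-- The disturbances known from the information at time `t`, extended by zero. -/
noncomputable def knownNoise {p t : ℕ} (s : ℕ) (i : Info nx nw p t) : Fin nw → ℝ :=
  if h : s < t + p + 1 then i.2 ⟨s, h⟩ else 0

theorem measurable_knownNoise {p t : ℕ} (s : ℕ) :
    Measurable (knownNoise s : Info nx nw p t → Fin nw → ℝ) := by
  unfold knownNoise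
  split_ifs
  · exact (measurable_pi_apply _).comp measurable_snd
  · exact measurable_const

/-- The deterministic policy that applies `previewLaw`. -/
noncomputable def Data.previewPolicy (D : Data nx nu nw) (P : Matrix (Fin nx) (Fin nx) ℝ) (p : ℕ) :
    Policy nx nu nw p where
  law t := Kernel.deterministic
    (fun i => D.previewLaw P p (fun s => knownNoise s i) t (i.1 (Fin.last t)))
    (Data.measurable_previewLaw (fun s _ => measurable_knownNoise s)
      ((measurable_pi_apply _).comp measurable_fst))
  isMarkov _ := Kernel.isMarkovKernel_deterministic _

theorem Data.previewPolicy_law_real {p t : ℕ} (i : Info nx nw p t) {S : Set (Fin nu → ℝ)}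
    (hS : MeasurableSet S) : ((D.previewPolicy P p).law t i).real S =
      S.indicator (fun _ => 1) (D.previewLaw P p (fun s => knownNoise s i) t (i.1 (Fin.last t))) := by
  rw [measureReal_def, Data.previewPolicy, Kernel.deterministic_apply' _ _ hS]
  by_cases h : D.previewLaw P p (fun s => knownNoise s i) t (i.1 (Fin.last t)) ∈ S <;> simp [h]

/-- The state under `previewLaw`. -/
noncomputable def Data.previewState (D : Data nx nu nw) (P : Matrix (Fin nx) (Fin nx) ℝ) (p : ℕ)
    (x₀ : Fin nx → ℝ) (w : ℕ → Fin nw → ℝ) : ℕ → Fin nx → ℝ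
  | 0 => x₀
  | t + 1 => D.A *ᵥ D.previewState P p x₀ w t +
      D.Bu *ᵥ D.previewLaw P p w t (D.previewState P p x₀ w t) + D.Bw *ᵥ w t

/-- The input generated by `previewLaw`. -/
noncomputable def Data.previewInput (D : Data nx nu nw) (P : Matrix (Fin nx) (Fin nx) ℝ) (p : ℕ)
    (x₀ : Fin nx → ℝ) (w : ℕ → Fin nw → ℝ) (t : ℕ) : Fin nu → ℝ :=
  D.previewLaw P p w t (D.previewState P p x₀ w t)

theorem Data.state_previewInput (p : ℕ) (x₀ : Fin nx → ℝ) (w : ℕ → Fin nw → ℝ) :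
    D.state x₀ (D.previewInput P p x₀ w) w = D.previewState P p x₀ w := by
  funext t
  induction t with
  | zero => rfl
  | succ t ih => rw [Data.state, ih, Data.previewState, Data.previewInput]

theorem Data.measurable_previewState {α : Type*} {G : MeasurableSpace α} {w : ℕ → α → Fin nw → ℝ}
    (hw : ∀ s, Measurable[G] (w s)) (p : ℕ) (x₀ : Fin nx → ℝ) (t : ℕ) :
    Measurable[G] fun a => D.previewState P p x₀ (fun s => w s a) t := by
  induction t with
  | zero => exact measurable_const
  | succ t ih =>
    exact (((measurable_mulVec D.A).comp ih).add ((measurable_mulVec D.Bu).comp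
      (Data.measurable_previewLaw (fun s _ => hw s) ih))).add ((measurable_mulVec D.Bw).comp (hw t))

variable {Ω : Type*} [MeasurableSpace Ω] {μ : Measure Ω} [IsProbabilityMeasure μ]
  {w : ℕ → Ω → Fin nw → ℝ}

/-- The input is itself measurable with respect to the noise, so the conditional expectation of its
indicator is that indicator, which is the mass given by the Dirac law. -/
theorem Data.isClosedLoop_preview (hw : ∀ t, Measurable (w t)) (p : ℕ) (x₀ : Fin nx → ℝ) :
    D.IsClosedLoop (D.previewPolicy P p) x₀ μ w
      fun t ω => D.previewInput P p x₀ (fun s => w s ω) t := by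
  have hm : ∀ t, Measurable fun ω => D.previewInput P p x₀ (fun s => w s ω) t := fun t =>
    Data.measurable_previewLaw (fun s _ => hw s) (Data.measurable_previewState hw p x₀ t)
  refine ⟨hm, fun t S hS => Eventually.of_forall fun ω => ?_⟩
  have hle := pastInputs_le hw hm t
  have hwp : ∀ s, Measurable[pastInputs w (fun t ω => D.previewInput P p x₀ (fun s => w s ω) t) t]
      (w s) := fun s =>
    measurable_iff_comap_le.2 ((le_iSup (fun s => MeasurableSpace.comap (w s) inferInstance) s).trans
      le_sup_left)
  have hmp : Measurable[pastInputs w (fun t ω => D.previewInput P p x₀ (fun s => w s ω) t) t]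
      fun ω => D.previewInput P p x₀ (fun s => w s ω) t :=
    Data.measurable_previewLaw (fun s _ => hwp s)
    (Data.measurable_previewState (D := D) (P := P) hwp p x₀ t)
  rw [condExp_of_stronglyMeasurable hle (stronglyMeasurable_const.indicator (hmp hS))
    ((integrable_const (1 : ℝ)).indicator (hm t hS))]
  have he : D.previewLaw P p (fun s => knownNoise s (info p
      (D.state x₀ (D.previewInput P p x₀ fun s => w s ω) fun s => w s ω) (fun s => w s ω) t)) t
      ((info p (D.state x₀ (D.previewInput P p x₀ fun s => w s ω) fun s => w s ω)
        (fun s => w s ω) t).1 (Fin.last t)) = D.previewInput P p x₀ (fun s => w s ω) t := by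
    rw [Data.previewInput, Data.state_previewInput]
    exact Data.previewLaw_congr (fun s hs => by simp [knownNoise, info, hs]) _
  show _ = ((D.previewPolicy P p).law t _).real S
  rw [Data.previewPolicy_law_real _ hS, he]
  rfl

theorem Data.isStabilized_preview (hw : IsWhiteNoise μ w) (hP : D.IsStabilizingSolution P) (p : ℕ)
    (x₀ : Fin nx → ℝ) :
    D.IsStabilized x₀ μ w fun t ω => D.previewInput P p x₀ (fun s => w s ω) t := by
  have hv : L2Bdd μ fun t ω => D.vPre P (fun s => w s ω) p t :=
    L2Bdd.sum (fun l => (hw.l2Bdd.shift l).mulVec _) p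
  have hx : L2Bdd μ fun t ω => D.previewState P p x₀ (fun s => w s ω) t := by
    refine hP.schur.powDecay.l2Bdd (g := fun t ω => (D.Bw - D.Bu * D.Kw P) *ᵥ w t ω +
      (-(D.Bu * D.Kv P)) *ᵥ D.vPre P (fun s => w s ω) p (t + 1))
      ((hw.l2Bdd.mulVec _).add ((hv.shift 1).mulVec _)) (fun t ω => ?_) (memLp_const x₀)
    rw [Data.previewState, Data.previewLaw, D.closedLoop_step]
  obtain ⟨C, hC⟩ := hx.exists_bound
  refine ⟨C, fun t => ?_⟩
  have he : (fun ω => D.state x₀ (fun s => D.previewInput P p x₀ (fun s => w s ω) s)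
      (fun s => w s ω) t) = fun ω => D.previewState P p x₀ (fun s => w s ω) t := by
    funext ω
    exact congrFun (Data.state_previewInput p x₀ _) t
  simp only [congrFun he]
  exact ⟨hx.memLp t, hC t⟩

/-- The vanishing cross average needed pathwise is the general fact about stabilizing policies,
applied to this policy. -/
theorem Data.ae_tendsto_avgCost_preview (hw : IsWhiteNoise μ w) (hP : D.IsStabilizingSolution P)
    (p : ℕ) (x₀ : Fin nx → ℝ) :
    ∀ᵐ ω ∂μ, Tendsto (D.avgCost (D.state x₀ (fun s => D.previewInput P p x₀ (fun s => w s ω) s)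
      (fun s => w s ω)) (fun s => D.previewInput P p x₀ (fun s => w s ω) s)) atTop
      (𝓝 (D.previewCost P p)) := by
  have hcl := Data.isClosedLoop_preview (D := D) (P := P) (μ := μ) hw.measurable p x₀
  have hst := Data.isStabilized_preview hw hP p x₀
  have hx := fun i j => hcl.ae_tendstoAvg hst hw i j
  simp only [← ae_all_iff] at hx
  filter_upwards [hw.ae_hasWhiteAverages, hx] with ω h1 h2
  refine hP.tendsto_avgCost_preview h1 p (fun t => rfl) (fun t => ?_) h2
  exact (congrArg (D.previewLaw P p (fun s => w s ω) t)
    (congrFun (Data.state_previewInput p x₀ fun s => w s ω) t)).symm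

/-- The constant is an almost sure limit of nonnegative averages; a probability space supplies a
path realizing it. Hence truncation by `toNNReal` changes nothing. -/
theorem Data.previewCost_nonneg (hw : IsWhiteNoise μ w) (hQ : D.Q.PosSemidef) (hR : D.R.PosDef)
    (hP : D.IsStabilizingSolution P) (p : ℕ) : 0 ≤ D.previewCost P p := by
  obtain ⟨ω, hω⟩ := (Data.ae_tendsto_avgCost_preview hw hP p 0).exists
  exact ge_of_tendsto' hω fun T => D.avgCost_nonneg hQ hR _ _ T

theorem initialInfo_le (hw : ∀ t, Measurable (w t)) (p : ℕ) :
    initialInfo p w ≤ (inferInstance : MeasurableSpace Ω) :=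
  iSup_le fun s => (hw s).comap_le

/-- The comparison already holds pathwise with a deterministic constant, so conditioning on the
initial information preserves it. -/
theorem Data.isOptimalPreviewCost (hw : IsWhiteNoise μ w) (hP : D.IsStabilizingSolution P)
    (x₀ : Fin nx → ℝ) (p : ℕ) :
    D.IsOptimalPreviewCost μ w x₀ p (D.previewCost P p).toNNReal := by
  have hle := initialInfo_le hw.measurable p
  have hconst : condLExp (initialInfo p w) μ (fun _ : Ω => ENNReal.ofReal (D.previewCost P p)) =
      fun _ => ENNReal.ofReal (D.previewCost P p) := condLExp_const hle μ _
  have hlim := Data.ae_tendsto_avgCost_preview hw hP p x₀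
  refine ⟨⟨D.previewPolicy P p, fun t ω => D.previewInput P p x₀ (fun s => w s ω) t,
    Data.isClosedLoop_preview hw.measurable p x₀, Data.isStabilized_preview hw hP p x₀,
    hlim.mono fun ω h => ⟨_, h⟩, ?_⟩, fun K u hcl hst => ?_⟩
  · refine (condLExp_congr_ae (Y := fun _ => ENNReal.ofReal (D.previewCost P p)) ?_).trans ?_
    · exact hlim.mono fun ω h => Data.longRunCost_of_tendsto h
    · rw [hconst]
      rfl
  · have := condLExp_mono (mΩ := initialInfo p w) (hcl.ae_previewCost_le hst hw hP)
    rw [hconst] at this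
    exact this

end Preview

/-! ### The noncausal controller -/

section Noncausal

variable {nx nu nw : ℕ} {D : Data nx nu nw} {P : Matrix (Fin nx) (Fin nx) ℝ}
  {Ω : Type*} [MeasurableSpace Ω] {μ : Measure Ω} {w : ℕ → Ω → Fin nw → ℝ}

/-- The squares of the entries of a row of `M ^ (l + 1) * B` are summable. -/
theorem PowDecay.exists_sum_sq_le {m n : ℕ} {M : Matrix (Fin m) (Fin m) ℝ} (h : PowDecay M)
    (B : Matrix (Fin m) (Fin n) ℝ) (i : Fin m) :
    ∃ K : ℝ, ∀ N, ∑ l ∈ Finset.range N, ∑ c, (M ^ (l + 1) * B) i c ^ 2 ≤ K := by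
  obtain ⟨C, r, hC, h0, h1, hM⟩ := h.exists_mulVec_le
  have hr : r ^ 2 < 1 := pow_lt_one₀ h0.le h1 two_ne_zero
  have hb : ∀ l c, (M ^ (l + 1) * B) i c ^ 2 ≤ (C * ‖B.col c‖) ^ 2 * (r ^ 2) ^ l := fun l c => by
    have e : (M ^ (l + 1) * B) i c = (M ^ (l + 1) *ᵥ B.col c) i := rfl
    rw [e, ← pow_mul, mul_comm 2 l, pow_mul, ← mul_pow, ← sq_abs]
    refine pow_le_pow_left₀ (abs_nonneg _) ((norm_le_pi_norm _ i).trans ((hM _ _).trans ?_)) 2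
    rw [mul_right_comm]
    exact mul_le_mul_of_nonneg_left (pow_le_pow_of_le_one h0.le h1.le l.le_succ) (by positivity)
  refine ⟨(∑ c, (C * ‖B.col c‖) ^ 2) * (1 - r ^ 2)⁻¹, fun N => ?_⟩
  calc ∑ l ∈ Finset.range N, ∑ c, (M ^ (l + 1) * B) i c ^ 2
      ≤ ∑ l ∈ Finset.range N, ∑ c, (C * ‖B.col c‖) ^ 2 * (r ^ 2) ^ l :=
        Finset.sum_le_sum fun l _ => Finset.sum_le_sum fun c _ => hb l c
    _ = (∑ c, (C * ‖B.col c‖) ^ 2) * ∑ l ∈ Finset.range N, (r ^ 2) ^ l := by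
        simp only [← Finset.sum_mul, ← Finset.mul_sum]
    _ ≤ _ := by
        refine mul_le_mul_of_nonneg_left ?_ (by positivity)
        rw [← tsum_geometric_of_lt_one (by positivity) hr]
        exact (summable_geometric_of_lt_one (by positivity) hr).sum_le_tsum _
          fun _ _ => by positivity

theorem IsWhiteNoise.ae_summable_vTerm (hw : IsWhiteNoise μ w) (hd : PowDecay (D.Ahat P)) :
    ∀ᵐ ω ∂μ, ∀ t, Summable (D.vTerm P (fun s => w s ω) t) :=
  hw.ae_hasWhiteAverages.mono fun _ h => h.sqrtLittle.summable_vTerm hd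

/-- `v (t + 1)` is a series in noise after `t` with square summable coefficients, so the backward
strong law applies. -/
theorem IsWhiteNoise.ae_tendstoAvg_vNC (hw : IsWhiteNoise μ w) (hd : PowDecay (D.Ahat P))
    (i : Fin nx) (j : Fin nw) :
    ∀ᵐ ω ∂μ, TendstoAvg (fun t => D.vNC P (fun s => w s ω) (t + 1) i * w t ω j) 0 := by
  obtain ⟨K, hK⟩ := hd.transpose.exists_sum_sq_le (P * D.Bw) i
  refine hw.ae_tendsto_avg_mul_series (fun l c => ((D.Ahat P)ᵀ ^ (l + 1) * (P * D.Bw)) i c) hK j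
    (ζ := fun t ω => D.vNC P (fun s => w s ω) (t + 1) i) ?_
  filter_upwards [hw.ae_summable_vTerm hd] with ω h t
  have h1 := ((continuous_apply i).tendsto _).comp (h (t + 1)).hasSum.tendsto_sum_nat
  refine h1.congr fun n => ?_
  simp only [Function.comp_apply, Finset.sum_apply, Data.vTerm, Matrix.mul_assoc]
  rfl

theorem Data.ae_tendsto_avgCost_nc (hw : IsWhiteNoise μ w) (hP : D.IsStabilizingSolution P)
    {X : Matrix (Fin nx) (Fin nx) ℝ} (hX : D.IsLyapunovSolution P X) (x₀ : Fin nx → ℝ) :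
    ∀ᵐ ω ∂μ, Tendsto (D.avgCost (D.ncState P x₀ (fun s => w s ω))
      (D.ncInput P x₀ (fun s => w s ω))) atTop (𝓝 (D.noncausalCost P X)) := by
  have hv := fun i j => hw.ae_tendstoAvg_vNC hP.schur.powDecay i j
  simp only [← ae_all_iff] at hv
  filter_upwards [hw.ae_hasWhiteAverages, hv] with ω h1 h2
  exact hP.tendsto_avgCost_nc hX h1 h2 x₀

variable [IsProbabilityMeasure μ]

theorem Data.noncausalCost_nonneg (hw : IsWhiteNoise μ w) (hQ : D.Q.PosSemidef) (hR : D.R.PosDef)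
    (hP : D.IsStabilizingSolution P) {X : Matrix (Fin nx) (Fin nx) ℝ}
    (hX : D.IsLyapunovSolution P X) : 0 ≤ D.noncausalCost P X := by
  obtain ⟨ω, hω⟩ := (Data.ae_tendsto_avgCost_nc hw hP hX 0).exists
  exact ge_of_tendsto' hω fun T => D.avgCost_nonneg hQ hR _ _ T

theorem Data.isNoncausalCost (hw : IsWhiteNoise μ w) (hP : D.IsStabilizingSolution P)
    {X : Matrix (Fin nx) (Fin nx) ℝ} (hX : D.IsLyapunovSolution P X) (x₀ : Fin nx → ℝ) :
    D.IsNoncausalCost P μ w x₀ (D.noncausalCost P X).toNNReal := by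
  have hlim := Data.ae_tendsto_avgCost_nc hw hP hX x₀
  refine ⟨hw.ae_summable_vTerm hP.schur.powDecay, hlim.mono fun ω h => ⟨_, h⟩, ?_⟩
  rw [lintegral_congr_ae (hlim.mono fun ω h => Data.longRunCost_of_tendsto h)]
  simp [ENNReal.ofReal]

end Noncausal

end PreviewLQR
-- The main theorem
theorem mainTheorem6 {nx nu nw : ℕ} (D : Data nx nu nw)
    (hA : IsUnit D.A) (hstab : Stabilizable D.A D.Bu) (hdet : Detectable D.A D.Q)
    (hQ : D.Q.PosSemidef) (hR : D.R.PosDef)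
    {Ω : Type*} [MeasurableSpace Ω] (μ : Measure Ω) [IsProbabilityMeasure μ]
    (w : ℕ → Ω → Fin nw → ℝ) (hw : IsWhiteNoise μ w) :
    (∃! P, D.IsStabilizingSolution P) ∧
    ∀ P, D.IsStabilizingSolution P →
      (∃! X, D.IsLyapunovSolution P X) ∧
      ∀ X, D.IsLyapunovSolution P X →
        X.PosSemidef ∧ (D.Y P).PosSemidef ∧
        ∃ (Jp : ℕ → ℝ≥0) (Jnc : ℝ≥0),
          (∀ x₀ p, D.IsOptimalPreviewCost μ w x₀ p (Jp p)) ∧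
          (∀ x₀, D.IsNoncausalCost P μ w x₀ Jnc) ∧
          (∀ p, (Jp p : ℝ) - Jnc =
            Matrix.trace (D.Y P * (D.Ahat P)ᵀ ^ (p + 1) * X * D.Ahat P ^ (p + 1))) ∧
          (∀ p, lamMin (matSqrt X) ^ 2 * lamMin (matSqrt (D.Y P)) ^ 2 *
            frobNorm (D.Ahat P ^ (p + 1)) ^ 2 ≤ (Jp p : ℝ) - Jnc) ∧
          (∀ p, (Jp p : ℝ) - Jnc ≤ frobNorm (matSqrt X) ^ 2 * frobNorm (matSqrt (D.Y P)) ^ 2 *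
            frobNorm (D.Ahat P ^ (p + 1)) ^ 2) ∧
          specRad (D.Ahat P) < 1 ∧
          (∀ p, lamMin X * lamMin (D.Y P) * specRad (D.Ahat P) ^ (2 * (p + 1)) ≤
            (Jp p : ℝ) - Jnc) ∧
          (∀ r : ℝ, specRad (D.Ahat P) < r →
            ∃ C : ℝ, ∀ p, (Jp p : ℝ) - Jnc ≤ C * r ^ (2 * (p + 1))) := by
  refine ⟨D.existsUnique_isStabilizingSolution hstab hdet hQ hR, fun P hP => ?_⟩
  have hd := hP.schur.powDecay
  have hPs := posSemidef_transpose_eq hP.posSemidef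
  obtain ⟨X₀, hX₀⟩ := hd.exists_lyapunov (P * D.Bw * D.Bwᵀ * P)
  refine ⟨⟨X₀, hX₀, fun X hX => hd.lyapunov_unique hX hX₀⟩, fun X hX => ?_⟩
  have hW : (P * D.Bw * D.Bwᵀ * P).PosSemidef := by
    have := posSemidef_transpose_mul_mul Matrix.PosSemidef.one (D.Bwᵀ * P)
    rwa [Matrix.mul_one, Matrix.transpose_mul, Matrix.transpose_transpose, hPs,
      ← Matrix.mul_assoc] at this
  have hXs := hd.lyapunov_posSemidef hW hX
  have hY := hP.Y_posSemidef
  -- Nonnegativity of both costs makes the `toNNReal` coercions exact, which reduces the gap to the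
  -- trace identity.
  have hgap : ∀ p, ((D.previewCost P p).toNNReal : ℝ) - (D.noncausalCost P X).toNNReal =
      Matrix.trace (D.Y P * (D.Ahat P)ᵀ ^ (p + 1) * X * D.Ahat P ^ (p + 1)) := fun p => by
    rw [Real.coe_toNNReal _ (Data.previewCost_nonneg hw hQ hR hP p),
      Real.coe_toNNReal _ (Data.noncausalCost_nonneg hw hQ hR hP hX),
      D.previewCost_sub_noncausalCost hPs hX]
  have hbd := fun p => trace_gap_bounds hXs hY (D.Ahat P ^ (p + 1))
  simp only [Matrix.transpose_pow, ← hgap] at hbd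
  refine ⟨hXs, hY, fun p => (D.previewCost P p).toNNReal, (D.noncausalCost P X).toNNReal,
    fun x₀ p => Data.isOptimalPreviewCost hw hP x₀ p, Data.isNoncausalCost hw hP hX, hgap,
    fun p => (hbd p).1, fun p => (hbd p).2, (isSchur_iff_specRad_lt_one _).2.1 hP.schur,
    fun p => (lamMin_mul_specRad_le hXs hY _ p).trans (hbd p).1, fun r hr => ?_⟩
  obtain ⟨C, hC⟩ := exists_frobNorm_pow_sq_le _ hr
  refine ⟨frobNorm (matSqrt X) ^ 2 * frobNorm (matSqrt (D.Y P)) ^ 2 * C, fun p => ?_⟩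
  refine (hbd p).2.trans ?_
  rw [mul_assoc _ C]
  exact mul_le_mul_of_nonneg_left (hC (p + 1)) (by positivity)
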